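/- Let $K$ be a nonarchimedean field of characteristic $0$, i.e. a field of characteristic $0$ that is complete with respect to a nontrivial nonarchimedean absolute value. Let $G$ be a (finite-dimensional) locally $K$-analytic Lie group with $K$-Lie algebra $\mathfrak g$, and let $V$ be a separated, barrelled, locally convex $K$-vector space (barrelled: every closed convex absorbing subset is open) with a locally analytic representation $G\to\operatorname{Aut}(V)$, i.e. an action by continuous linear automorphisms all of whose orbit maps $g\mapsto gv$ are analytic. Here a function $f\colon X\to V$ on a locally $K$-analytic manifold is called analytic if every $x\in X$ has a neighbourhood on which $f$ factors as an analytic map into a $K$-Banach space $W$ (locally given in charts by convergent power series with coefficients in $W$) followed by a continuous linear injection $W\hookrightarrow V$. For an open subgroup $G'\subseteq G$ let $H^n_{\mathrm{an}}(G',V)$ be the locally analytic group cohomology: the $n$-th cohomology of the complex of homogeneous analytic cochains, whose term in degree $p$ is the space of analytic functions $f\colon (G')^{p+1}\to V$ with $f(gg_0,\dots,gg_p)=g\,f(g_0,\dots,g_p)$, with differential $(\delta f)(g_0,\dots,g_{p+1})=\sum_{i=0}^{p+1}(-1)^i f(g_0,\dots,\widehat{g_i},\dots,g_{p+1})$. Let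 $H^n(\mathfrak g,V)$ be the Lie algebra cohomology, i.e. the cohomology of the Chevalley–Eilenberg complex $\operatorname{Hom}_K(\bigwedge^{\bullet}\mathfrak g,V)$, where $\mathfrak g$ acts on $V$ by differentiating the orbit maps at $1$. Then for every $n\ge 0$ there are $K$-linear isomorphisms $$\operatorname*{colim}_{G'\subseteq G\ \mathrm{open}} H^n_{\mathrm{an}}(G',V)\;\cong\; H^n(\mathfrak g,V),$$ where the colimit is taken over the system of open subgroups of $G$ with respect to restriction. These isomorphisms are natural in the pair $(G,V)$: if $(G_1,V_1)$ is a second such pair, $\varphi\colon G\to G_1$ is an analytic homomorphism and $T\colon V_1\to V$ is a continuous linear map with $T(\varphi(g)v)=g\,T(v)$ for all $g\in G$, $v\in V_1$, then they are compatible with the map on colimits induced by $f\mapsto T\circ f\circ(\varphi\times\dots\times\varphi)$ (from an open subgroup $G_1'$ of $G_1$ to $\varphi^{-1}(G_1')$) and the map $H^n(\mathfrak g_1,V_1)\to H^n(\mathfrak g,V)$ induced by $z\mapsto T\circ z\circ(d\varphi\times\dots\times d\varphi)$. -/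

import Mathlib

open scoped Manifold ContDiff Topology

universe w u v

noncomputable section

namespace LocAn

/-! ### Locally convex and barrelled spaces over a nonarchimedean field -/

section LocallyConvex

variable (K : Type w) [NontriviallyNormedField K] {V : Type v} [AddCommGroup V] [Module K V]

/-- `L` is a submodule of `V` over the ring of integers `{a : K | ‖a‖ ≤ 1}` of `K`. -/
structure IsIntegralSubmodule (L : Set V) : Prop where
  zero_mem : (0 : V) ∈ L
  add_mem : ∀ x ∈ L, ∀ y ∈ L, x + y ∈ L
  smul_mem : ∀ a : K, ‖a‖ ≤ 1 → ∀ x ∈ L, a • x ∈ L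

/-- A lattice: an absorbing submodule over the ring of integers. Over a nonarchimedean field the
nonempty convex sets are the translates of submodules over the ring of integers, and an absorbing
set contains `0`, so that the lattices are precisely the convex absorbing subsets. -/
structure IsLattice (L : Set V) : Prop extends IsIntegralSubmodule K L where
  absorbing : ∀ x : V, ∃ a : K, a ≠ 0 ∧ a • x ∈ L

variable (V) [TopologicalSpace V]

/-- The topology of the topological `K`-vector space `V` is locally convex in the nonarchimedean
sense: `0` has a fundamental system of neighbourhoods consisting of submodules over the ring of
integers of `K`. -/
def IsLocallyConvex : Prop :=
  ∀ U ∈ 𝓝 (0 : V), ∃ L ∈ 𝓝 (0 : V), L ⊆ U ∧ IsIntegralSubmodule K L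

/-- `V` is barrelled: every closed convex absorbing subset is open. -/
def IsBarrelled : Prop :=
  ∀ L : Set V, IsLattice K L → IsClosed L → IsOpen L

end LocallyConvex

/-! ### Locally analytic functions with values in a locally convex space -/

theorem isUltrametricDist_quotient {K : Type*} [NontriviallyNormedField K] {W : Type*}
    [NormedAddCommGroup W] [NormedSpace K W] [IsUltrametricDist W] (S : Submodule K W)
    [IsClosed (S : Set W)] : IsUltrametricDist (W ⧸ S) := by
  refine IsUltrametricDist.isUltrametricDist_of_forall_norm_add_le_max_norm fun x y => ?_
  refine le_of_forall_pos_le_add fun ε hε => ?_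
  obtain ⟨a, rfl, ha⟩ := Submodule.Quotient.norm_mk_lt (S := S) x hε
  obtain ⟨b, rfl, hb⟩ := Submodule.Quotient.norm_mk_lt (S := S) y hε
  rw [← Submodule.Quotient.mk_add]
  refine (Submodule.Quotient.norm_mk_le S _).trans
    ((IsUltrametricDist.norm_add_le_max a b).trans ?_)
  rw [← max_add_add_right]
  exact max_le_max ha.le hb.le

section Analytic

variable {K : Type w} [NontriviallyNormedField K]
variable {E : Type*} [NormedAddCommGroup E] [NormedSpace K E] {H : Type*} [TopologicalSpace H]
  {M : Type*} [TopologicalSpace M] [ChartedSpace H M]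
variable {E' : Type*} [NormedAddCommGroup E'] [NormedSpace K E'] {H' : Type*}
  [TopologicalSpace H'] {M' : Type*} [TopologicalSpace M'] [ChartedSpace H' M']
variable {V : Type v} [AddCommGroup V] [Module K V] [TopologicalSpace V]

/-- The function `f : M → V` on a manifold is (locally) analytic at `x`: near `x` it factors as
`j ∘ h`, where `j : W → V` is a continuous linear injection of a `K`-Banach space `W` (with an
ultrametric norm), and where `h : M → W` is analytic at `x`, i.e. given in charts near `x` by a
convergent power series with coefficients in `W`. (As `W` injects into `V`, it is no restriction
to take `W` in the universe of `V`.) -/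
def IsLocAnalyticAt (I : ModelWithCorners K E H) (f : M → V) (x : M) : Prop :=
  ∃ (W : Type v) (_ : NormedAddCommGroup W) (_ : NormedSpace K W) (_ : CompleteSpace W)
    (_ : IsUltrametricDist W) (j : W →L[K] V) (h : M → W),
    Function.Injective j ∧ ContMDiffAt I 𝓘(K, W) ω h x ∧ ∀ᶠ y in 𝓝 x, f y = j (h y)

/-- `f : M → V` is (locally) analytic. -/
def IsLocAnalytic (I : ModelWithCorners K E H) (f : M → V) : Prop :=
  ∀ x, IsLocAnalyticAt I f x

theorem IsLocAnalyticAt.of_factor [T1Space V] {I : ModelWithCorners K E H} {f : M → V} {x : M}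
    {W : Type v} [NormedAddCommGroup W] [NormedSpace K W] [CompleteSpace W]
    [IsUltrametricDist W] (j : W →L[K] V) {h : M → W} (hh : ContMDiffAt I 𝓘(K, W) ω h x)
    (hf : ∀ᶠ y in 𝓝 x, f y = j (h y)) : IsLocAnalyticAt I f x := by
  let S : Submodule K W := LinearMap.ker (j : W →ₗ[K] V)
  have hS : IsClosed (S : Set W) := ContinuousLinearMap.isClosed_ker j
  let j' : (W ⧸ S) →L[K] V :=
    ⟨S.liftQ (j : W →ₗ[K] V) le_rfl, by exact Continuous.quotient_liftOn' j.continuous _⟩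
  refine ⟨W ⧸ S, inferInstance, inferInstance, inferInstance, isUltrametricDist_quotient S, j',
    fun y => S.mkQL (h y), ?_, ?_, ?_⟩
  · exact LinearMap.ker_eq_bot.1 (Submodule.ker_liftQ_eq_bot _ _ _ le_rfl)
  · exact S.mkQL.contMDiff.contMDiffAt.comp x hh
  · filter_upwards [hf] with y hy
    rw [hy]; rfl

theorem IsLocAnalyticAt.zero [T1Space V] (I : ModelWithCorners K E H) (x : M) :
    IsLocAnalyticAt I (fun _ : M => (0 : V)) x := by
  have : IsUltrametricDist PUnit.{v + 1} := ⟨fun _ _ _ => by simp⟩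
  exact IsLocAnalyticAt.of_factor (W := PUnit) (h := fun _ => 0) 0 contMDiffAt_const (by simp)

theorem IsLocAnalyticAt.add [T1Space V] [ContinuousAdd V] {I : ModelWithCorners K E H}
    {f g : M → V} {x : M} (hf : IsLocAnalyticAt I f x) (hg : IsLocAnalyticAt I g x) :
    IsLocAnalyticAt I (fun y => f y + g y) x := by
  obtain ⟨W₁, _, _, _, _, j₁, h₁, -, c₁, e₁⟩ := hf
  obtain ⟨W₂, _, _, _, _, j₂, h₂, -, c₂, e₂⟩ := hg
  have : IsUltrametricDist (W₁ × W₂) :=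
    IsUltrametricDist.isUltrametricDist_of_forall_norm_add_le_max_norm fun a b => by
      simp only [Prod.norm_def, Prod.fst_add, Prod.snd_add]
      have := IsUltrametricDist.norm_add_le_max a.1 b.1
      have := IsUltrametricDist.norm_add_le_max a.2 b.2
      grind
  refine IsLocAnalyticAt.of_factor (j₁.coprod j₂) (h := fun y => (h₁ y, h₂ y)) ?_ ?_
  · exact c₁.prodMk_space c₂
  · filter_upwards [e₁, e₂] with y a b
    simp [a, b]

theorem IsLocAnalyticAt.clm_comp {V' : Type v} [AddCommGroup V'] [Module K V']
    [TopologicalSpace V'] [T1Space V'] {I : ModelWithCorners K E H} {f : M → V} {x : M}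
    (T : V →L[K] V') (hf : IsLocAnalyticAt I f x) : IsLocAnalyticAt I (fun y => T (f y)) x := by
  obtain ⟨W₁, _, _, _, _, j₁, h₁, -, c₁, e₁⟩ := hf
  refine IsLocAnalyticAt.of_factor (T.comp j₁) c₁ ?_
  filter_upwards [e₁] with y a
  simp [a]

theorem IsLocAnalyticAt.comp {I : ModelWithCorners K E H} {I' : ModelWithCorners K E' H'}
    {f : M → V} {φ : M' → M} {x : M'} (hf : IsLocAnalyticAt I f (φ x))
    (hφ : ContMDiffAt I' I ω φ x) : IsLocAnalyticAt I' (fun y => f (φ y)) x := by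
  obtain ⟨W₁, _, _, _, _, j₁, h₁, i₁, c₁, e₁⟩ := hf
  exact ⟨W₁, _, _, ‹_›, ‹_›, j₁, fun y => h₁ (φ y), i₁, c₁.comp x hφ,
    hφ.continuousAt.eventually e₁⟩

theorem contMDiff_pi_reindex {ι κ : Type*} [Fintype ι] [Fintype κ]
    {I : ModelWithCorners K E H} {I' : ModelWithCorners K E' H'} {φ : M → M'}
    (hφ : ContMDiff I I' ω φ) (σ : κ → ι) :
    ContMDiff (ModelWithCorners.pi fun _ : ι => I) (ModelWithCorners.pi fun _ : κ => I') ω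
      (fun (x : ι → M) (k : κ) => φ (x (σ k))) := by
  intro x
  rw [contMDiffAt_iff]
  refine ⟨(continuous_pi fun k => hφ.continuous.comp (continuous_apply _)).continuousAt, ?_⟩
  rw [contDiffWithinAt_pi]
  intro k
  have h1 := (contMDiffAt_iff.1 (hφ (x (σ k)))).2
  have h2 : ContDiffWithinAt K ω (fun y : ι → E => y (σ k))
      (Set.range (ModelWithCorners.pi fun _ : ι => I))
      (extChartAt (ModelWithCorners.pi fun _ : ι => I) x x) :=
    (contDiff_apply K E (σ k)).contDiffWithinAt
  refine ContDiffWithinAt.comp (t := Set.range I)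
    (f := fun y : ι → E => y (σ k))
    (g := extChartAt I' (φ (x (σ k))) ∘ φ ∘ (extChartAt I (x (σ k))).symm) _ h1 h2 ?_
  rintro _ ⟨y, rfl⟩
  exact ⟨y (σ k), rfl⟩

theorem hasFDerivAt_clm_comp {W : Type*} [AddCommGroup W] [Module K W] [TopologicalSpace W]
    (j : W →L[K] V) {h : E → W} {h' : E →L[K] W} {x : E} (hh : HasFDerivAt h h' x) :
    HasFDerivAt (fun y => j (h y)) (j.comp h') x := by
  rw [hasFDerivAt_iff_isLittleOTVS] at hh ⊢
  refine ((j.isBigOTVS_fun_comp).trans_isLittleOTVS hh).congr_left fun y => ?_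
  simp

theorem hasFDerivAt_add [ContinuousAdd V] [ContinuousSMul K V] {f g : E → V} {f' g' : E →L[K] V}
    {x : E} (hf : HasFDerivAt f f' x) (hg : HasFDerivAt g g' x) :
    HasFDerivAt (fun y => f y + g y) (f' + g') x := by
  rw [hasFDerivAt_iff_isLittleOTVS] at hf hg ⊢
  refine (hf.add hg).congr_left fun y => ?_
  simp only [add_apply, Pi.add_apply]
  abel

theorem IsLocAnalyticAt.differentiableAt {E : Type*} [NormedAddCommGroup E] [NormedSpace K E]
    {M : Type*} [TopologicalSpace M] [ChartedSpace E M] {f : M → V} {x : M}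
    (hf : IsLocAnalyticAt 𝓘(K, E) f x) :
    DifferentiableAt K (fun y : E => f ((extChartAt 𝓘(K, E) x).symm y))
      (extChartAt 𝓘(K, E) x x) := by
  obtain ⟨W, _, _, _, _, j, h, -, c, e⟩ := hf
  have h1 := (contMDiffAt_iff.1 c).2
  simp only [modelWithCornersSelf_coe, Set.range_id, contDiffWithinAt_univ] at h1
  obtain ⟨h', h2⟩ := h1.differentiableAt (by simp)
  have h3 := (hasFDerivAt_clm_comp j h2).isLittleOTVS
  have hc : Filter.Tendsto (extChartAt 𝓘(K, E) x).symm (𝓝 (extChartAt 𝓘(K, E) x x)) (𝓝 x) := by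
    have := (continuousAt_extChartAt_symm (I := 𝓘(K, E)) x)
    rwa [ContinuousAt, extChartAt_to_inv] at this
  refine ⟨j.comp h', HasFDerivAt.of_isLittleOTVS (h3.congr' ?_ Filter.EventuallyEq.rfl)⟩
  filter_upwards [hc.eventually e] with y hy
  have hx : f x = j (h x) := e.self_of_nhds
  simp only [Function.comp_apply, extChartAt_to_inv, hy, hx, extChartAt_model_space_eq_id,
    PartialEquiv.refl_coe, id]

end Analytic

/-! ### Cohomology of a sequence of linear maps -/

section Cohomology

variable {K : Type*} [Field K]
variable {C : ℕ → Type*} [∀ n, AddCommGroup (C n)] [∀ n, Module K (C n)]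
variable {C' : ℕ → Type*} [∀ n, AddCommGroup (C' n)] [∀ n, Module K (C' n)]

/-- The image of the incoming differential in degree `n`. -/
def coboundaries (d : ∀ n, C n →ₗ[K] C (n + 1)) : ∀ n, Submodule K (C n)
  | 0 => ⊥
  | n + 1 => LinearMap.range (d n)

/-- The cohomology `ker d / im d` in degree `n` of the complex `(C, d)`. -/
abbrev Cohomology (d : ∀ n, C n →ₗ[K] C (n + 1)) (n : ℕ) : Type _ :=
  LinearMap.ker (d n) ⧸ (coboundaries d n).submoduleOf (LinearMap.ker (d n))

/-- The class of a cocycle. -/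
def Cohomology.mk (d : ∀ n, C n →ₗ[K] C (n + 1)) {n : ℕ} (z : C n) (hz : d n z = 0) :
    Cohomology d n :=
  Submodule.Quotient.mk ⟨z, hz⟩

/-- The map induced on cohomology by a morphism of complexes. -/
def Cohomology.map {d : ∀ n, C n →ₗ[K] C (n + 1)} {d' : ∀ n, C' n →ₗ[K] C' (n + 1)}
    (F : ∀ n, C n →ₗ[K] C' n) (hF : ∀ n x, F (n + 1) (d n x) = d' n (F n x)) (n : ℕ) :
    Cohomology d n →ₗ[K] Cohomology d' n :=
  Submodule.mapQ _ _
    ((F n).restrict (p := LinearMap.ker (d n)) (q := LinearMap.ker (d' n)) fun x hx => by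
      rw [LinearMap.mem_ker] at hx ⊢
      rw [← hF, hx, map_zero]) (by
    rintro ⟨x, hx⟩ h
    cases n with
    | zero =>
      have h0 : x = 0 := h
      subst h0
      change F 0 0 ∈ (⊥ : Submodule K (C' 0))
      simp
    | succ n =>
      obtain ⟨y, rfl⟩ : ∃ y, d n y = x := h
      exact ⟨F n y, (hF n y).symm⟩)

theorem Cohomology.map_mk {d : ∀ n, C n →ₗ[K] C (n + 1)} {d' : ∀ n, C' n →ₗ[K] C' (n + 1)}
    (F : ∀ n, C n →ₗ[K] C' n) (hF : ∀ n x, F (n + 1) (d n x) = d' n (F n x)) {n : ℕ}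
    (z : C n) (hz : d n z = 0) :
    Cohomology.map F hF n (Cohomology.mk d z hz) =
      Cohomology.mk d' (F n z) (by rw [← hF, hz, map_zero]) := rfl

end Cohomology

/-! ### The Chevalley-Eilenberg complex -/

section ChevalleyEilenberg

variable {K : Type*} [Field K] {L : Type*} [LieRing L] [LieAlgebra K L]
  {V : Type*} [AddCommGroup V] [Module K V]

/-- The part `φ ↦ ∑ i, (-1) ^ i • x_i · φ(…, x̂_i, …)` of the Chevalley-Eilenberg differential,
for an operation `a` of `L` on `V`. -/
def ceDiff₁ (a : L →ₗ[K] V →ₗ[K] V) (n : ℕ) :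
    (L [⋀^Fin n]→ₗ[K] V) →ₗ[K] (L [⋀^Fin (n + 1)]→ₗ[K] V) where
  toFun φ := AlternatingMap.alternatizeUncurryFin
    { toFun := fun x => (a x).compAlternatingMap φ
      map_add' := fun x y => by ext; simp
      map_smul' := fun c x => by ext; simp }
  map_add' φ ψ := by
    ext; simp [AlternatingMap.alternatizeUncurryFin_apply, Finset.sum_add_distrib]
  map_smul' c φ := by
    ext; simp [AlternatingMap.alternatizeUncurryFin_apply, Finset.smul_sum, smul_comm _ c]

/-- The part of the Chevalley-Eilenberg differential that involves the Lie bracket, on cochains of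
positive degree; see `ceDiff₂_apply` for the formula. -/
def ceDiff₂ (n : ℕ) : (L [⋀^Fin (n + 1)]→ₗ[K] V) →ₗ[K] (L [⋀^Fin (n + 2)]→ₗ[K] V) where
  toFun φ := (2⁻¹ : K) • AlternatingMap.alternatizeUncurryFin
    (AlternatingMap.alternatizeUncurryFinLM ∘ₗ
      LinearMap.compr₂ (LieModule.toEnd K L L : L →ₗ[K] L →ₗ[K] L) φ.curryLeft)
  map_add' φ ψ := by
    ext
    simp only [AlternatingMap.alternatizeUncurryFin_alternatizeUncurryFinLM_comp_apply,
      AlternatingMap.smul_apply, AlternatingMap.add_apply, ← smul_add, ← Finset.sum_add_distrib]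
    simp only [LinearMap.compr₂_apply, AlternatingMap.curryLeft_add, LinearMap.add_apply,
      AlternatingMap.add_apply, add_sub_add_comm]
  map_smul' c φ := by
    ext
    simp only [AlternatingMap.alternatizeUncurryFin_alternatizeUncurryFinLM_comp_apply,
      AlternatingMap.smul_apply, RingHom.id_apply]
    rw [smul_comm c]
    simp only [Finset.smul_sum, LinearMap.compr₂_apply, AlternatingMap.curryLeft_smul,
      LinearMap.smul_apply, AlternatingMap.smul_apply, ← smul_sub, smul_comm c]

/-- The differential of the Chevalley-Eilenberg complex `Hom(⋀ⁿ L, V)` of alternating maps;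
see `ceDiff_zero_apply` and `ceDiff_succ_apply` for the formulas. -/
def ceDiff (a : L →ₗ[K] V →ₗ[K] V) :
    ∀ n : ℕ, (L [⋀^Fin n]→ₗ[K] V) →ₗ[K] (L [⋀^Fin (n + 1)]→ₗ[K] V)
  | 0 => ceDiff₁ a 0
  | n + 1 => ceDiff₁ a (n + 1) - ceDiff₂ n

theorem ceDiff₁_apply (a : L →ₗ[K] V →ₗ[K] V) (n : ℕ) (φ : L [⋀^Fin n]→ₗ[K] V)
    (x : Fin (n + 1) → L) :
    ceDiff₁ a n φ x =
      ∑ i : Fin (n + 1), (-1 : ℤ) ^ (i : ℕ) • a (x i) (φ (i.removeNth x)) := by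
  simp [ceDiff₁, AlternatingMap.alternatizeUncurryFin_apply]

theorem ceDiff₂_apply [CharZero K] (n : ℕ) (φ : L [⋀^Fin (n + 1)]→ₗ[K] V)
    (x : Fin (n + 2) → L) :
    ceDiff₂ n φ x = ∑ i : Fin (n + 1), ∑ j ≥ i, (-1 : ℤ) ^ (i + j : ℕ) •
      φ (Matrix.vecCons ⁅x i.castSucc, x j.succ⁆ (j.removeNth (i.castSucc.removeNth x))) := by
  simp only [ceDiff₂, LinearMap.coe_mk, AddHom.coe_mk, AlternatingMap.smul_apply,
    AlternatingMap.alternatizeUncurryFin_alternatizeUncurryFinLM_comp_apply, Finset.smul_sum]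
  refine Finset.sum_congr rfl fun i _ => Finset.sum_congr rfl fun j _ => ?_
  rw [smul_comm]
  congr 1
  simp only [LinearMap.compr₂_apply, LieHom.coe_toLinearMap, LieModule.toEnd_apply_apply]
  rw [← AlternatingMap.curryLeft_apply_apply, ← lie_skew (x j.succ) (x i.castSucc), map_neg,
    AlternatingMap.neg_apply, sub_neg_eq_add, ← two_smul K, smul_smul,
    inv_mul_cancel₀ two_ne_zero, one_smul]

/-- In degree `0`: `(dφ)(x) = x · φ`. -/
theorem ceDiff_zero_apply (a : L →ₗ[K] V →ₗ[K] V) (φ : L [⋀^Fin 0]→ₗ[K] V) (x : Fin 1 → L) :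
    ceDiff a 0 φ x = a (x 0) (φ ![]) := by
  simp [ceDiff, ceDiff₁_apply, Subsingleton.elim (Fin.removeNth 0 x) ![]]

/-- In positive degree,
`(dφ)(x_0, …, x_{n+1}) = ∑_i (-1)^i x_i · φ(…, x̂_i, …)
  + ∑_{k < l} (-1)^{k+l} φ([x_k, x_l], …, x̂_k, …, x̂_l, …)`,
where the second sum is written with `k = i`, `l = j + 1`, whence the sign. -/
theorem ceDiff_succ_apply [CharZero K] (a : L →ₗ[K] V →ₗ[K] V) (n : ℕ)
    (φ : L [⋀^Fin (n + 1)]→ₗ[K] V) (x : Fin (n + 2) → L) :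
    ceDiff a (n + 1) φ x =
      ∑ i : Fin (n + 2), (-1 : ℤ) ^ (i : ℕ) • a (x i) (φ (i.removeNth x)) -
      ∑ i : Fin (n + 1), ∑ j ≥ i, (-1 : ℤ) ^ (i + j : ℕ) •
        φ (Matrix.vecCons ⁅x i.castSucc, x j.succ⁆ (j.removeNth (i.castSucc.removeNth x))) := by
  simp [ceDiff, ceDiff₁_apply, ceDiff₂_apply]

end ChevalleyEilenberg

/-! ### Locally analytic group cohomology -/

section GroupCohomology

variable {K : Type w} [NontriviallyNormedField K]
variable (d d' : ℕ) {G : Type*} [Group G] [TopologicalSpace G] [ChartedSpace (Fin d → K) G]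
  {G' : Type*} [Group G'] [TopologicalSpace G'] [ChartedSpace (Fin d' → K) G']
variable {V : Type v} [AddCommGroup V] [Module K V] [TopologicalSpace V] [IsTopologicalAddGroup V]
  [ContinuousSMul K V] [T2Space V]
variable {V' : Type v} [AddCommGroup V'] [Module K V'] [TopologicalSpace V']
  [IsTopologicalAddGroup V'] [ContinuousSMul K V'] [T2Space V']

/-- The space of homogeneous (locally) analytic `p`-cochains of the `d`-dimensional Lie group `G`
with coefficients in `V`: the analytic functions `f : G^{p+1} → V` with
`f (g g₀, …, g g_p) = g f (g₀, …, g_p)`. Here `G^{p+1}` is a manifold as a finite product of copies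
of `G`. -/
def anCochain (ρ : G →* (V ≃L[K] V)) (p : ℕ) : Submodule K ((Fin (p + 1) → G) → V) where
  carrier := {f | IsLocAnalytic (ModelWithCorners.pi fun _ : Fin (p + 1) => 𝓘(K, Fin d → K)) f ∧
    ∀ (g : G) (x : Fin (p + 1) → G), f (fun i => g * x i) = ρ g (f x)}
  zero_mem' := ⟨fun x => IsLocAnalyticAt.zero _ x, by simp⟩
  add_mem' hf hf' := ⟨fun x => (hf.1 x).add (hf'.1 x), fun g x => by simp [hf.2, hf'.2]⟩
  smul_mem' c f hf := ⟨fun x => (hf.1 x).clm_comp (c • ContinuousLinearMap.id K V),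
    fun g x => by simp [hf.2]⟩

theorem anCochain_face (ρ : G →* (V ≃L[K] V)) {p : ℕ} {f : (Fin (p + 1) → G) → V}
    (hf : f ∈ anCochain d ρ p) (i : Fin (p + 2)) :
    (fun x => f (i.removeNth x)) ∈ anCochain d ρ (p + 1) :=
  ⟨fun x => (hf.1 (i.removeNth x)).comp (contMDiff_pi_reindex contMDiff_id i.succAbove x),
    fun g x => hf.2 g (i.removeNth x)⟩

/-- The differential of the complex of homogeneous analytic cochains,
`(δf)(g₀, …, g_{p+1}) = ∑ i, (-1) ^ i f (g₀, …, ĝ_i, …, g_{p+1})`. -/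
def anDiff (ρ : G →* (V ≃L[K] V)) (p : ℕ) : anCochain d ρ p →ₗ[K] anCochain d ρ (p + 1) where
  toFun f := ⟨fun x => ∑ i : Fin (p + 2), (-1 : K) ^ (i : ℕ) • f.1 (i.removeNth x), by
    have h := Submodule.sum_mem (anCochain d ρ (p + 1)) (t := Finset.univ)
      (f := fun i : Fin (p + 2) => (-1 : K) ^ (i : ℕ) • fun x => f.1 (i.removeNth x))
      fun i _ => Submodule.smul_mem _ _ (anCochain_face d ρ f.2 i)
    convert h using 1
    ext x
    simp⟩
  map_add' f f' := by
    ext x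
    simp [Finset.sum_add_distrib]
  map_smul' c f := by
    ext x
    simp [Finset.smul_sum, smul_comm _ c]

/-- The locally analytic cohomology `Hⁿ_an(G, V)`. -/
abbrev anCohomology (ρ : G →* (V ≃L[K] V)) (n : ℕ) : Type _ :=
  Cohomology (C := fun n => anCochain d ρ n) (anDiff d ρ) n

variable {d d'}

/-- The map on homogeneous analytic cochains induced by an analytic homomorphism `φ : G → G'` and a
compatible continuous linear map `T : V' → V`. -/
def anCochainMap {ρ : G →* (V ≃L[K] V)} {ρ' : G' →* (V' ≃L[K] V')} (φ : G →* G')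
    (hφ : ContMDiff 𝓘(K, Fin d → K) 𝓘(K, Fin d' → K) ω φ) (T : V' →L[K] V)
    (hT : ∀ g v, T (ρ' (φ g) v) = ρ g (T v)) (p : ℕ) :
    anCochain d' ρ' p →ₗ[K] anCochain d ρ p where
  toFun f := ⟨fun x => T (f.1 fun i => φ (x i)),
    fun x => ((f.2.1 fun i => φ (x i)).comp (contMDiff_pi_reindex hφ id x)).clm_comp T,
    fun g x => by simp [f.2.2, hT]⟩
  map_add' f f' := by
    ext x
    simp
  map_smul' c f := by
    ext x
    simp

/-- The map on locally analytic cohomology induced by an analytic homomorphism `φ : G → G'` and a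
compatible continuous linear map `T : V' → V`. -/
def anCohomologyMap {ρ : G →* (V ≃L[K] V)} {ρ' : G' →* (V' ≃L[K] V')} (φ : G →* G')
    (hφ : ContMDiff 𝓘(K, Fin d → K) 𝓘(K, Fin d' → K) ω φ) (T : V' →L[K] V)
    (hT : ∀ g v, T (ρ' (φ g) v) = ρ g (T v)) (n : ℕ) :
    anCohomology d' ρ' n →ₗ[K] anCohomology d ρ n :=
  Cohomology.map (C := fun n => anCochain d' ρ' n) (C' := fun n => anCochain d ρ n)
    (anCochainMap φ hφ T hT) (fun p f => by
      ext x
      simp only [anCochainMap, anDiff, LinearMap.coe_mk, AddHom.coe_mk, map_sum, map_smul]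
      rfl) n

end GroupCohomology

/-! ### Open subgroups and the colimit of their cohomology -/

section OpenSubgroups

variable {K : Type w} [NontriviallyNormedField K]
variable {d d' : ℕ} {G : Type*} [Group G] [TopologicalSpace G] [ChartedSpace (Fin d → K) G]
  {G' : Type*} [Group G'] [TopologicalSpace G'] [ChartedSpace (Fin d' → K) G']
variable {V : Type v} [AddCommGroup V] [Module K V] [TopologicalSpace V] [IsTopologicalAddGroup V]
  [ContinuousSMul K V] [T2Space V]
variable {V' : Type v} [AddCommGroup V'] [Module K V'] [TopologicalSpace V']
  [IsTopologicalAddGroup V'] [ContinuousSMul K V'] [T2Space V']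

/-- An open subgroup is a manifold, as an open subset of `G`. -/
instance openSubgroupChartedSpace (U : OpenSubgroup G) : ChartedSpace (Fin d → K) U :=
  inferInstanceAs (ChartedSpace (Fin d → K) (U : TopologicalSpace.Opens G))

/-- The restriction of a representation of `G` to an open subgroup. -/
def resRep (ρ : G →* (V ≃L[K] V)) (U : OpenSubgroup G) : U →* (V ≃L[K] V) :=
  ρ.comp U.toSubgroup.subtype

/-- The homomorphism `U → U'` between open subgroups induced by `φ : G → G'`. -/
def resHom (φ : G →* G') (U : OpenSubgroup G) (U' : OpenSubgroup G')
    (h : ∀ g ∈ U, φ g ∈ U') : U →* U' :=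
  (φ.comp U.toSubgroup.subtype).codRestrict U'.toSubgroup fun g => h g g.2

theorem contMDiff_resHom {φ : G →* G'}
    (hφ : ContMDiff 𝓘(K, Fin d → K) 𝓘(K, Fin d' → K) ω φ) (U : OpenSubgroup G)
    (U' : OpenSubgroup G') (h : ∀ g ∈ U, φ g ∈ U') :
    ContMDiff 𝓘(K, Fin d → K) 𝓘(K, Fin d' → K) ω (resHom φ U U' h) := by
  intro x
  have h1 : ContMDiff 𝓘(K, Fin d → K) 𝓘(K, Fin d → K) ω
      (Subtype.val : ↥(U : TopologicalSpace.Opens G) → G) := contMDiff_subtype_val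
  have h2 := (hφ.comp h1) x
  have h3 := contMDiffAt_iff.1 h2
  exact contMDiffAt_iff.2 ⟨Topology.IsInducing.subtypeVal.continuousAt_iff.2 h3.1, h3.2⟩

/-- The map `Hⁿ_an(U', V') → Hⁿ_an(U, V)` for open subgroups `U` of `G` and `U'` of `G'`, an
analytic homomorphism `φ : G → G'` that maps `U` to `U'`, and a compatible `T : V' → V`. -/
def resMap {ρ : G →* (V ≃L[K] V)} {ρ' : G' →* (V' ≃L[K] V')} (φ : G →* G')
    (hφ : ContMDiff 𝓘(K, Fin d → K) 𝓘(K, Fin d' → K) ω φ) (T : V' →L[K] V)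
    (hT : ∀ g v, T (ρ' (φ g) v) = ρ g (T v)) (U : OpenSubgroup G) (U' : OpenSubgroup G')
    (h : ∀ g ∈ U, φ g ∈ U') (n : ℕ) :
    anCohomology d' (resRep ρ' U') n →ₗ[K] anCohomology d (resRep ρ U) n :=
  anCohomologyMap (resHom φ U U' h) (contMDiff_resHom hφ U U' h) T
    (fun g v => hT g v) n

/-- The restriction map `Hⁿ_an(U', V) → Hⁿ_an(U, V)` for open subgroups `U ≤ U'` of `G`. -/
def resOpen (ρ : G →* (V ≃L[K] V)) {U U' : OpenSubgroup G} (h : U ≤ U') (n : ℕ) :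
    anCohomology d (resRep ρ U') n →ₗ[K] anCohomology d (resRep ρ U) n :=
  resMap (MonoidHom.id G) contMDiff_id (ContinuousLinearMap.id K V) (fun g v => by simp)
    U U' (fun g hg => h hg) n

theorem resMap_resOpen {ρ : G →* (V ≃L[K] V)} {ρ' : G' →* (V' ≃L[K] V')} (φ : G →* G')
    (hφ : ContMDiff 𝓘(K, Fin d → K) 𝓘(K, Fin d' → K) ω φ) (T : V' →L[K] V)
    (hT : ∀ g v, T (ρ' (φ g) v) = ρ g (T v)) {U₁ U₂ : OpenSubgroup G} {U₁' U₂' : OpenSubgroup G'}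
    (h₁ : ∀ g ∈ U₁, φ g ∈ U₁') (h₂ : ∀ g ∈ U₂, φ g ∈ U₂') (h : U₁ ≤ U₂) (h' : U₁' ≤ U₂') (n : ℕ)
    (x : anCohomology d' (resRep ρ' U₂') n) :
    resMap φ hφ T hT U₁ U₁' h₁ n (resOpen ρ' h' n x) =
      resOpen ρ h n (resMap φ hφ T hT U₂ U₂' h₂ n x) := by
  obtain ⟨⟨f, hf⟩, rfl⟩ := Submodule.Quotient.mk_surjective _ x
  rfl

open Classical in
/-- The colimit of `Hⁿ_an(U, V)` over the system of open subgroups `U` of `G`, directed by reverse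
inclusion, with the restriction maps as transition maps. -/
abbrev colimAnCohomology (d : ℕ) [ChartedSpace (Fin d → K) G] (ρ : G →* (V ≃L[K] V)) (n : ℕ) :
    Type _ :=
  Module.DirectLimit (R := K) (ι := (OpenSubgroup G)ᵒᵈ)
    (fun U => anCohomology d (resRep ρ (OrderDual.ofDual U)) n)
    (fun U U' h => resOpen ρ (U := OrderDual.ofDual U') (U' := OrderDual.ofDual U) h n)

open Classical in
/-- The map on colimits over the open subgroups induced by an analytic homomorphism `φ : G → G'`
and a compatible continuous linear map `T : V' → V`: on the class of a cochain on the open subgroup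
`U'` of `G'` it is given by pulling back to the open subgroup `φ⁻¹(U')` of `G`. -/
def colimMap {ρ : G →* (V ≃L[K] V)} {ρ' : G' →* (V' ≃L[K] V')} (φ : G →* G')
    (hφ : ContMDiff 𝓘(K, Fin d → K) 𝓘(K, Fin d' → K) ω φ) (T : V' →L[K] V)
    (hT : ∀ g v, T (ρ' (φ g) v) = ρ g (T v)) (n : ℕ) :
    colimAnCohomology d' ρ' n →ₗ[K] colimAnCohomology d ρ n :=
  Module.DirectLimit.lift K _ _ _
    (fun U' => Module.DirectLimit.of K (OpenSubgroup G)ᵒᵈ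
        (fun U => anCohomology d (resRep ρ (OrderDual.ofDual U)) n) _
        (OrderDual.toDual ((OrderDual.ofDual U').comap φ hφ.continuous)) ∘ₗ
      resMap φ hφ T hT ((OrderDual.ofDual U').comap φ hφ.continuous) (OrderDual.ofDual U')
        (fun _ hg => hg) n)
    (fun U₁ U₂ h x => by
      have hle : (OrderDual.ofDual U₂).comap φ hφ.continuous ≤
          (OrderDual.ofDual U₁).comap φ hφ.continuous := fun g hg => h hg
      exact (congrArg _ (resMap_resOpen φ hφ T hT (fun _ hg => hg) (fun _ hg => hg) hle h n x)).trans
        (Module.DirectLimit.of_f (R := K) (ι := (OpenSubgroup G)ᵒᵈ)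
          (G := fun U => anCohomology d (resRep ρ (OrderDual.ofDual U)) n)
          (f := fun U U' h => resOpen ρ (U := OrderDual.ofDual U') (U' := OrderDual.ofDual U) h n)
          (i := OrderDual.toDual ((OrderDual.ofDual U₁).comap φ hφ.continuous))
          (j := OrderDual.toDual ((OrderDual.ofDual U₂).comap φ hφ.continuous)) (hij := hle)))

end OpenSubgroups

/-! ### The Lie algebra action -/

section LieAction

variable {K : Type w} [NontriviallyNormedField K]
variable (d : ℕ) {G : Type*} [Group G] [TopologicalSpace G] [ChartedSpace (Fin d → K) G]
variable {V : Type v} [AddCommGroup V] [Module K V] [TopologicalSpace V] [IsTopologicalAddGroup V]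
  [ContinuousSMul K V] [T2Space V]

/-- The representation `ρ` of `G` on `V` is locally analytic: all orbit maps `g ↦ ρ g v` are
analytic. -/
def IsLocAnalyticRep (ρ : G →* (V ≃L[K] V)) : Prop :=
  ∀ v : V, IsLocAnalytic 𝓘(K, Fin d → K) (fun g => ρ g v)

/-- The action of the Lie algebra of `G` on `V` obtained by differentiating the orbit maps at `1`:
`x · v` is the derivative at `1` of `g ↦ ρ g v` in the direction of the tangent vector `x`, computed
in the chart at `1` (by which the tangent space at `1` is identified with `Fin d → K`). -/
def lieAction {ρ : G →* (V ≃L[K] V)} (hρ : IsLocAnalyticRep d ρ) :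
    GroupLieAlgebra 𝓘(K, Fin d → K) G →ₗ[K] V →ₗ[K] V :=
  LinearMap.mk₂ K
    (fun x v => fderiv K (fun y : Fin d → K => ρ ((extChartAt 𝓘(K, Fin d → K) (1 : G)).symm y) v)
      (extChartAt 𝓘(K, Fin d → K) (1 : G) 1) x)
    (fun x x' v => map_add _ _ _) (fun c x v => map_smul _ _ _)
    (fun x v v' => by
      have h := hasFDerivAt_add (hρ v 1).differentiableAt.hasFDerivAt
        (hρ v' 1).differentiableAt.hasFDerivAt
      simp only [← map_add] at h
      rw [h.fderiv]
      rfl)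
    (fun c x v => by
      have h := hasFDerivAt_clm_comp (c • ContinuousLinearMap.id K V)
        (hρ v 1).differentiableAt.hasFDerivAt
      simp only [smul_apply, ContinuousLinearMap.id_apply, ← map_smul] at h
      rw [h.fderiv]
      rfl)

variable [CompleteSpace K] [LieGroup 𝓘(K, Fin d → K) ω G]

/-- The differential of the Chevalley-Eilenberg complex of the Lie algebra of `G` with coefficients
in the locally analytic representation `V`. -/
abbrev lieDiff {ρ : G →* (V ≃L[K] V)} (hρ : IsLocAnalyticRep d ρ) (n : ℕ) :
    (GroupLieAlgebra 𝓘(K, Fin d → K) G [⋀^Fin n]→ₗ[K] V) →ₗ[K]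
      (GroupLieAlgebra 𝓘(K, Fin d → K) G [⋀^Fin (n + 1)]→ₗ[K] V) :=
  ceDiff (lieAction d hρ) n

/-- The Lie algebra cohomology `Hⁿ(𝔤, V)`. -/
abbrev lieCohomology {ρ : G →* (V ≃L[K] V)} (hρ : IsLocAnalyticRep d ρ) (n : ℕ) : Type _ :=
  Cohomology (C := fun n => GroupLieAlgebra 𝓘(K, Fin d → K) G [⋀^Fin n]→ₗ[K] V) (lieDiff d hρ) n

end LieAction

/-! ### The pairs `(G, V)` -/

/-- A pair `(G, V)` of a locally `K`-analytic Lie group `G` (of finite dimension) and a locally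
analytic representation of `G` on a separated barrelled locally convex `K`-vector space `V`. -/
structure LocAnRep (K : Type w) [NontriviallyNormedField K] where
  /-- the dimension of the Lie group -/
  dim : ℕ
  /-- the Lie group -/
  G : Type u
  [group : Group G]
  [topG : TopologicalSpace G]
  [charted : ChartedSpace (Fin dim → K) G]
  [lieGroup : LieGroup 𝓘(K, Fin dim → K) ω G]
  /-- the space of the representation -/
  V : Type v
  [addCommGroup : AddCommGroup V]
  [module : Module K V]
  [topV : TopologicalSpace V]
  [topAddGroup : IsTopologicalAddGroup V]
  [continuousSMul : ContinuousSMul K V]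
  [separated : T2Space V]
  locallyConvex : IsLocallyConvex K V
  barrelled : IsBarrelled K V
  /-- the representation -/
  ρ : G →* (V ≃L[K] V)
  locAnalytic : IsLocAnalyticRep dim ρ

namespace LocAnRep

attribute [instance] group topG charted lieGroup addCommGroup module topV topAddGroup
  continuousSMul separated

variable {K : Type w} [NontriviallyNormedField K]

/-- A morphism from `(G, V)` to `(G', V')`: an analytic homomorphism `φ : G → G'` together with a
continuous linear map `T : V' → V` that is `G`-equivariant when `G` acts on `V'` through `φ`. -/
structure Hom (R S : LocAnRep.{w, u, v} K) where
  φ : R.G →* S.G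
  contMDiff : ContMDiff 𝓘(K, Fin R.dim → K) 𝓘(K, Fin S.dim → K) ω φ
  T : S.V →L[K] R.V
  map_smul : ∀ g v, T (S.ρ (φ g) v) = R.ρ g (T v)

variable {R S : LocAnRep.{w, u, v} K}

/-- The colimit of `Hⁿ_an(U, V)` over the open subgroups `U` of `G`. -/
abbrev colimH (R : LocAnRep.{w, u, v} K) (n : ℕ) : Type _ := colimAnCohomology R.dim R.ρ n

/-- The map on the colimits induced by a morphism of pairs. -/
def Hom.colimMap (m : Hom R S) (n : ℕ) : S.colimH n →ₗ[K] R.colimH n :=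
  LocAn.colimMap m.φ m.contMDiff m.T m.map_smul n

/-- The derivative at `1` of the homomorphism of groups, as a map of Lie algebras. (As `φ 1 = 1`,
the tangent space at `φ 1` is the one at `1`.) -/
def Hom.deriv (m : Hom R S) :
    GroupLieAlgebra 𝓘(K, Fin R.dim → K) R.G →ₗ[K] GroupLieAlgebra 𝓘(K, Fin S.dim → K) S.G :=
  (mfderiv 𝓘(K, Fin R.dim → K) 𝓘(K, Fin S.dim → K) m.φ 1).toLinearMap

/-- The map on Lie algebra cochains induced by a morphism of pairs,
`z ↦ T ∘ z ∘ (dφ × ⋯ × dφ)`. -/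
def Hom.lieCochainMap (m : Hom R S) (n : ℕ)
    (z : GroupLieAlgebra 𝓘(K, Fin S.dim → K) S.G [⋀^Fin n]→ₗ[K] S.V) :
    GroupLieAlgebra 𝓘(K, Fin R.dim → K) R.G [⋀^Fin n]→ₗ[K] R.V :=
  ((m.T : S.V →ₗ[K] R.V).compAlternatingMap z).compLinearMap m.deriv

variable [CompleteSpace K]

/-- The Chevalley-Eilenberg differential of the pair. -/
abbrev lieD (R : LocAnRep.{w, u, v} K) (n : ℕ) :
    (GroupLieAlgebra 𝓘(K, Fin R.dim → K) R.G [⋀^Fin n]→ₗ[K] R.V) →ₗ[K]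
      (GroupLieAlgebra 𝓘(K, Fin R.dim → K) R.G [⋀^Fin (n + 1)]→ₗ[K] R.V) :=
  lieDiff R.dim R.locAnalytic n

/-- The Lie algebra cohomology `Hⁿ(𝔤, V)`. -/
abbrev lieH (R : LocAnRep.{w, u, v} K) (n : ℕ) : Type _ := lieCohomology R.dim R.locAnalytic n

end LocAnRep

end LocAn

end

/-! Both sides are compared with the cohomology of a complex of germs at the unit element, in the
coordinates of the chart at `1`. The comparison is van Est's double complex argument, carried out
for germs.

Reduction to germs. In the centred chart the multiplication is addition up to an error of smaller
order, so by the strong triangle inequality all sufficiently small balls are open subgroups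
(`exists_isSmall`). Hence the germ of an equivariant function of `p + 1` variables extends to a
homogeneous cochain on a small open subgroup, and a cochain with trivial germ vanishes on a smaller
one. The colimit is therefore the cohomology of the complex `Cg p` of germs of cochains
(`colimEquiv`).

The double complex. Let `Og p` be the germs of equivariant functions `F(x₀, …, x_p; g)`; the Lie
algebra `L` operates on them by left invariant vector fields in `g`. The term in bidegree `(p, q)`
consists of the alternating `q`-forms on `L` with values in `Og p`. In the rows one omits the `x_i`;
they are contracted by `F ↦ F(g, x; g)`, and the kernel at the start is `V`, embedded by `v ↦ (g ↦ g
v)`. So the edge of the rows is the Chevalley-Eilenberg complex of `V`. Column `p` is a complex of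
equivariant differential forms in the variable `g`; it is exact by a Poincaré lemma with parameters,
and the kernel at the start consists of the functions that do not depend on `g`, which is `Cg p`. A
diagram chase identifies the cohomology of the two edges (`DoubleResolution.exists_equiv`).

The Poincaré lemma. Simultaneous left translation does not commute with scaling `g`. The
substitution `g = x₀ y` makes the group act trivially on `y`, and scaling `y` is harmless. The usual
integral over the scaling parameter is replaced by division: in a closed form of degree `q + 1`, the
part whose coefficients have degree `s` in `y` is divided by `s + q + 1`. This preserves convergence
because the inverses of integers grow at most geometrically (`exists_inv_natCast_le`). The resulting
form `τ` solves an Euler equation of weight `q + 1`. Solutions of Euler equations of nonzero weight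
are unique, which shows both that `τ` is closed and that it is equivariant; by Cartan's formula the
contraction of `τ` with the Euler field is the primitive (`exists_primitive`, `Frame.exact`). As the
operators of the representation need not preserve the Banach space `W` through which a function
factors, uniqueness is applied in a quotient of `W × W` (`eventually_isEq_of_euler`).

Naturality. The isomorphism is characterised by staircases in the double complex, and a morphism of
pairs induces a morphism of double complexes, which preserves staircases. -/

noncomputable section
namespace LocAn

/-! ### Comparison of the two edges of a double complex -/

section DoubleComplex

variable {K : Type*} [Field K]

/-- A double complex `A` in the first quadrant with commuting differentials, whose rows are
resolutions of the terms of the complex `L` and whose columns are resolutions of the terms of the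
complex `C`. -/
structure DoubleResolution {C : ℕ → Type*} [∀ n, AddCommGroup (C n)] [∀ n, Module K (C n)]
    {L : ℕ → Type*} [∀ n, AddCommGroup (L n)] [∀ n, Module K (L n)]
    (dC : ∀ n, C n →ₗ[K] C (n + 1)) (dL : ∀ n, L n →ₗ[K] L (n + 1))
    (A : ℕ → ℕ → Type*) [∀ p q, AddCommGroup (A p q)] [∀ p q, Module K (A p q)] where
  d₁ : ∀ p q, A p q →ₗ[K] A (p + 1) q
  d₂ : ∀ p q, A p q →ₗ[K] A p (q + 1)
  ι : ∀ p, C p →ₗ[K] A p 0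
  κ : ∀ q, L q →ₗ[K] A 0 q
  d₁_d₁ : ∀ p q x, d₁ (p + 1) q (d₁ p q x) = 0
  d₂_d₂ : ∀ p q x, d₂ p (q + 1) (d₂ p q x) = 0
  comm : ∀ p q x, d₁ p (q + 1) (d₂ p q x) = d₂ (p + 1) q (d₁ p q x)
  ι_injective : ∀ p, Function.Injective (ι p)
  κ_injective : ∀ q, Function.Injective (κ q)
  d₁_ι : ∀ p c, d₁ p 0 (ι p c) = ι (p + 1) (dC p c)
  d₂_κ : ∀ q l, d₂ 0 q (κ q l) = κ (q + 1) (dL q l)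
  d₂_ι : ∀ p c, d₂ p 0 (ι p c) = 0
  d₁_κ : ∀ q l, d₁ 0 q (κ q l) = 0
  row_exact : ∀ p q x, d₁ (p + 1) q x = 0 → ∃ a, d₁ p q a = x
  row_exact_zero : ∀ q x, d₁ 0 q x = 0 → ∃ l, κ q l = x
  col_exact : ∀ p q x, d₂ p (q + 1) x = 0 → ∃ a, d₂ p q a = x
  col_exact_zero : ∀ p x, d₂ p 0 x = 0 → ∃ c, ι p c = x

namespace DoubleResolution

variable {C : ℕ → Type*} [∀ n, AddCommGroup (C n)] [∀ n, Module K (C n)]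
  {L : ℕ → Type*} [∀ n, AddCommGroup (L n)] [∀ n, Module K (L n)]
  {dC : ∀ n, C n →ₗ[K] C (n + 1)} {dL : ∀ n, L n →ₗ[K] L (n + 1)}
  {A : ℕ → ℕ → Type*} [∀ p q, AddCommGroup (A p q)] [∀ p q, Module K (A p q)]
  (D : DoubleResolution dC dL A)

/-- `D.Stair l p q x`: the element `x` of `A p q` is connected by a staircase to the element `l` of
the edge complex `L`. -/
inductive Stair {n : ℕ} (l : L n) : ∀ p q, A p q → Prop
  | base : Stair l 0 n (D.κ n l)
  | step {p q : ℕ} (a : A p q) : Stair l p (q + 1) (D.d₂ p q a) → Stair l (p + 1) q (D.d₁ p q a)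

variable {D}

theorem Stair.eq_zero_left {n : ℕ} {l : L n} {q : ℕ} {x : A 0 q} (h : D.Stair l 0 q x) :
    ∃ e : n = q, x = D.κ q (e ▸ l) := by
  cases h
  exact ⟨rfl, rfl⟩

theorem Stair.exists_step {n : ℕ} {l : L n} {p q : ℕ} {x : A (p + 1) q}
    (h : D.Stair l (p + 1) q x) : ∃ a, x = D.d₁ p q a ∧ D.Stair l p (q + 1) (D.d₂ p q a) := by
  cases h with
  | step a ha => exact ⟨a, rfl, ha⟩

theorem Stair.add {n : ℕ} {l l' : L n} {p q : ℕ} {x x' : A p q} (h : D.Stair l p q x)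
    (h' : D.Stair l' p q x') : D.Stair (l + l') p q (x + x') := by
  induction p generalizing q with
  | zero =>
    obtain ⟨rfl, rfl⟩ := h.eq_zero_left
    obtain ⟨e, rfl⟩ := h'.eq_zero_left
    simp only [← map_add]
    exact Stair.base
  | succ p ih =>
    obtain ⟨a, rfl, ha⟩ := h.exists_step
    obtain ⟨a', rfl, ha'⟩ := h'.exists_step
    rw [← map_add]
    exact Stair.step _ (by rw [map_add]; exact ih ha ha')

theorem Stair.smul {n : ℕ} {l : L n} {p q : ℕ} {x : A p q} (c : K) (h : D.Stair l p q x) :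
    D.Stair (c • l) p q (c • x) := by
  induction p generalizing q with
  | zero =>
    obtain ⟨rfl, rfl⟩ := h.eq_zero_left
    simp only [← map_smul]
    exact Stair.base
  | succ p ih =>
    obtain ⟨a, rfl, ha⟩ := h.exists_step
    rw [← map_smul]
    exact Stair.step _ (by rw [map_smul]; exact ih ha)

theorem Stair.sub {n : ℕ} {l l' : L n} {p q : ℕ} {x x' : A p q} (h : D.Stair l p q x)
    (h' : D.Stair l' p q x') : D.Stair (l - l') p q (x - x') := by
  have := h.add (h'.smul (-1))
  simpa [sub_eq_add_neg] using this

variable (D) in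
-- Exactness of the rows writes an element closed for both differentials as `d₁ a`, and `d₂ a` is
-- again closed for both, one step nearer to the edge `L`. At `p = 0` an element of `L` remains; it
-- is a cocycle because `κ` is injective.
theorem exists_stair_of_mem {n p q : ℕ} (hn : p + q = n) (x : A p q) (h₁ : D.d₁ p q x = 0)
    (h₂ : D.d₂ p q x = 0) : ∃ l : L n, dL n l = 0 ∧ D.Stair l p q x := by
  induction p generalizing q with
  | zero =>
    obtain rfl : q = n := by omega
    obtain ⟨l, rfl⟩ := D.row_exact_zero _ _ h₁
    refine ⟨l, D.κ_injective _ ?_, Stair.base⟩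
    rw [← D.d₂_κ, h₂, map_zero]
  | succ p ih =>
    obtain ⟨a, rfl⟩ := D.row_exact _ _ _ h₁
    obtain ⟨l, hl, hs⟩ := ih (q := q + 1) (by omega) (D.d₂ p q a) (by rw [D.comm, h₂])
      (D.d₂_d₂ _ _ _)
    exact ⟨l, hl, Stair.step a hs⟩

/-- The chase in the opposite direction: exactness of the columns writes the end of the staircase as
`d₂ a`, and `d₁ a` prolongs it. Starting from `κ l` this gives surjectivity of the comparison. -/
theorem Stair.exists_of_stair {n : ℕ} {l : L n} {p q : ℕ} {x : A p q} (hs : D.Stair l p q x)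
    (h₁ : D.d₁ p q x = 0) (h₂ : D.d₂ p q x = 0) (hn : p + q = n) :
    ∃ c : C n, dC n c = 0 ∧ D.Stair l n 0 (D.ι n c) := by
  induction q generalizing p with
  | zero =>
    obtain rfl : p = n := by omega
    obtain ⟨c, rfl⟩ := D.col_exact_zero _ _ h₂
    refine ⟨c, D.ι_injective _ ?_, hs⟩
    rw [← D.d₁_ι, h₁, map_zero]
  | succ q ih =>
    obtain ⟨a, rfl⟩ := D.col_exact _ _ _ h₂
    exact ih (Stair.step a hs) (D.d₁_d₁ _ _ _) (by rw [← D.comm, h₁]) (by omega)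

/-- If `d₂ w = d₁ a` is the last step and `w = d₁ w'`, then `a - d₂ w'` is killed by `d₁` and has
the same image under `d₂` as `a`, so it takes the role of `w` one step nearer to `L`. -/
theorem Stair.mem_coboundaries_right {n : ℕ} {l : L n} {p q : ℕ} {w : A p q}
    (h : D.Stair l p (q + 1) (D.d₂ p q w)) (hw : D.d₁ p q w = 0) : l ∈ coboundaries dL n := by
  induction p generalizing q with
  | zero =>
    obtain ⟨rfl, hl⟩ := h.eq_zero_left
    obtain ⟨l', rfl⟩ := D.row_exact_zero _ _ hw
    rw [D.d₂_κ] at hl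
    exact ⟨l', D.κ_injective _ hl⟩
  | succ p ih =>
    obtain ⟨a, ha, hs⟩ := h.exists_step
    obtain ⟨w', rfl⟩ := D.row_exact _ _ _ hw
    refine ih (q := q + 1) (w := a - D.d₂ p q w') ?_ ?_
    · rwa [map_sub, D.d₂_d₂, sub_zero]
    · rw [map_sub, D.comm, ha, sub_self]

/-- A coboundary at the edge `L` can be pushed along the staircase: if `d₂ a = d₁ b` with `d₂ b =
0`, write `b = d₂ b'` and replace `a` by `a - d₁ b'`, which has the same `d₁` and is killed by `d₂`.
-/
theorem Stair.exists_left {n : ℕ} {l : L n} {p q : ℕ} {x : A (p + 1) q}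
    (h : D.Stair l (p + 1) q x) (hl : l ∈ coboundaries dL n) :
    ∃ b : A p q, x = D.d₁ p q b ∧ D.d₂ p q b = 0 := by
  induction p generalizing q with
  | zero =>
    obtain ⟨a, rfl, hs⟩ := h.exists_step
    obtain ⟨rfl, ha⟩ := hs.eq_zero_left
    obtain ⟨l', rfl⟩ := hl
    refine ⟨a - D.κ q l', ?_, ?_⟩
    · rw [map_sub, D.d₁_κ, sub_zero]
    · rw [map_sub, ha, D.d₂_κ, sub_self]
  | succ p ih =>
    obtain ⟨a, rfl, hs⟩ := h.exists_step
    obtain ⟨b, hb, hb'⟩ := ih hs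
    obtain ⟨b', rfl⟩ := D.col_exact _ _ _ hb'
    refine ⟨a - D.d₁ p q b', ?_, ?_⟩
    · rw [map_sub, D.d₁_d₁, sub_zero]
    · rw [map_sub, hb, D.comm, sub_self]

/-- One direction makes the comparison well defined on classes, the other makes it injective. -/
theorem Stair.coboundaries_iff {n : ℕ} {l : L n} {c : C n} (h : D.Stair l n 0 (D.ι n c)) :
    c ∈ coboundaries dC n ↔ l ∈ coboundaries dL n := by
  cases n with
  | zero =>
    obtain ⟨e, h0⟩ := h.eq_zero_left
    have h0 : D.ι 0 c = D.κ 0 l := h0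
    simp only [coboundaries, Submodule.mem_bot]
    constructor
    · rintro rfl
      exact D.κ_injective 0 (by rw [map_zero, ← h0, map_zero])
    · rintro rfl
      exact D.ι_injective 0 (by rw [map_zero, h0, map_zero])
  | succ n =>
    constructor
    · rintro ⟨c', rfl⟩
      obtain ⟨a, ha, hs⟩ := h.exists_step
      rw [← D.d₁_ι] at ha
      refine Stair.mem_coboundaries_right (D := D) (w := a - D.ι n c') ?_ ?_
      · rwa [map_sub, D.d₂_ι, sub_zero]
      · rw [map_sub, ha, sub_self]
    · intro hl
      obtain ⟨b, hb, hb'⟩ := h.exists_left hl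
      obtain ⟨c', rfl⟩ := D.col_exact_zero _ _ hb'
      exact ⟨c', D.ι_injective _ (by rw [← D.d₁_ι, hb])⟩

variable (D)

/-- The two edge complexes of a double resolution have isomorphic cohomology; the isomorphism is
given by staircases. -/
theorem exists_equiv (n : ℕ) : ∃ β : Cohomology dC n ≃ₗ[K] Cohomology dL n,
    ∀ (c : C n) (hc : dC n c = 0) (l : L n) (hl : dL n l = 0), D.Stair l n 0 (D.ι n c) →
      β (Cohomology.mk dC c hc) = Cohomology.mk dL l hl := by
  have hex : ∀ c : LinearMap.ker (dC n), ∃ l : L n, dL n l = 0 ∧ D.Stair l n 0 (D.ι n c) :=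
    fun c => D.exists_stair_of_mem (by simp) _
      (by rw [D.d₁_ι, LinearMap.mem_ker.1 c.2, map_zero]) (D.d₂_ι _ _)
  choose s hs hst using hex
  have key : ∀ (c : LinearMap.ker (dC n)) (l : L n) (hl : dL n l = 0),
      D.Stair l n 0 (D.ι n c) → Cohomology.mk dL (s c) (hs c) = Cohomology.mk dL l hl := by
    intro c l hl h
    -- Two staircases that end at `ι c` differ by one that ends at `0 = ι 0`, and `0` is a
    -- coboundary.
    have h2 := (hst c).sub h
    rw [sub_self, ← map_zero (D.ι n)] at h2
    exact (Submodule.Quotient.eq _).2 (h2.coboundaries_iff.1 (zero_mem _))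
  let f : LinearMap.ker (dC n) →ₗ[K] Cohomology dL n :=
    { toFun := fun c => Cohomology.mk dL (s c) (hs c)
      map_add' := fun c c' => by
        rw [key (c + c') (s c + s c') (by rw [map_add, hs, hs, add_zero])
          (by simpa using (hst c).add (hst c'))]
        rfl
      map_smul' := fun a c => by
        rw [key (a • c) (a • s c) (by rw [map_smul, hs, smul_zero])
          (by simpa using (hst c).smul a)]
        rfl }
  have hf : ∀ c, f c = 0 ↔ c ∈ (coboundaries dC n).submoduleOf (LinearMap.ker (dC n)) := fun c =>
    (Submodule.Quotient.mk_eq_zero _).trans (hst c).coboundaries_iff.symm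
  refine ⟨LinearEquiv.ofBijective
    (Submodule.liftQ _ f fun c hc => (hf c).2 hc) ⟨?_, ?_⟩, ?_⟩
  · exact LinearMap.ker_eq_bot.1
      (Submodule.ker_liftQ_eq_bot _ _ _ fun c hc => (hf c).1 (LinearMap.mem_ker.1 hc))
  · intro y
    obtain ⟨⟨l, hl⟩, rfl⟩ := Submodule.Quotient.mk_surjective _ y
    obtain ⟨c, hc, h⟩ := Stair.exists_of_stair (D := D) (Stair.base (l := l)) (D.d₁_κ _ _)
      (by rw [D.d₂_κ, LinearMap.mem_ker.1 hl, map_zero]) (by simp)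
    exact ⟨Submodule.Quotient.mk ⟨c, hc⟩, key ⟨c, hc⟩ l hl h⟩
  · intro c hc l hl h
    exact key ⟨c, hc⟩ l hl h

end DoubleResolution

section Map

variable {C : ℕ → Type*} [∀ n, AddCommGroup (C n)] [∀ n, Module K (C n)]
  {L : ℕ → Type*} [∀ n, AddCommGroup (L n)] [∀ n, Module K (L n)]
  {dC : ∀ n, C n →ₗ[K] C (n + 1)} {dL : ∀ n, L n →ₗ[K] L (n + 1)}
  {A : ℕ → ℕ → Type*} [∀ p q, AddCommGroup (A p q)] [∀ p q, Module K (A p q)]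
  {C' : ℕ → Type*} [∀ n, AddCommGroup (C' n)] [∀ n, Module K (C' n)]
  {L' : ℕ → Type*} [∀ n, AddCommGroup (L' n)] [∀ n, Module K (L' n)]
  {dC' : ∀ n, C' n →ₗ[K] C' (n + 1)} {dL' : ∀ n, L' n →ₗ[K] L' (n + 1)}
  {A' : ℕ → ℕ → Type*} [∀ p q, AddCommGroup (A' p q)] [∀ p q, Module K (A' p q)]
  {D' : DoubleResolution dC' dL' A'} {D : DoubleResolution dC dL A}

/-- A morphism of double complexes maps staircases to staircases. -/
theorem DoubleResolution.Stair.map (FA : ∀ p q, A p q → A' p q)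
    (FL : ∀ q, L q → L' q)
    (h₁ : ∀ p q x, FA (p + 1) q (D.d₁ p q x) = D'.d₁ p q (FA p q x))
    (h₂ : ∀ p q x, FA p (q + 1) (D.d₂ p q x) = D'.d₂ p q (FA p q x))
    (hκ : ∀ q l, FA 0 q (D.κ q l) = D'.κ q (FL q l)) {n : ℕ} {l : L n} {p q : ℕ} {x : A p q}
    (h : D.Stair l p q x) : D'.Stair (FL n l) p q (FA p q x) := by
  induction h with
  | base => rw [hκ]; exact Stair.base
  | step a _ ih => rw [h₁]; exact Stair.step _ (by rwa [← h₂])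

end Map

end DoubleComplex

/-! ### Functoriality of the Chevalley-Eilenberg complex -/

section CEMap

variable {K : Type*} [Field K] [CharZero K] {L : Type*} [LieRing L] [LieAlgebra K L]
  {L' : Type*} [LieRing L'] [LieAlgebra K L']
  {V : Type*} [AddCommGroup V] [Module K V] {V' : Type*} [AddCommGroup V'] [Module K V']

/-- Compatibility of the Chevalley-Eilenberg differential with a morphism of Lie algebras
`D : L' → L` and a compatible linear map `u : V → V'`. -/
theorem ceDiff_map (a : L →ₗ[K] V →ₗ[K] V) (a' : L' →ₗ[K] V' →ₗ[K] V') (D : L' →ₗ[K] L)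
    (hD : ∀ x y, D ⁅x, y⁆ = ⁅D x, D y⁆) (u : V →ₗ[K] V') (hu : ∀ x v, u (a (D x) v) = a' x (u v))
    (n : ℕ) (φ : L [⋀^Fin n]→ₗ[K] V) :
    ceDiff a' n ((u.compAlternatingMap φ).compLinearMap D) =
      (u.compAlternatingMap (ceDiff a n φ)).compLinearMap D := by
  ext x
  cases n with
  | zero =>
    simp only [ceDiff_zero_apply, AlternatingMap.compLinearMap_apply,
      LinearMap.compAlternatingMap_apply, hu]
    congr
    exact Subsingleton.elim _ _
  | succ n =>
    simp only [ceDiff_succ_apply, AlternatingMap.compLinearMap_apply,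
      LinearMap.compAlternatingMap_apply, map_sub, map_sum, map_zsmul, hu]
    refine congrArg₂ _ rfl (Finset.sum_congr rfl fun i _ => Finset.sum_congr rfl fun j _ => ?_)
    congr 3
    ext k
    refine Fin.cases ?_ (fun k => ?_) k
    · exact hD _ _
    · rfl

theorem ceDiff_comp (a : L →ₗ[K] V →ₗ[K] V) (a' : L →ₗ[K] V' →ₗ[K] V') (u : V →ₗ[K] V')
    (hu : ∀ x v, u (a x v) = a' x (u v)) (n : ℕ) (φ : L [⋀^Fin n]→ₗ[K] V) :
    ceDiff a' n (u.compAlternatingMap φ) = u.compAlternatingMap (ceDiff a n φ) :=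
  ceDiff_map a a' LinearMap.id (fun _ _ => rfl) u hu n φ

end CEMap

end LocAn

end
noncomputable section
namespace LocAn

/-! ### Power series and the Euler operator -/

section Euler

open FormalMultilinearSeries

variable {K : Type*} [NontriviallyNormedField K] {E : Type*} [NormedAddCommGroup E]
  [NormedSpace K E] {P : Type*} [NormedAddCommGroup P] [NormedSpace K P]
  {F : Type*} [NormedAddCommGroup F] [NormedSpace K F]

/-- The series for a change of origin is indexed by the set of slots that keep `x`; for the first
derivative these sets are the complements of singletons. -/
theorem derivSeries_apply (p : FormalMultilinearSeries K E F) (n : ℕ) (x y : E) :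
    derivSeries p n (fun _ => x) y =
      ∑ i : Fin (1 + n), p (1 + n) (Function.update (fun _ => x) i y) := by
  simp only [derivSeries, ContinuousLinearMap.compFormalMultilinearSeries_apply,
    changeOriginSeries, ContinuousLinearMap.compContinuousMultilinearMap_coe,
    ContinuousLinearEquiv.coe_coe, LinearIsometryEquiv.coe_coe,
    Function.comp_apply, map_sum, _root_.sum_apply, continuousMultilinearCurryFin1_apply,
    Matrix.zero_empty]
  symm
  refine Fintype.sum_bijective
    (fun i : Fin (1 + n) => (⟨{i}ᶜ, by rw [Finset.card_compl]; simp⟩ :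
      {s : Finset (Fin (1 + n)) // s.card = n})) ⟨?_, ?_⟩ _ _ ?_
  · intro i j h
    simpa using h
  · rintro ⟨s, hs⟩
    obtain ⟨i, hi⟩ : ∃ i, sᶜ = {i} := by
      rw [← Finset.card_eq_one, Finset.card_compl, hs]; simp
    exact ⟨i, Subtype.ext (by simp [← hi])⟩
  · intro i
    rw [Fin.snoc_zero, changeOriginSeriesTerm_apply]
    congr 1
    ext j
    by_cases h : j = i
    · subst h; simp
    · simp [h, Finset.piecewise]

theorem hasSum_fderiv_apply [CompleteSpace F] {f : E → F} {p : FormalMultilinearSeries K E F}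
    {r : ENNReal} (hf : HasFPowerSeriesOnBall f p 0 r) {x : E} (hx : x ∈ Metric.eball (0 : E) r)
    (y : E) :
    HasSum (fun n => ∑ i : Fin n, p n (Function.update (fun _ => x) i y)) (fderiv K f x y) := by
  have h := (ContinuousLinearMap.apply K F y).hasSum (hf.fderiv.hasSum hx)
  simp only [zero_add, ContinuousLinearMap.apply_apply, derivSeries_apply] at h
  let g : ℕ → F := fun n => ∑ i : Fin n, p n (Function.update (fun _ => x) i y)
  have h' : HasSum (fun n => g (1 + n)) (fderiv K f x y) := h
  simp only [add_comm 1] at h'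
  -- Differentiation shifts degrees by one; the added term in degree `0` is an empty sum.
  refine (hasSum_nat_add_iff' (f := g) 1).1 ?_
  simpa [g] using h'

/-- Euler's identity: the radial derivative multiplies the component of degree `n` by `n`. -/
theorem hasSum_fderiv_apply_self [CompleteSpace F] {f : E → F}
    {p : FormalMultilinearSeries K E F} {r : ENNReal} (hf : HasFPowerSeriesOnBall f p 0 r) {x : E}
    (hx : x ∈ Metric.eball (0 : E) r) :
    HasSum (fun n : ℕ => (n : K) • p n (fun _ => x)) (fderiv K f x x) := by
  have h := hasSum_fderiv_apply hf hx x
  simpa [Function.update_eq_self_iff, Nat.cast_smul_eq_nsmul] using h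

/-- Uniqueness of power series in one variable. Along the line `t ↦ t • y` it separates the
homogeneous components of a function. -/
theorem eq_zero_of_hasSum_smul_pow [CompleteSpace F] {b : ℕ → F} {ε : ℝ} (hε : 0 < ε)
    (h : ∀ t : K, ‖t‖ < ε → HasSum (fun n => t ^ n • b n) 0) (n : ℕ) : b n = 0 := by
  let p : FormalMultilinearSeries K K F := fun n =>
    ContinuousMultilinearMap.mkPiRing K (Fin n) (b n)
  obtain ⟨t, ht0, ht⟩ := NormedField.exists_norm_lt K hε
  have hr : (‖t‖₊ : ENNReal) ≤ p.radius := by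
    refine p.le_radius_of_tendsto (l := 0) ?_
    have := (h t ht).summable.tendsto_atTop_zero.norm
    simpa [p, norm_smul, mul_comm] using this
  have hp : HasFPowerSeriesAt (0 : K → F) p 0 := by
    refine ⟨‖t‖₊, hr, by simpa using ht0, fun {y} hy => ?_⟩
    have hy' : ‖y‖ < ε := by
      have : ‖y‖ < ‖t‖ := by
        simpa [edist_zero_right, enorm_eq_nnnorm, ENNReal.coe_lt_coe] using hy
      exact this.trans ht
    simpa [p] using h y hy'
  have h0 := congrFun hp.eq_zero n
  simpa [p] using congrArg (fun q : ContinuousMultilinearMap K (fun _ : Fin n => K) F =>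
    q fun _ => 1) h0

/-- The homogeneous components of a solution of the Euler equation `y · f'(y) + k f(y) = 0`. -/
theorem euler_eq_zero [CompleteSpace F] {f : E → F} {p : FormalMultilinearSeries K E F}
    {r : ENNReal}
    (hf : HasFPowerSeriesOnBall f p 0 r) (k : ℕ)
    (h : ∀ y ∈ Metric.eball (0 : E) r, fderiv K f y y + (k : K) • f y = 0) {y : E}
    (hy : y ∈ Metric.eball (0 : E) r) (n : ℕ) :
    ((n + k : ℕ) : K) • p n (fun _ => y) = 0 := by
  refine eq_zero_of_hasSum_smul_pow (K := K) (b := fun n => ((n + k : ℕ) : K) • p n (fun _ => y))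
    one_pos (fun t ht => ?_) n
  have hty : t • y ∈ Metric.eball (0 : E) r := by
    rw [mem_eball_zero_iff] at hy ⊢
    refine lt_of_le_of_lt ?_ hy
    rw [enorm_smul]
    exact mul_le_of_le_one_left' (by
      rw [enorm_eq_nnnorm]; exact_mod_cast ht.le)
  have h1 := (hasSum_fderiv_apply_self hf hty).add ((hf.hasSum hty).const_smul (k : K))
  rw [zero_add, h _ hty] at h1
  convert h1 using 2 with m
  have h2 : p m (fun _ => t • y) = t ^ m • p m (fun _ => y) := by
    simpa using (p m).map_smul_univ (fun _ => t) (fun _ => y)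
  rw [h2, Nat.cast_add, add_smul, smul_add, smul_comm (t ^ m), smul_comm (t ^ m)]

/-- The component of degree `n` is annihilated by `n + k`, which is invertible in characteristic
`0`; `k ≠ 0` is needed for `n = 0`. -/
theorem eq_zero_of_euler [CompleteSpace F] [CharZero K] {f : E → F}
    {p : FormalMultilinearSeries K E F}
    {r : ENNReal} (hf : HasFPowerSeriesOnBall f p 0 r) {k : ℕ} (hk : k ≠ 0)
    (h : ∀ y ∈ Metric.eball (0 : E) r, fderiv K f y y + (k : K) • f y = 0) {y : E}
    (hy : y ∈ Metric.eball (0 : E) r) : f y = 0 := by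
  have h1 := hf.hasSum hy
  rw [zero_add] at h1
  refine h1.unique ?_
  convert hasSum_zero with n
  have := euler_eq_zero hf k h hy n
  exact (smul_eq_zero.1 this).resolve_left (by exact_mod_cast (by omega))

/-- In weight `0` the component of degree `0` is the only one that survives. -/
theorem eq_apply_zero_of_euler [CompleteSpace F] [CharZero K] {f : E → F}
    {p : FormalMultilinearSeries K E F} {r : ENNReal} (hf : HasFPowerSeriesOnBall f p 0 r)
    (h : ∀ y ∈ Metric.eball (0 : E) r, fderiv K f y y = 0) {y : E}
    (hy : y ∈ Metric.eball (0 : E) r) : f y = f 0 := by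
  have h1 := hf.hasSum hy
  rw [zero_add] at h1
  refine h1.unique ?_
  have h0 : f 0 = p 0 fun _ => y := by
    rw [← hf.coeff_zero (fun _ => y)]
  rw [h0]
  refine hasSum_single 0 fun n hn => ?_
  have := euler_eq_zero hf 0 (by simpa using h) hy n
  exact (smul_eq_zero.1 this).resolve_left (by exact_mod_cast (by omega))

/-- This keeps the radius of convergence positive when coefficients are divided by integers. If some
nonzero integer has norm `< 1`, let `m` be the least one: integers not divisible by `m` have norm
`1`, by division with remainder and the strong triangle inequality, and every factor `m` costs `c =
‖m‖⁻¹`. The exponent suffices because `q + 1 ≤ m * q`. Otherwise `c = 1` works. -/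
theorem exists_inv_natCast_le (K : Type*) [NontriviallyNormedField K] [IsUltrametricDist K]
    [CharZero K] : ∃ c : ℝ, 1 ≤ c ∧ ∀ n : ℕ, n ≠ 0 → ‖(n : K)⁻¹‖ ≤ c ^ n := by
  classical
  by_cases h : ∃ m : ℕ, m ≠ 0 ∧ ‖(m : K)‖ < 1
  · obtain ⟨hm0, hm1⟩ := Nat.find_spec h
    have hmin : ∀ s : ℕ, s ≠ 0 → s < Nat.find h → ‖(s : K)‖ = 1 := fun s hs hs' =>
      le_antisymm (IsUltrametricDist.norm_natCast_le_one K s)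
        (not_lt.1 fun hlt => Nat.find_min h hs' ⟨hs, hlt⟩)
    set m := Nat.find h
    have hm2 : 2 ≤ m := by
      rcases Nat.lt_or_ge m 2 with h1 | h1
      · have hm : m = 1 := by omega
        simp [hm] at hm1
      · exact h1
    have hpos : 0 < ‖(m : K)‖ := by simpa using hm0
    refine ⟨‖(m : K)‖⁻¹, (one_le_inv₀ hpos).2 hm1.le, fun n => ?_⟩
    induction n using Nat.strong_induction_on with
    | _ n ih =>
      intro hn
      rcases Nat.eq_zero_or_pos (n % m) with h0 | h0
      · obtain ⟨q, rfl⟩ := Nat.dvd_of_mod_eq_zero h0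
        have hq : q ≠ 0 := by rintro rfl; simp at hn
        have hqlt : q < m * q := by nlinarith [Nat.pos_of_ne_zero hq]
        rw [Nat.cast_mul, mul_inv, norm_mul, norm_inv]
        calc ‖(m : K)‖⁻¹ * ‖(q : K)⁻¹‖ ≤ ‖(m : K)‖⁻¹ * ‖(m : K)‖⁻¹ ^ q := by
              gcongr; exact ih q hqlt hq
          _ = ‖(m : K)‖⁻¹ ^ (q + 1) := by rw [pow_succ']
          _ ≤ _ := pow_le_pow_right₀ ((one_le_inv₀ hpos).2 hm1.le) hqlt
      · have h1 : ‖((n % m : ℕ) : K)‖ = 1 := hmin _ h0.ne' (Nat.mod_lt _ (by omega))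
        have h2 : ‖((m * (n / m) : ℕ) : K)‖ < 1 := by
          rw [Nat.cast_mul, norm_mul]
          exact mul_lt_one_of_nonneg_of_lt_one_left (norm_nonneg _) hm1
            (IsUltrametricDist.norm_natCast_le_one K _)
        have h3 : ‖(n : K)‖ = 1 := by
          conv_lhs => rw [← Nat.mod_add_div n m, Nat.cast_add]
          rw [IsUltrametricDist.norm_add_eq_max_of_norm_ne_norm (by rw [h1]; exact h2.ne'), h1]
          exact max_eq_left h2.le
        rw [norm_inv, h3, inv_one]
        exact one_le_pow₀ ((one_le_inv₀ hpos).2 hm1.le)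
  · push Not at h
    refine ⟨1, le_rfl, fun n hn => ?_⟩
    rw [norm_inv, one_pow]
    exact inv_le_one_of_one_le₀ (h n hn)

/-! ### Power series on a product: partial degrees and slices. -/

section Slices

/-- The projections of `P × E` onto the subspaces `E` (for `true`) and `P` (for `false`). -/
def axisProj (K P E : Type*) [NontriviallyNormedField K] [NormedAddCommGroup E] [NormedSpace K E]
    [NormedAddCommGroup P] [NormedSpace K P] (b : Bool) : P × E →L[K] P × E :=
  if b then (ContinuousLinearMap.inr K P E).comp (ContinuousLinearMap.snd K P E)
  else (ContinuousLinearMap.inl K P E).comp (ContinuousLinearMap.fst K P E)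

theorem norm_axisProj_le (b : Bool) : ‖axisProj K P E b‖ ≤ 1 := by
  refine ContinuousLinearMap.opNorm_le_bound _ zero_le_one fun z => ?_
  cases b <;> simp [axisProj, Prod.norm_def]

theorem axisProj_add (z : P × E) : axisProj K P E true z + axisProj K P E false z = z := by
  ext <;> simp [axisProj]

/-- The part of the multilinear map `q` that has degree `s` in the second factor of `P × E`. -/
def axisPart {n : ℕ} (q : ContinuousMultilinearMap K (fun _ : Fin n => P × E) F)
    (s : Finset (Fin n)) : ContinuousMultilinearMap K (fun _ : Fin n => P × E) F :=
  q.compContinuousLinearMap fun i => axisProj K P E (decide (i ∈ s))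

theorem norm_axisPart_le {n : ℕ} (q : ContinuousMultilinearMap K (fun _ : Fin n => P × E) F)
    (s : Finset (Fin n)) : ‖axisPart q s‖ ≤ ‖q‖ := by
  refine (ContinuousMultilinearMap.norm_compContinuousLinearMap_le _ _).trans ?_
  refine mul_le_of_le_one_right (norm_nonneg _) ?_
  exact Finset.prod_le_one (fun _ _ => norm_nonneg _) fun _ _ => norm_axisProj_le _

theorem sum_axisPart {n : ℕ} (q : ContinuousMultilinearMap K (fun _ : Fin n => P × E) F)
    (z : P × E) : ∑ s : Finset (Fin n), axisPart q s (fun _ => z) = q fun _ => z := by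
  have h := q.map_add_univ (fun _ => axisProj K P E true z) (fun _ => axisProj K P E false z)
  have hz : ((fun _ => axisProj K P E true z) + fun _ => axisProj K P E false z : Fin n → P × E) =
      fun _ => z := funext fun _ => axisProj_add z
  rw [hz] at h
  rw [h]
  refine Finset.sum_congr rfl fun s _ => congrArg q (funext fun i => ?_)
  by_cases hi : i ∈ s <;> simp [hi]

/-- Summed over `i`, this gives the factor `s.card`: the parts are eigenvectors of the Euler
operator in the second variable. -/
theorem axisPart_update {n : ℕ} (q : ContinuousMultilinearMap K (fun _ : Fin n => P × E) F)
    (s : Finset (Fin n)) (z : P × E) (i : Fin n) :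
    axisPart q s (Function.update (fun _ => z) i (0, z.2)) =
      if i ∈ s then axisPart q s (fun _ => z) else 0 := by
  split_ifs with hi
  · refine congrArg q (funext fun j => ?_)
    by_cases hj : j = i
    · subst hj; simp [hi, axisProj]
    · simp [hj]
  · refine q.map_coord_zero i ?_
    simp [hi, axisProj]

/-- Moving the centre to `(x, 0)` with `x` in the ball of half the radius leaves at least half the
radius. The point is that the radius does not depend on `x`, so that uniqueness on slices yields
statements on a neighbourhood. -/
theorem exists_slice_hasFPowerSeriesOnBall [CompleteSpace F] {f : P × E → F}
    (hf : AnalyticAt K f 0) :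
    ∃ R : ENNReal, 0 < R ∧ ∀ r ≤ R, 0 < r → ∀ x : P, x ∈ Metric.eball (0 : P) r →
      ∃ p : FormalMultilinearSeries K E F, HasFPowerSeriesOnBall (fun y => f (x, y)) p 0 r := by
  obtain ⟨p, R, hR⟩ := hf
  refine ⟨R / 2, ENNReal.half_pos hR.r_pos.ne', fun r hr hr0 x hx => ?_⟩
  have hx' : ‖(x, (0 : E))‖ₑ < r := by
    have : ‖(x, (0 : E))‖ₑ = ‖x‖ₑ := by
      rw [enorm_eq_nnnorm, enorm_eq_nnnorm]; simp
    rw [this]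
    simpa using hx
  have h1 := hR.changeOrigin (y := (x, 0)) (hx'.trans_le (hr.trans ENNReal.half_le_self))
  have h2 : HasFPowerSeriesOnBall (fun z => f (z + (x, 0))) (p.changeOrigin (x, 0)) 0
      (R - ‖(x, (0 : E))‖₊) := by
    have := h1.comp_sub (-(x, (0 : E)))
    rw [zero_add, add_neg_cancel] at this
    simpa only [sub_neg_eq_add] using this
  have h3 := (h2.mono (r' := r) hr0 ?_)
  · have h4 := HasFPowerSeriesOnBall.compContinuousLinearMap (u := ContinuousLinearMap.inr K P E)
      (x := 0) (by rw [map_zero]; exact h3)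
    refine ⟨_, (h4.mono hr0 ?_).congr ?_⟩
    · conv_lhs => rw [← div_one r]
      refine ENNReal.div_le_div_left ?_ _
      rw [enorm_eq_nnnorm]
      exact_mod_cast ContinuousLinearMap.norm_inr_le_one K P E
    · intro y hy; simp
  · refine ENNReal.le_sub_of_add_le_right (by simp) ?_
    calc r + ‖(x, (0 : E))‖ₑ ≤ R / 2 + R / 2 := add_le_add hr (hx'.le.trans hr)
      _ = R := ENNReal.add_halves R

variable [IsUltrametricDist K] [CharZero K] [CompleteSpace F]

/-- The equation `y · ∂_y τ(x, y) + k τ(x, y) = η(x, y)` has an analytic solution if `k ≠ 0`. -/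
theorem exists_euler_solution {η : P × E → F} (hη : AnalyticAt K η 0) {k : ℕ} (hk : k ≠ 0) :
    ∃ τ : P × E → F, AnalyticAt K τ 0 ∧
      ∀ᶠ z in 𝓝 (0 : P × E), fderiv K τ z (0, z.2) + (k : K) • τ z = η z := by
  obtain ⟨p, hp⟩ := hη
  obtain ⟨c, hc1, hc⟩ := exists_inv_natCast_le K
  -- On the part indexed by `s`, the Euler operator plus `k` is multiplication by `s.card + k`; this
  -- is nonzero even for empty `s`.
  let p' : FormalMultilinearSeries K (P × E) F := fun n =>
    ∑ s : Finset (Fin n), ((s.card + k : ℕ) : K)⁻¹ • axisPart (p n) s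
  have hbound : ∀ n, ‖p' n‖ ≤ 2 ^ n * c ^ (n + k) * ‖p n‖ := fun n => by
    refine (norm_sum_le _ _).trans ?_
    have : ∀ s : Finset (Fin n), ‖((s.card + k : ℕ) : K)⁻¹ • axisPart (p n) s‖ ≤
        c ^ (n + k) * ‖p n‖ := fun s => by
      rw [norm_smul]
      refine mul_le_mul ((hc _ (by omega)).trans ?_) (norm_axisPart_le _ _) (norm_nonneg _)
        (by positivity)
      refine pow_le_pow_right₀ hc1 ?_
      have := Finset.card_le_univ s
      simp at this
      omega
    refine (Finset.sum_le_card_nsmul _ _ _ fun s _ => this s).trans ?_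
    simp [mul_assoc]
  have hrad : 0 < p'.radius := by
    obtain ⟨C, a, hC, ha, hbd⟩ : ∃ C a : ℝ, 0 < C ∧ 0 < a ∧ ∀ n, ‖p n‖ * a ^ n ≤ C := by
      obtain ⟨a, ha, har⟩ := ENNReal.lt_iff_exists_nnreal_btwn.1 hp.radius_pos
      obtain ⟨C, hC, hb⟩ := p.norm_mul_pow_le_of_lt_radius har
      exact ⟨C, a, hC, by exact_mod_cast ha, hb⟩
    have hc0 : 0 < c := by linarith
    -- Shrinking `a` by `2 * c` absorbs the number `2 ^ n` of subsets and the growth `c ^ n` of the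
    -- inverses.
    have hpos : 0 < a / (2 * c) := by positivity
    refine lt_of_lt_of_le ?_ (p'.le_radius_of_bound (c ^ k * C) (r := ⟨a / (2 * c), hpos.le⟩)
      fun n => ?_)
    · exact ENNReal.coe_pos.2 (show (0 : NNReal) < ⟨a / (2 * c), hpos.le⟩ from hpos)
    · calc ‖p' n‖ * (a / (2 * c)) ^ n ≤ (2 ^ n * c ^ (n + k) * ‖p n‖) * (a / (2 * c)) ^ n := by
            gcongr; exact hbound n
        _ = c ^ k * (‖p n‖ * a ^ n) := by
            rw [div_pow, mul_pow, pow_add]; field_simp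
        _ ≤ c ^ k * C := by gcongr; exact hbd n
  obtain ⟨r, hr⟩ := hp
  have hτ := p'.hasFPowerSeriesOnBall hrad
  refine ⟨p'.sum, hτ.analyticAt, ?_⟩
  filter_upwards [Metric.eball_mem_nhds (0 : P × E) hrad,
    Metric.eball_mem_nhds (0 : P × E) hr.r_pos]
    with z hz hz'
  have h₁ := hτ.hasSum hz
  have h₂ := hr.hasSum hz'
  rw [zero_add] at h₁ h₂
  refine ((hasSum_fderiv_apply hτ hz (0, z.2)).add (h₁.const_smul (k : K))).unique ?_
  · convert h₂ using 2 with n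
    rw [← sum_axisPart (p n) z]
    simp only [p', sum_apply, _root_.smul_apply,
      axisPart_update, Finset.smul_sum]
    rw [Finset.sum_comm, ← Finset.sum_add_distrib]
    refine Finset.sum_congr rfl fun s _ => ?_
    have hne : ((s.card + k : ℕ) : K) ≠ 0 := by exact_mod_cast (by omega)
    simp only [smul_ite, smul_zero, Finset.sum_ite_mem, Finset.univ_inter, Finset.sum_const]
    rw [← Nat.cast_smul_eq_nsmul K, ← add_smul, ← Nat.cast_add, smul_smul, mul_inv_cancel₀ hne,
      one_smul]

end Slices

end Euler

end LocAn

end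
noncomputable section
namespace LocAn

/-! ### The Poincaré lemma with parameters -/

section Poincare

variable {K : Type*} [NontriviallyNormedField K] {E : Type*} [NormedAddCommGroup E]
  [NormedSpace K E] {P : Type*} [NormedAddCommGroup P] [NormedSpace K P]
  {F : Type*} [NormedAddCommGroup F] [NormedSpace K F]

theorem fderiv_slice {f : P × E → F} {z : P × E} (hf : DifferentiableAt K f z) :
    fderiv K (fun y => f (z.1, y)) z.2 = (fderiv K f z).comp (ContinuousLinearMap.inr K P E) :=
  (HasFDerivAt.comp z.2 (f := fun y => (z.1, y)) hf.hasFDerivAt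
    (hasFDerivAt_prodMk_right z.1 z.2)).fderiv

theorem differentiableAt_slice {f : P × E → F} {z : P × E} (hf : DifferentiableAt K f z) :
    DifferentiableAt K (fun y => f (z.1, y)) z.2 :=
  (HasFDerivAt.comp z.2 (f := fun y => (z.1, y)) hf.hasFDerivAt
    (hasFDerivAt_prodMk_right z.1 z.2)).differentiableAt

/-- For the sup norm a ball of the product is a product of balls of the same radius. -/
theorem exists_eball_of_eventually {Q : P × E → Prop} (h : ∀ᶠ z in 𝓝 (0 : P × E), Q z) :
    ∃ R : ENNReal, 0 < R ∧ ∀ x ∈ Metric.eball (0 : P) R,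
      ∀ y ∈ Metric.eball (0 : E) R, Q (x, y) := by
  obtain ⟨R, hR, h⟩ := EMetric.mem_nhds_iff.1 h
  refine ⟨R, hR, fun x hx y hy => h ?_⟩
  rw [Metric.mem_eball, Prod.edist_eq]
  exact max_lt hx hy

theorem eventually_of_eball {Q : P × E → Prop} {R : ENNReal} (hR : 0 < R)
    (h : ∀ x ∈ Metric.eball (0 : P) R, ∀ y ∈ Metric.eball (0 : E) R, Q (x, y)) :
    ∀ᶠ z in 𝓝 (0 : P × E), Q z := by
  filter_upwards [Metric.eball_mem_nhds (0 : P × E) hR] with z hz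
  rw [Metric.mem_eball, Prod.edist_eq] at hz
  exact h z.1 (lt_of_le_of_lt (le_max_left _ _) hz) z.2 (lt_of_le_of_lt (le_max_right _ _) hz)

variable [CompleteSpace F] [CharZero K]

/-- Uniqueness for the Euler equation, applied to all slices `y ↦ f (x, y)` on a ball that does not
depend on `x`. -/
theorem eventually_eq_zero_of_euler {f : P × E → F} (hf : AnalyticAt K f 0) {k : ℕ} (hk : k ≠ 0)
    (h : ∀ᶠ z in 𝓝 (0 : P × E), fderiv K f z (0, z.2) + (k : K) • f z = 0) :
    ∀ᶠ z in 𝓝 (0 : P × E), f z = 0 := by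
  obtain ⟨R₁, hR₁, h₁⟩ := exists_slice_hasFPowerSeriesOnBall hf
  obtain ⟨R₂, hR₂, h₂⟩ := exists_eball_of_eventually (h.and
    (hf.eventually_analyticAt.mono fun z hz => hz.differentiableAt))
  refine eventually_of_eball (lt_min hR₁ hR₂) fun x hx y hy => ?_
  obtain ⟨p, hp⟩ := h₁ (min R₁ R₂) (min_le_left _ _) (lt_min hR₁ hR₂) x hx
  refine eq_zero_of_euler hp hk (fun y hy => ?_) hy
  obtain ⟨h3, h4⟩ := h₂ x (Metric.eball_subset_eball (min_le_right _ _) hx) y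
    (Metric.eball_subset_eball (min_le_right _ _) hy)
  rw [fderiv_slice (z := (x, y)) h4]
  exact h3

theorem eventually_eq_of_fderiv_eq_zero {f : P × E → F} (hf : AnalyticAt K f 0)
    (h : ∀ᶠ z in 𝓝 (0 : P × E), fderiv K f z (0, z.2) = 0) :
    ∀ᶠ z in 𝓝 (0 : P × E), f z = f (z.1, 0) := by
  obtain ⟨R₁, hR₁, h₁⟩ := exists_slice_hasFPowerSeriesOnBall hf
  obtain ⟨R₂, hR₂, h₂⟩ := exists_eball_of_eventually (h.and
    (hf.eventually_analyticAt.mono fun z hz => hz.differentiableAt))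
  refine eventually_of_eball (lt_min hR₁ hR₂) fun x hx y hy => ?_
  obtain ⟨p, hp⟩ := h₁ (min R₁ R₂) (min_le_left _ _) (lt_min hR₁ hR₂) x hx
  refine eq_apply_zero_of_euler hp (fun y hy => ?_) hy
  obtain ⟨h3, h4⟩ := h₂ x (Metric.eball_subset_eball (min_le_right _ _) hx) y
    (Metric.eball_subset_eball (min_le_right _ _) hy)
  rw [fderiv_slice (z := (x, y)) h4]
  exact h3

end Poincare

/-! ### The exterior derivative relative to the parameters, and primitives of closed forms. -/

section ExtDeriv

open ContinuousAlternatingMap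

variable {K : Type*} [NontriviallyNormedField K] {E : Type*} [NormedAddCommGroup E]
  [NormedSpace K E] {P : Type*} [NormedAddCommGroup P] [NormedSpace K P]
  {F : Type*} [NormedAddCommGroup F] [NormedSpace K F]

theorem clm_comp_analyticAt {A B : Type*} [NormedAddCommGroup A] [NormedSpace K A]
    [NormedAddCommGroup B] [NormedSpace K B] (c : A →L[K] B) {f : E → A} {z : E}
    (hf : AnalyticAt K f z) : AnalyticAt K (fun z => c (f z)) z :=
  (c.analyticAt _).comp hf

section Abstract

variable {A B : Type*} [NormedAddCommGroup A] [NormedSpace K A] [NormedAddCommGroup B]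
  [NormedSpace K B]

theorem analyticAt_clm_snd (c : A →L[K] E →L[K] B) {τ : P × E → A} {z : P × E}
    (hτ : AnalyticAt K τ z) : AnalyticAt K (fun z => c (τ z) z.2) z :=
  (ContinuousLinearMap.analyticAt_bilinear c (τ z, z.2)).comp₂ hτ analyticAt_snd

theorem fderiv_clm_snd (c : A →L[K] E →L[K] B) {τ : P × E → A} {z : P × E}
    (hτ : DifferentiableAt K τ z) (v : E) :
    fderiv K (fun z => c (τ z) z.2) z (0, v) = c (fderiv K τ z (0, v)) z.2 + c (τ z) v := by
  have h0 : HasFDerivAt (fun z => c (τ z)) (c.comp (fderiv K τ z)) z :=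
    c.hasFDerivAt.comp z hτ.hasFDerivAt
  have h1 := h0.clm_apply (hasFDerivAt_snd (𝕜 := K) (E := P) (F := E) (p := z))
  rw [h1.fderiv]
  simp [add_comm]

variable [CompleteSpace A]

theorem analyticAt_clm_fderiv (c : (E →L[K] A) →L[K] B) {η : P × E → A} {z : P × E}
    (hη : AnalyticAt K η z) :
    AnalyticAt K (fun z => c ((fderiv K η z).comp (ContinuousLinearMap.inr K P E))) z :=
  clm_comp_analyticAt c (clm_comp_analyticAt
    ((ContinuousLinearMap.compL K E (P × E) A).flip (ContinuousLinearMap.inr K P E)) hη.fderiv)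

/-- Differentiating an Euler equation. -/
theorem euler_clm_fderiv (c : (E →L[K] A) →L[K] B) {τ η : P × E → A} {z : P × E}
    (hτ : AnalyticAt K τ z) (hη : AnalyticAt K η z) {k : ℕ}
    (h : ∀ᶠ z in 𝓝 z, fderiv K τ z (0, z.2) + (k : K) • τ z = η z) :
    fderiv K (fun z => c ((fderiv K τ z).comp (ContinuousLinearMap.inr K P E))) z (0, z.2) +
      ((k + 1 : ℕ) : K) • c ((fderiv K τ z).comp (ContinuousLinearMap.inr K P E)) =
      c ((fderiv K η z).comp (ContinuousLinearMap.inr K P E)) := by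
  let e := (ContinuousLinearMap.compL K E (P × E) A).flip (ContinuousLinearMap.inr K P E)
  have hd : HasFDerivAt (fun z => fderiv K τ z (0, z.2) + (k : K) • τ z) (fderiv K η z) z :=
    hη.differentiableAt.hasFDerivAt.congr_of_eventuallyEq h
  have hlin : HasFDerivAt (fun z : P × E => ((0 : P), z.2))
      ((ContinuousLinearMap.inr K P E).comp (ContinuousLinearMap.snd K P E)) z :=
    ((ContinuousLinearMap.inr K P E).comp (ContinuousLinearMap.snd K P E)).hasFDerivAt
  have hd' := ((hτ.fderiv.differentiableAt.hasFDerivAt.clm_apply hlin).add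
    (hτ.differentiableAt.hasFDerivAt.const_smul (k : K))).unique hd
  have hκ : HasFDerivAt (fun z => c ((fderiv K τ z).comp (ContinuousLinearMap.inr K P E)))
      ((c.comp e).comp (fderiv K (fderiv K τ) z)) z :=
    (c.comp e).hasFDerivAt.comp z hτ.fderiv.differentiableAt.hasFDerivAt
  -- In direction `v` the product rule gives `τ''(v, y) + τ'(v) + k τ'(v)`. By symmetry the first
  -- term is the Euler derivative of `τ'`, and the extra `τ'(v)` raises the weight to `k + 1`.
  have hsymm := (hτ.contDiffAt (n := ω)).isSymmSndFDerivAt_of_omega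
  rw [hκ.fderiv, ← hd']
  simp only [ContinuousLinearMap.comp_apply]
  rw [← map_smul, ← map_add]
  congr 1
  ext v : 1
  simp only [e, _root_.add_apply, _root_.smul_apply, ContinuousLinearMap.comp_apply,
    ContinuousLinearMap.flip_apply, ContinuousLinearMap.inr_apply, ContinuousLinearMap.coe_snd',
    ContinuousLinearMap.compL_apply]
  rw [hsymm (0, z.2) (0, v), Nat.cast_add, Nat.cast_one, add_smul, one_smul]
  abel

end Abstract

/-- Currying of continuous alternating maps, as a continuous linear map. -/
def curryLeftCLM (K E F : Type*) [NontriviallyNormedField K] [NormedAddCommGroup E]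
    [NormedSpace K E] [NormedAddCommGroup F] [NormedSpace K F] (q : ℕ) :
    (E [⋀^Fin (q + 1)]→L[K] F) →L[K] E →L[K] E [⋀^Fin q]→L[K] F :=
  curryLeftLI.toContinuousLinearMap

/-- The exterior derivative in the second variable of `P × E`. -/
def extDerivSnd {q : ℕ} (η : P × E → E [⋀^Fin q]→L[K] F) (z : P × E) :
    E [⋀^Fin (q + 1)]→L[K] F :=
  alternatizeUncurryFinCLM K E F ((fderiv K η z).comp (ContinuousLinearMap.inr K P E))

theorem extDeriv_slice {q : ℕ} {η : P × E → E [⋀^Fin q]→L[K] F} {z : P × E}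
    (hη : DifferentiableAt K η z) :
    extDeriv (fun y => η (z.1, y)) z.2 = extDerivSnd η z := by
  rw [extDeriv, fderiv_slice hη]; rfl

theorem analyticAt_curryLeft_apply {q : ℕ} {τ : P × E → E [⋀^Fin (q + 1)]→L[K] F} {z : P × E}
    (hτ : AnalyticAt K τ z) : AnalyticAt K (fun z => (τ z).curryLeft z.2) z := by
  exact analyticAt_clm_snd (curryLeftCLM K E F q) hτ

/-- Cartan's formula `d i + i d = Lie derivative` for the Euler field. On a form of degree `q + 1`
with respect to a constant frame, this Lie derivative is the radial derivative of the coefficients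
plus multiplication by `q + 1`. -/
theorem extDerivSnd_curryLeft {q : ℕ} {τ : P × E → E [⋀^Fin (q + 1)]→L[K] F} {z : P × E}
    (hτ : DifferentiableAt K τ z) :
    extDerivSnd (fun z => (τ z).curryLeft z.2) z =
      fderiv K τ z (0, z.2) + ((q + 1 : ℕ) : K) • τ z - (extDerivSnd τ z).curryLeft z.2 := by
  have h1 : ∀ v, fderiv K (fun z : P × E => (τ z).curryLeft z.2) z (0, v) =
      (fderiv K τ z (0, v)).curryLeft z.2 + (τ z).curryLeft v :=
    fun v => fderiv_clm_snd (curryLeftCLM K E F q) hτ v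
  ext v
  simp only [alternatizeUncurryFinCLM_apply, alternatizeUncurryFin_apply, extDerivSnd,
    ContinuousAlternatingMap.sub_apply, ContinuousAlternatingMap.add_apply,
    ContinuousAlternatingMap.smul_apply, curryLeft_apply_apply, ContinuousLinearMap.comp_apply,
    ContinuousLinearMap.inr_apply, h1]
  rw [Fin.sum_univ_succ (n := q + 1)]
  simp only [smul_add, Finset.sum_add_distrib, Matrix.cons_val_zero, Fin.val_zero, pow_zero,
    one_smul,
    Matrix.cons_val_succ, Fin.val_succ, pow_succ, mul_neg_one, neg_smul, Finset.sum_neg_distrib]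
  -- Moving `v i` back to its place produces the same sign, so the `q + 1` terms in which the Euler
  -- field is differentiated all equal `τ z v`.
  have h2 : ∀ i : Fin (q + 1), (-1 : ℤ) ^ (i : ℕ) • τ z (Matrix.vecCons (v i) (i.removeNth v)) =
      τ z v := fun i => by
    rw [← map_insertNth, Fin.insertNth_self_removeNth]
  have h3 : ∀ i : Fin (q + 1), (i.succ.removeNth (Matrix.vecCons z.2 v) : Fin (q + 1) → E) =
      Matrix.vecCons z.2 (i.removeNth v) := fun i => by
    ext j
    refine Fin.cases ?_ (fun j => ?_) j
    · simp [Fin.removeNth]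
    · simp [Fin.removeNth]
  have h4 : Fin.removeNth 0 (Matrix.vecCons z.2 v) = v := by
    ext j; simp [Fin.removeNth]
  simp only [h2, h3, h4, Finset.sum_const, Finset.card_univ, Fintype.card_fin,
    ← Nat.cast_smul_eq_nsmul K]
  abel

variable [CompleteSpace F]

theorem analyticAt_extDerivSnd {q : ℕ} {η : P × E → E [⋀^Fin q]→L[K] F} {z : P × E}
    (hη : AnalyticAt K η z) : AnalyticAt K (extDerivSnd η) z :=
  analyticAt_clm_fderiv _ hη

theorem extDerivSnd_extDerivSnd {q : ℕ} {η : P × E → E [⋀^Fin q]→L[K] F} {z : P × E}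
    (hη : AnalyticAt K η z) : extDerivSnd (extDerivSnd η) z = 0 := by
  rw [← extDeriv_slice (analyticAt_extDerivSnd hη).differentiableAt]
  have h1 : (fun y => extDerivSnd η (z.1, y)) =ᶠ[𝓝 z.2] extDeriv fun y => η (z.1, y) := by
    have hc : Filter.Tendsto (fun y : E => (z.1, y)) (𝓝 z.2) (𝓝 z) :=
      (Continuous.prodMk_right z.1).tendsto z.2
    filter_upwards [hc.eventually hη.eventually_analyticAt] with y hy
    exact (extDeriv_slice hy.differentiableAt).symm
  rw [h1.extDeriv_eq]
  have h2 : AnalyticAt K (fun y => η (z.1, y)) z.2 :=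
    AnalyticAt.comp (f := fun y => (z.1, y)) hη (analyticAt_const.prod analyticAt_id)
  exact extDeriv_extDeriv_apply (r := ω) h2.contDiffAt le_top

variable [CharZero K] [IsUltrametricDist K]

/-- The Poincaré lemma with parameters: the primitive of a closed form `η` is obtained by
contracting with the Euler vector field the solution `τ` of an Euler equation. -/
theorem exists_primitive {q : ℕ} {η : P × E → E [⋀^Fin (q + 1)]→L[K] F} (hη : AnalyticAt K η 0)
    (hcl : ∀ᶠ z in 𝓝 (0 : P × E), extDerivSnd η z = 0) :
    ∃ τ : P × E → E [⋀^Fin (q + 1)]→L[K] F, AnalyticAt K τ 0 ∧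
      (∀ᶠ z in 𝓝 (0 : P × E), fderiv K τ z (0, z.2) + ((q + 1 : ℕ) : K) • τ z = η z) ∧
      ∀ᶠ z in 𝓝 (0 : P × E), extDerivSnd (fun z => (τ z).curryLeft z.2) z = η z := by
  obtain ⟨τ, hτ, heq⟩ := exists_euler_solution hη (k := q + 1) (by omega)
  refine ⟨τ, hτ, heq, ?_⟩
  -- If `τ` is closed, Cartan's formula reduces the claim to the Euler equation. It is closed
  -- because its exterior derivative solves the homogeneous Euler equation of weight `q + 2`, the
  -- right-hand side being the exterior derivative of the closed form `η`.
  suffices h : ∀ᶠ z in 𝓝 (0 : P × E), extDerivSnd τ z = 0 by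
    filter_upwards [h, heq, hτ.eventually_analyticAt] with z h1 h2 h3
    rw [extDerivSnd_curryLeft h3.differentiableAt, h1, h2]
    simp
  refine eventually_eq_zero_of_euler (k := q + 2) (analyticAt_extDerivSnd hτ) (by omega) ?_
  filter_upwards [heq.eventually_nhds, hcl, hτ.eventually_analyticAt, hη.eventually_analyticAt]
    with z h1 h2 h3 h4
  exact (euler_clm_fderiv (alternatizeUncurryFinCLM K E F) h3 h4 h1).trans h2

end ExtDeriv

end LocAn

end
noncomputable section
namespace LocAn

/-! ### Locally analytic functions on normed spaces -/

section LA

variable (K : Type w) [NontriviallyNormedField K] {N : Type*} [NormedAddCommGroup N]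
  [NormedSpace K N] {N' : Type*} [NormedAddCommGroup N'] [NormedSpace K N']
  {V : Type v} [AddCommGroup V] [Module K V] [TopologicalSpace V]
  {V' : Type v} [AddCommGroup V'] [Module K V'] [TopologicalSpace V']

/-- The function `f : N → V` on a normed space factors near `x` through an analytic map into a
Banach space. -/
def LA (f : N → V) (x : N) : Prop :=
  ∃ (W : Type v) (_ : NormedAddCommGroup W) (_ : NormedSpace K W) (_ : CompleteSpace W)
    (_ : IsUltrametricDist W) (j : W →L[K] V) (h : N → W),
    AnalyticAt K h x ∧ ∀ᶠ y in 𝓝 x, f y = j (h y)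

variable {K}

theorem LA.clm_comp {f : N → V} {x : N} (T : V →L[K] V') (hf : LA K f x) :
    LA K (fun y => T (f y)) x := by
  obtain ⟨W, _, _, _, _, j, k, hk, e⟩ := hf
  refine ⟨W, _, _, ‹_›, ‹_›, T.comp j, k, hk, ?_⟩
  filter_upwards [e] with y h1
  simp [h1]

theorem LA.comp {f : N → V} {ψ : N' → N} {x : N'} (hf : LA K f (ψ x)) (hψ : AnalyticAt K ψ x) :
    LA K (fun y => f (ψ y)) x := by
  obtain ⟨W, _, _, _, _, j, k, hk, e⟩ := hf
  exact ⟨W, _, _, ‹_›, ‹_›, j, fun y => k (ψ y), hk.comp hψ, hψ.continuousAt.eventually e⟩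

theorem LA.eventually {f : N → V} {x : N} (hf : LA K f x) : ∀ᶠ y in 𝓝 x, LA K f y := by
  obtain ⟨W, _, _, _, _, j, k, hk, e⟩ := hf
  filter_upwards [hk.eventually_analyticAt, e.eventually_nhds] with y h1 h2
  exact ⟨W, _, _, ‹_›, ‹_›, j, k, h1, h2⟩

theorem LA.zero (x : N) : LA K (fun _ : N => (0 : V)) x := by
  have : IsUltrametricDist PUnit.{v + 1} := ⟨fun _ _ _ => by simp⟩
  exact ⟨PUnit, _, _, inferInstance, this, 0, fun _ => 0, analyticAt_const, by simp⟩

variable [IsTopologicalAddGroup V] [T2Space V]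

/-- Finitely many locally analytic functions factor through the same Banach space, which can be
taken to inject into `V`. -/
theorem LA.exists_common {ι : Type} [Finite ι] {f : ι → N → V} {x : N} (hf : ∀ i, LA K (f i) x) :
    ∃ (W : Type v) (_ : NormedAddCommGroup W) (_ : NormedSpace K W) (_ : CompleteSpace W)
      (_ : IsUltrametricDist W) (j : W →L[K] V) (h : ι → N → W), Function.Injective j ∧
      ∀ i, AnalyticAt K (h i) x ∧ ∀ᶠ y in 𝓝 x, f i y = j (h i y) := by
  classical
  have := Fintype.ofFinite ι
  choose W n1 n2 n3 n4 j h hh e using hf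
  let j₀ : (∀ i, W i) →L[K] V := ∑ i, (j i).comp (ContinuousLinearMap.proj i)
  -- The sum of the maps `j i` need not be injective on the product; its kernel is closed because
  -- `V` is separated, and dividing by it gives a Banach space that injects into `V`.
  let S : Submodule K (∀ i, W i) := LinearMap.ker (j₀ : (∀ i, W i) →ₗ[K] V)
  have hS : IsClosed (S : Set (∀ i, W i)) := ContinuousLinearMap.isClosed_ker j₀
  let j' : ((∀ i, W i) ⧸ S) →L[K] V :=
    ⟨S.liftQ (j₀ : (∀ i, W i) →ₗ[K] V) le_rfl, by exact Continuous.quotient_liftOn' j₀.continuous _⟩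
  refine ⟨(∀ i, W i) ⧸ S, inferInstance, inferInstance, inferInstance,
    isUltrametricDist_quotient S, j',
    fun i y => S.mkQL (ContinuousLinearMap.single K W i (h i y)),
    LinearMap.ker_eq_bot.1 (Submodule.ker_liftQ_eq_bot _ _ _ le_rfl), fun i => ⟨?_, ?_⟩⟩
  · exact clm_comp_analyticAt S.mkQL (clm_comp_analyticAt (ContinuousLinearMap.single K W i) (hh i))
  · filter_upwards [e i] with y hy
    rw [hy]
    change _ = j₀ (Pi.single i (h i y))
    simp only [j₀, sum_apply, ContinuousLinearMap.comp_apply, ContinuousLinearMap.proj_apply]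
    rw [Finset.sum_eq_single i]
    · simp
    · intro b _ hb; simp [hb]
    · simp

/-- Injectivity allows identities between values in `V` to be checked in the Banach space. -/
theorem LA.exists_inj {f : N → V} {x : N} (hf : LA K f x) :
    ∃ (W : Type v) (_ : NormedAddCommGroup W) (_ : NormedSpace K W) (_ : CompleteSpace W)
      (_ : IsUltrametricDist W) (j : W →L[K] V) (h : N → W), Function.Injective j ∧
      AnalyticAt K h x ∧ ∀ᶠ y in 𝓝 x, f y = j (h y) := by
  obtain ⟨W, i1, i2, i3, i4, j, h, hj, H⟩ := LA.exists_common (ι := Unit) fun _ => hf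
  exact ⟨W, i1, i2, i3, i4, j, h (), hj, H ()⟩

theorem LA.exists_pair {f g : N → V} {x : N} (hf : LA K f x) (hg : LA K g x) :
    ∃ (W : Type v) (_ : NormedAddCommGroup W) (_ : NormedSpace K W) (_ : CompleteSpace W)
      (_ : IsUltrametricDist W) (j : W →L[K] V) (h k : N → W), Function.Injective j ∧
      AnalyticAt K h x ∧ AnalyticAt K k x ∧
      ∀ᶠ y in 𝓝 x, f y = j (h y) ∧ g y = j (k y) := by
  obtain ⟨W, i1, i2, i3, i4, j, h, hj, H⟩ := LA.exists_common (K := K) (x := x)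
    (f := fun b : Bool => if b then f else g)
    (fun b => by cases b <;> simpa)
  have h1 := H true
  have h2 := H false
  simp only [if_true, Bool.false_eq_true, if_false] at h1 h2
  exact ⟨W, i1, i2, i3, i4, j, h true, h false, hj, h1.1, h2.1, h1.2.and h2.2⟩

theorem LA.add {f g : N → V} {x : N} (hf : LA K f x) (hg : LA K g x) :
    LA K (fun y => f y + g y) x := by
  obtain ⟨W, i1, i2, i3, i4, j, h, k, -, hh, hk, e⟩ := hf.exists_pair hg
  refine ⟨W, i1, i2, i3, i4, j, fun y => h y + k y, hh.add hk, ?_⟩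
  filter_upwards [e] with y hy
  rw [hy.1, hy.2, map_add]

variable [ContinuousSMul K V]

/-- All calculus with values in `V` is done in the Banach space and transported by `j`. -/
theorem fderiv_clm_comp {W : Type*} [NormedAddCommGroup W] [NormedSpace K W] (j : W →L[K] V)
    {h : N → W} {f : N → V} {x : N} (hh : DifferentiableAt K h x)
    (e : ∀ᶠ y in 𝓝 x, f y = j (h y)) : fderiv K f x = j.comp (fderiv K h x) :=
  ((hasFDerivAt_clm_comp j hh.hasFDerivAt).congr_of_eventuallyEq e).fderiv

theorem eventually_fderiv_clm_comp {W : Type*} [NormedAddCommGroup W] [NormedSpace K W]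
    [CompleteSpace W] (j : W →L[K] V)
    {h : N → W} {f : N → V} {x : N} (hh : AnalyticAt K h x)
    (e : ∀ᶠ y in 𝓝 x, f y = j (h y)) : ∀ᶠ y in 𝓝 x, fderiv K f y = j.comp (fderiv K h y) := by
  filter_upwards [hh.eventually_analyticAt, e.eventually_nhds] with y h1 h2
  exact fderiv_clm_comp j h1.differentiableAt h2

theorem LA.fderiv_apply {f : N → V} {x : N} (hf : LA K f x) {ξ : N → N} (hξ : AnalyticAt K ξ x) :
    LA K (fun y => fderiv K f y (ξ y)) x := by
  obtain ⟨W, _, _, _, _, j, h, hh, e⟩ := hf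
  refine ⟨W, _, _, ‹_›, ‹_›, j, fun y => fderiv K h y (ξ y), ?_, ?_⟩
  · exact (ContinuousLinearMap.analyticAt_bilinear (ContinuousLinearMap.id K (N →L[K] W))
      (fderiv K h x, ξ x)).comp₂ hh.fderiv hξ
  · filter_upwards [eventually_fderiv_clm_comp j hh e] with y hy
    rw [hy]; rfl

theorem LA.fderiv_add {f g : N → V} {x : N} (hf : LA K f x) (hg : LA K g x) :
    ∀ᶠ y in 𝓝 x, fderiv K (fun y => f y + g y) y = fderiv K f y + fderiv K g y := by
  obtain ⟨W, i1, i2, i3, i4, j, h, k, -, hh, hk, e⟩ := hf.exists_pair hg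
  have e' : ∀ᶠ y in 𝓝 x, f y + g y = j (h y + k y) := e.mono fun y hy => by
    rw [hy.1, hy.2, map_add]
  filter_upwards [eventually_fderiv_clm_comp j hh (e.mono fun y hy => hy.1),
    eventually_fderiv_clm_comp j hk (e.mono fun y hy => hy.2),
    eventually_fderiv_clm_comp j (hh.add hk) e',
    hh.eventually_analyticAt, hk.eventually_analyticAt] with y h1 h2 h3 h4 h5
  rw [h1, h2, h3, _root_.fderiv_add h4.differentiableAt h5.differentiableAt,
    ContinuousLinearMap.comp_add]

variable [IsTopologicalAddGroup V'] [T2Space V'] [ContinuousSMul K V']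

theorem LA.fderiv_clm {f : N → V} {x : N} (hf : LA K f x) (T : V →L[K] V') :
    ∀ᶠ y in 𝓝 x, fderiv K (fun y => T (f y)) y = T.comp (fderiv K f y) := by
  obtain ⟨W, i1, i2, i3, i4, j, h, hh, e⟩ := hf
  filter_upwards [eventually_fderiv_clm_comp j hh e, eventually_fderiv_clm_comp (T.comp j) hh
    (e.mono fun y hy => show T (f y) = _ by rw [hy]; rfl)] with y h1 h2
  rw [h1, h2]; rfl

/-- The chain rule for a locally analytic function and an analytic change of variables. -/
theorem LA.fderiv_comp {f : N → V} {ψ : N' → N} {x : N'} (hf : LA K f (ψ x))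
    (hψ : DifferentiableAt K ψ x) :
    fderiv K (fun y => f (ψ y)) x = (fderiv K f (ψ x)).comp (fderiv K ψ x) := by
  obtain ⟨W, i1, i2, i3, i4, j, h, hh, e⟩ := hf
  rw [fderiv_clm_comp j hh.differentiableAt e,
    fderiv_clm_comp j (h := fun y => h (ψ y)) (hh.differentiableAt.comp x hψ)
      (hψ.continuousAt.eventually e)]
  rw [show (fun y => h (ψ y)) = h ∘ ψ from rfl, _root_.fderiv_comp x hh.differentiableAt hψ]
  rfl

end LA

end LocAn

end
noncomputable section
namespace LocAn

/-! ### Germs of equivariant functions -/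

section EqGerm

set_option linter.unusedSectionVars false

open Filter

/-- A germ of an analytic action on a neighbourhood of `0` in `N`. (No laws of actions are needed
for the definition of equivariant germs.) -/
structure LocAct (K Γ N : Type*) [NontriviallyNormedField K] [NormedAddCommGroup Γ]
    [NormedSpace K Γ] [NormedAddCommGroup N] [NormedSpace K N] where
  act : Γ → N → N
  analyticAt : AnalyticAt K (fun z : Γ × N => act z.1 z.2) 0
  act_zero : act 0 0 = 0

namespace LocAct

variable {K : Type*} [NontriviallyNormedField K]
  {Γ : Type*} [NormedAddCommGroup Γ] [NormedSpace K Γ]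
  {N : Type*} [NormedAddCommGroup N] [NormedSpace K N]
  {N' : Type*} [NormedAddCommGroup N'] [NormedSpace K N']

theorem tendsto (A : LocAct K Γ N) : Tendsto (fun z : Γ × N => A.act z.1 z.2) (𝓝 0) (𝓝 0) := by
  have h := A.analyticAt.continuousAt
  rwa [ContinuousAt, show A.act (0 : Γ × N).1 (0 : Γ × N).2 = 0 from A.act_zero] at h

theorem analyticAt_slice [CompleteSpace N] (A : LocAct K Γ N) :
    ∀ᶠ z : Γ × N in 𝓝 0, AnalyticAt K (A.act z.1) z.2 := by
  filter_upwards [A.analyticAt.eventually_analyticAt] with z hz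
  exact AnalyticAt.comp (f := fun y => (z.1, y)) (g := fun z : Γ × N => A.act z.1 z.2) hz
    (analyticAt_const.prod analyticAt_id)

/-- The trivial action. -/
def triv (K Γ N : Type*) [NontriviallyNormedField K] [NormedAddCommGroup Γ]
    [NormedSpace K Γ] [NormedAddCommGroup N] [NormedSpace K N] : LocAct K Γ N where
  act _ n := n
  analyticAt := analyticAt_snd
  act_zero := rfl

/-- The action on a product. -/
def prod (A : LocAct K Γ N) (A' : LocAct K Γ N') : LocAct K Γ (N × N') where
  act γ n := (A.act γ n.1, A'.act γ n.2)
  analyticAt := by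
    refine AnalyticAt.prod ?_ ?_
    · exact AnalyticAt.comp (f := fun z : Γ × (N × N') => (z.1, z.2.1))
        (g := fun z : Γ × N => A.act z.1 z.2) A.analyticAt
        (analyticAt_fst.prod (analyticAt_fst.comp analyticAt_snd))
    · exact AnalyticAt.comp (f := fun z : Γ × (N × N') => (z.1, z.2.2))
        (g := fun z : Γ × N' => A'.act z.1 z.2) A'.analyticAt
        (analyticAt_fst.prod (analyticAt_snd.comp analyticAt_snd))
  act_zero := by simp [A.act_zero, A'.act_zero]

/-- The diagonal action on a power. -/
def pi (A : LocAct K Γ N) (ι : Type*) [Fintype ι] : LocAct K Γ (ι → N) where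
  act γ n i := A.act γ (n i)
  analyticAt := by
    rw [analyticAt_pi_iff]
    intro i
    exact AnalyticAt.comp (f := fun z : Γ × (ι → N) => (z.1, z.2 i))
        (g := fun z : Γ × N => A.act z.1 z.2) A.analyticAt
        (analyticAt_fst.prod (((ContinuousLinearMap.proj (R := K) (φ := fun _ : ι => N)
          i).analyticAt _).comp analyticAt_snd))
  act_zero := by
    ext i
    simp [A.act_zero]

end LocAct

variable {K : Type w} [NontriviallyNormedField K]
  {Γ : Type*} [NormedAddCommGroup Γ] [NormedSpace K Γ]
  {N : Type*} [NormedAddCommGroup N] [NormedSpace K N]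
  {Γ' : Type*} [NormedAddCommGroup Γ'] [NormedSpace K Γ']
  {N' : Type*} [NormedAddCommGroup N'] [NormedSpace K N']
  {V : Type v} [AddCommGroup V] [Module K V] [TopologicalSpace V] [IsTopologicalAddGroup V]
  [T2Space V] [ContinuousSMul K V]
  {V' : Type v} [AddCommGroup V'] [Module K V'] [TopologicalSpace V'] [IsTopologicalAddGroup V']
  [T2Space V'] [ContinuousSMul K V']

/-- `F` is equivariant near `0`. -/
def IsEq (A : LocAct K Γ N) (r : Γ → V →L[K] V) (F : N → V) : Prop :=
  ∀ᶠ z : Γ × N in 𝓝 0, F (A.act z.1 z.2) = r z.1 (F z.2)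

/-- Equivariance depends on the germ only, because the action fixes `0` and is continuous there. -/
theorem IsEq.congr {A : LocAct K Γ N} {r : Γ → V →L[K] V} {F F' : N → V} (h : IsEq A r F)
    (e : F =ᶠ[𝓝 0] F') : IsEq A r F' := by
  have h2 : Tendsto (fun z : Γ × N => z.2) (𝓝 0) (𝓝 0) := continuous_snd.tendsto' _ _ rfl
  filter_upwards [h, A.tendsto.eventually e, h2.eventually e] with z h1 h2 h3
  rw [← h2, ← h3, h1]

variable (A : LocAct K Γ N) (r : Γ → V →L[K] V)

/-- The germs at `0` of locally analytic equivariant functions. -/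
def eqGerm : Submodule K ((𝓝 (0 : N)).Germ V) where
  carrier := {φ | ∃ F : N → V, LA K F 0 ∧ IsEq A r F ∧ φ = F}
  zero_mem' := ⟨fun _ => 0, LA.zero 0, by simp [IsEq], rfl⟩
  add_mem' := by
    rintro _ _ ⟨F, h1, h2, rfl⟩ ⟨F', h1', h2', rfl⟩
    refine ⟨_, h1.add h1', ?_, rfl⟩
    filter_upwards [h2, h2'] with z h h'
    rw [h, h', map_add]
  smul_mem' := by
    rintro c _ ⟨F, h1, h2, rfl⟩
    refine ⟨_, h1.clm_comp (c • ContinuousLinearMap.id K V), ?_, rfl⟩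
    filter_upwards [h2] with z h
    simp [h]

variable {A r}

/-- The germ of a function, as a linear map. -/
def germL (K N V : Type*) [NontriviallyNormedField K] [NormedAddCommGroup N] [AddCommGroup V]
    [Module K V] : (N → V) →ₗ[K] (𝓝 (0 : N)).Germ V where
  toFun F := F
  map_add' _ _ := rfl
  map_smul' _ _ := rfl

theorem germL_eq_iff {F F' : N → V} : germL K N V F = germL K N V F' ↔ F =ᶠ[𝓝 0] F' :=
  Germ.coe_eq

/-- The class of an equivariant function. -/
def eqGerm.mk (F : N → V) (h : LA K F 0) (h' : IsEq A r F) : eqGerm A r := ⟨F, F, h, h', rfl⟩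

theorem eqGerm.exists_rep (φ : eqGerm A r) : ∃ F h h', φ = eqGerm.mk F h h' := by
  obtain ⟨_, F, h, h', rfl⟩ := φ
  exact ⟨F, h, h', rfl⟩

theorem eqGerm.exists_germL (φ : eqGerm A r) :
    ∃ F, LA K F 0 ∧ IsEq A r F ∧ φ.1 = germL K N V F := by
  obtain ⟨F, h, h', rfl⟩ := eqGerm.exists_rep φ
  exact ⟨F, h, h', rfl⟩

theorem isEq_of_coe (φ : eqGerm A r) {F : N → V} (h : φ.1 = germL K N V F) : IsEq A r F := by
  obtain ⟨F', h1, h2, rfl⟩ := eqGerm.exists_rep φ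
  exact h2.congr (Germ.coe_eq.1 h)

theorem eqGerm.mk_eq_mk {F F' : N → V} {h : LA K F 0} {h' : IsEq A r F} {k : LA K F' 0}
    {k' : IsEq A r F'} : eqGerm.mk F h h' = eqGerm.mk F' k k' ↔ F =ᶠ[𝓝 0] F' := by
  exact Subtype.ext_iff.trans Germ.coe_eq

/-! #### Pullback -/

/-- The data for pulling back equivariant germs along `ψ : N' → N`, a homomorphism `f : Γ' → Γ` of
groups and a map `T : V → V'` of representations. -/
structure EqMap (A : LocAct K Γ N) (r : Γ → V →L[K] V) (A' : LocAct K Γ' N')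
    (r' : Γ' → V' →L[K] V') where
  f : Γ' → Γ
  f_tendsto : Tendsto f (𝓝 0) (𝓝 0)
  ψ : N' → N
  analyticAt : AnalyticAt K ψ 0
  map_zero : ψ 0 = 0
  map_act : ∀ᶠ z : Γ' × N' in 𝓝 0, ψ (A'.act z.1 z.2) = A.act (f z.1) (ψ z.2)
  T : V →L[K] V'
  map_rep : ∀ᶠ γ in 𝓝 (0 : Γ'), ∀ v, T (r (f γ) v) = r' γ (T v)

namespace EqMap

variable {A' : LocAct K Γ' N'} {r' : Γ' → V' →L[K] V'} (m : EqMap A r A' r')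

theorem tendsto : Tendsto m.ψ (𝓝 0) (𝓝 0) := by
  have := m.analyticAt.continuousAt
  rwa [ContinuousAt, m.map_zero] at this

theorem pullback_LA {F : N → V} (h : LA K F 0) : LA K (fun n => m.T (F (m.ψ n))) 0 :=
  (LA.comp (by rwa [m.map_zero]) m.analyticAt).clm_comp m.T

theorem pullback_isEq {F : N → V} (h : IsEq A r F) : IsEq A' r' (fun n => m.T (F (m.ψ n))) := by
  have h1 : Tendsto (fun z : Γ' × N' => (m.f z.1, m.ψ z.2)) (𝓝 0) (𝓝 0) := by
    refine Tendsto.prodMk_nhds (m.f_tendsto.comp (continuous_fst.tendsto' _ _ rfl))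
      (m.tendsto.comp (continuous_snd.tendsto' _ _ rfl))
  have h2 : Tendsto (fun z : Γ' × N' => z.1) (𝓝 0) (𝓝 0) := continuous_fst.tendsto' _ _ rfl
  filter_upwards [h1.eventually h, m.map_act, h2.eventually m.map_rep] with z k1 k2 k3
  rw [k2, k1, k3]

/-- The pullback of equivariant germs. -/
def pullback : eqGerm A r →ₗ[K] eqGerm A' r' where
  toFun φ := ⟨(φ.1.map m.T).compTendsto m.ψ m.tendsto, by
    obtain ⟨F, h, h', rfl⟩ := eqGerm.exists_rep φ
    exact ⟨_, m.pullback_LA h, m.pullback_isEq h', rfl⟩⟩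
  map_add' φ φ' := by
    obtain ⟨F, h, h', rfl⟩ := eqGerm.exists_rep φ
    obtain ⟨F', k, k', rfl⟩ := eqGerm.exists_rep φ'
    refine Subtype.ext (Germ.coe_eq.2 (.of_forall fun n => ?_))
    exact map_add m.T _ _
  map_smul' c φ := by
    obtain ⟨F, h, h', rfl⟩ := eqGerm.exists_rep φ
    refine Subtype.ext (Germ.coe_eq.2 (.of_forall fun n => ?_))
    exact map_smul m.T _ _

theorem pullback_mk {F : N → V} (h : LA K F 0) (h' : IsEq A r F) :
    m.pullback (eqGerm.mk F h h') =
      eqGerm.mk (fun n => m.T (F (m.ψ n))) (m.pullback_LA h) (m.pullback_isEq h') := rfl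

theorem pullback_coe {φ : eqGerm A r} {F : N → V} (h : φ.1 = germL K N V F) :
    (m.pullback φ).1 = germL K N' V' fun n => m.T (F (m.ψ n)) := by
  obtain ⟨φ, hφ⟩ := φ
  change φ = _ at h
  subst h
  rfl

/-- A linear equivariant map, as a datum for pulling back. -/
def ofCLM {A : LocAct K Γ N} {A' : LocAct K Γ N'} (r : Γ → V →L[K] V) (ψ : N' →L[K] N)
    (h : ∀ γ n, ψ (A'.act γ n) = A.act γ (ψ n)) : EqMap A r A' r where
  f := id
  f_tendsto := tendsto_id
  ψ := ψ
  analyticAt := ψ.analyticAt 0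
  map_zero := _root_.map_zero ψ
  map_act := .of_forall fun z => h z.1 z.2
  T := ContinuousLinearMap.id K V
  map_rep := .of_forall fun _ _ => rfl

end EqMap

/-! #### Derivations -/

theorem eventuallyEq_fderiv {f g : N → V} {x : N} (h : f =ᶠ[𝓝 x] g) :
    fderiv K f =ᶠ[𝓝 x] fderiv K g := by
  filter_upwards [h.eventuallyEq_nhds] with y hy
  exact hy.fderiv_eq

variable (A) in
/-- An invariant analytic vector field. -/
structure InvField where
  ξ : N → N
  analyticAt : AnalyticAt K ξ 0
  inv : ∀ᶠ z : Γ × N in 𝓝 0, fderiv K (A.act z.1) z.2 (ξ z.2) = ξ (A.act z.1 z.2)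

namespace InvField

variable [CompleteSpace N] (X : InvField A)

/-- Differentiate `F (γ n) = r γ (F n)` in `n` along the field: invariance of the field gives the
left-hand side, and continuity of the linear map `r γ` lets it pass through the derivative. -/
theorem isEq {F : N → V} (h : LA K F 0) (h' : IsEq A r F) :
    IsEq A r (fun n => fderiv K F n (X.ξ n)) := by
  have hs : Tendsto (fun z : Γ × N => z.2) (𝓝 0) (𝓝 0) := continuous_snd.tendsto' _ _ rfl
  filter_upwards [X.inv, h'.eventually_nhds, A.tendsto.eventually h.eventually,
    hs.eventually h.eventually, A.analyticAt_slice] with z h1 h2 h3 h4 h5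
  have e : ∀ᶠ y in 𝓝 z.2, F (A.act z.1 y) = r z.1 (F y) := by
    have : Tendsto (fun y => (z.1, y)) (𝓝 z.2) (𝓝 z) := by
      have := (Continuous.prodMk_right z.1 (Y := N)).tendsto z.2
      exact this
    exact this.eventually h2
  have e1 := LA.fderiv_comp (ψ := A.act z.1) h3 h5.differentiableAt
  have e2 : fderiv K (fun y => F (A.act z.1 y)) z.2 = fderiv K (fun y => r z.1 (F y)) z.2 :=
    (Filter.EventuallyEq.fderiv_eq (𝕜 := K) e)
  have e3 := (h4.fderiv_clm (r z.1)).self_of_nhds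
  rw [← h1, ← ContinuousLinearMap.comp_apply, ← e1, e2, e3]
  rfl

/-- The derivation of equivariant germs given by an invariant vector field. -/
def der : eqGerm A r →ₗ[K] eqGerm A r where
  toFun φ := ⟨Quotient.map' (fun (F : N → V) n => fderiv K F n (X.ξ n)) (fun F F' h => by
      filter_upwards [eventuallyEq_fderiv (K := K) h] with n hn
      rw [hn]) φ.1, by
    obtain ⟨F, h, h', rfl⟩ := eqGerm.exists_rep φ
    exact ⟨_, h.fderiv_apply X.analyticAt, X.isEq h h', rfl⟩⟩
  map_add' φ φ' := by
    obtain ⟨F, h, h', rfl⟩ := eqGerm.exists_rep φ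
    obtain ⟨F', k, k', rfl⟩ := eqGerm.exists_rep φ'
    refine Subtype.ext (Germ.coe_eq.2 ?_)
    filter_upwards [LA.fderiv_add h k] with n hn
    exact (congrArg (fun l => l (X.ξ n)) hn)
  map_smul' c φ := by
    obtain ⟨F, h, h', rfl⟩ := eqGerm.exists_rep φ
    refine Subtype.ext (Germ.coe_eq.2 ?_)
    filter_upwards [LA.fderiv_clm h (c • ContinuousLinearMap.id K V)] with n hn
    exact (congrArg (fun l => l (X.ξ n)) hn)

theorem der_mk {F : N → V} (h : LA K F 0) (h' : IsEq A r F) :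
    X.der (eqGerm.mk F h h') = eqGerm.mk (fun n => fderiv K F n (X.ξ n))
      (h.fderiv_apply X.analyticAt) (X.isEq h h') := rfl

theorem der_coe {φ : eqGerm A r} {F : N → V} (h : φ.1 = germL K N V F) :
    (X.der φ).1 = germL K N V fun n => fderiv K F n (X.ξ n) := by
  obtain ⟨φ, hφ⟩ := φ
  change φ = _ at h
  subst h
  rfl

/-- The derivations given by a linear family of invariant vector fields. -/
def derL {L : Type*} [AddCommGroup L] [Module K L] (X : L → InvField A)
    (hadd : ∀ a b n, (X (a + b)).ξ n = (X a).ξ n + (X b).ξ n)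
    (hsmul : ∀ (c : K) a n, (X (c • a)).ξ n = c • (X a).ξ n) :
    L →ₗ[K] eqGerm A r →ₗ[K] eqGerm A r where
  toFun a := (X a).der
  map_add' a b := by
    refine LinearMap.ext fun φ => ?_
    obtain ⟨F, h, h', rfl⟩ := eqGerm.exists_rep φ
    refine Subtype.ext (Germ.coe_eq.2 (.of_forall fun z => ?_))
    change fderiv K F z ((X (a + b)).ξ z) = fderiv K F z ((X a).ξ z) + fderiv K F z ((X b).ξ z)
    rw [hadd, map_add]
  map_smul' c a := by
    refine LinearMap.ext fun φ => ?_
    obtain ⟨F, h, h', rfl⟩ := eqGerm.exists_rep φ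
    refine Subtype.ext (Germ.coe_eq.2 (.of_forall fun z => ?_))
    change fderiv K F z ((X (c • a)).ξ z) = c • fderiv K F z ((X a).ξ z)
    rw [hsmul, map_smul]

/-- Naturality of the derivations along related vector fields. -/
theorem pullback_der [CompleteSpace N'] {A' : LocAct K Γ' N'} {r' : Γ' → V' →L[K] V'}
    (m : EqMap A r A' r')
    (X' : InvField A') (hX : ∀ᶠ n in 𝓝 0, fderiv K m.ψ n (X'.ξ n) = X.ξ (m.ψ n))
    (φ : eqGerm A r) : m.pullback (X.der φ) = X'.der (m.pullback φ) := by
  obtain ⟨F, h, h', rfl⟩ := eqGerm.exists_rep φ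
  rw [der_mk, EqMap.pullback_mk, EqMap.pullback_mk, der_mk, eqGerm.mk_eq_mk]
  filter_upwards [hX, m.tendsto.eventually h.eventually, m.analyticAt.eventually_analyticAt]
    with n h1 h2 h3
  have h4 : LA K (fun n => F (m.ψ n)) n := LA.comp h2 h3
  rw [(h4.fderiv_clm m.T).self_of_nhds, LA.fderiv_comp h2 h3.differentiableAt, ← h1]
  rfl

end InvField

end EqGerm

end LocAn

end
noncomputable section
namespace LocAn

/-! ### Alternating forms in coordinates -/

section AltForm

set_option linter.unusedSectionVars false

open Module

/-- Expand `f` multilinearly after permuting the arguments and sum over all permutations with signs;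
the products of coordinates become determinants. Summing over all index tuples avoids choosing
increasing ones, at the price of `q!`, which is invertible in characteristic `0`. -/
theorem factorial_smul_alternatingMap {K M N ι : Type*} [Field K] [AddCommGroup M] [Module K M]
    [AddCommGroup N] [Module K N] [Fintype ι] (b : Basis ι K M) {q : ℕ}
    (f : M [⋀^Fin q]→ₗ[K] N) (v : Fin q → M) :
    (q.factorial : K) • f v = ∑ m : Fin q → ι,
      (Matrix.of fun i j => b.repr (v i) (m j)).det • f (fun i => b (m i)) := by
  classical
  have key : ∀ u : Fin q → M, f u = ∑ m : Fin q → ι,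
      (∏ i, b.repr (u i) (m i)) • f (fun i => b (m i)) := by
    intro u
    conv_lhs => rw [show u = fun i => ∑ k, b.repr (u i) k • b k from
      funext fun i => (b.sum_repr (u i)).symm]
    rw [← AlternatingMap.coe_multilinearMap, MultilinearMap.map_sum]
    exact Finset.sum_congr rfl fun m _ => MultilinearMap.map_smul_univ _ _ _
  have h2 : ∀ π : Equiv.Perm (Fin q), f v = ∑ m : Fin q → ι,
      ((Equiv.Perm.sign π : ℤ) : K) • (∏ i, b.repr (v (π i)) (m i)) • f (fun i => b (m i)) := by
    intro π
    rw [← Finset.smul_sum, ← key (fun i => v (π i))]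
    have := f.map_perm v π
    rw [show (fun i => v (π i)) = v ∘ π from rfl, this, Units.smul_def, ← Int.cast_smul_eq_zsmul K,
      smul_smul, ← Int.cast_mul, ← Units.val_mul, Int.units_mul_self]
    simp
  calc (q.factorial : K) • f v = ∑ _π : Equiv.Perm (Fin q), f v := by
        simp [Fintype.card_perm, Nat.cast_smul_eq_nsmul]
    _ = ∑ π : Equiv.Perm (Fin q), ∑ m : Fin q → ι,
      ((Equiv.Perm.sign π : ℤ) : K) • (∏ i, b.repr (v (π i)) (m i)) • f (fun i => b (m i)) :=
        Finset.sum_congr rfl fun π _ => h2 π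
    _ = _ := by
        rw [Finset.sum_comm]
        refine Finset.sum_congr rfl fun m _ => ?_
        rw [Matrix.det_apply, Finset.sum_smul]
        refine Finset.sum_congr rfl fun π _ => ?_
        rw [smul_smul, Units.smul_def, ← Int.cast_smul_eq_zsmul K, smul_eq_mul]
        rfl

variable {K : Type*} [NontriviallyNormedField K] [CompleteSpace K] {E : Type*}
  [NormedAddCommGroup E] [NormedSpace K E] [FiniteDimensional K E]
  {W : Type*} [NormedAddCommGroup W] [NormedSpace K W] {ι : Type*} [Fintype ι]

/-- The alternating form `v ↦ det (b_{m j}^* (v_i))`. -/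
def altForm (b : Basis ι K E) {q : ℕ} (m : Fin q → ι) : E [⋀^Fin q]→L[K] K where
  toMultilinearMap := ((Matrix.detRowAlternating (n := Fin q) (R := K)).compLinearMap
    (LinearMap.pi fun j => b.coord (m j))).toMultilinearMap
  cont := by
    change Continuous fun v : Fin q → E => (Matrix.of fun i j => b.repr (v i) (m j)).det
    refine Continuous.matrix_det (continuous_pi fun i => continuous_pi fun j => ?_)
    exact (LinearMap.continuous_of_finiteDimensional (b.coord (m j))).comp (continuous_apply i)
  map_eq_zero_of_eq' v i j h hij :=
    ((Matrix.detRowAlternating (n := Fin q) (R := K)).compLinearMap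
      (LinearMap.pi fun j => b.coord (m j))).map_eq_zero_of_eq v h hij

theorem altForm_apply (b : Basis ι K E) {q : ℕ} (m : Fin q → ι) (v : Fin q → E) :
    altForm b m v = (Matrix.of fun i j => b.repr (v i) (m j)).det := rfl

/-- `w ↦ f ⊗ w` as a continuous linear map. -/
def smulRightCLM {q : ℕ} (f : E [⋀^Fin q]→L[K] K) : W →L[K] (E [⋀^Fin q]→L[K] W) :=
  LinearMap.mkContinuous
    { toFun := fun w => f.smulRight w
      map_add' := fun w w' => by ext v; exact smul_add _ _ _
      map_smul' := fun c w => by ext v; exact smul_comm _ _ _ } ‖f‖ (fun w => by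
      refine ContinuousAlternatingMap.opNorm_le_bound _ (by positivity) fun v => ?_
      change ‖f v • w‖ ≤ _
      rw [norm_smul]
      calc _ ≤ (‖f‖ * ∏ i, ‖v i‖) * ‖w‖ := by gcongr; exact f.le_opNorm v
        _ = _ := by ring)

theorem smulRightCLM_apply {q : ℕ} (f : E [⋀^Fin q]→L[K] K) (w : W) (v : Fin q → E) :
    smulRightCLM f w v = f v • w := rfl

theorem form_apply_eq_sum [CharZero K] (b : Basis ι K E) {q : ℕ} (f : E [⋀^Fin q]→L[K] W)
    (v : Fin q → E) :
    f v = (q.factorial : K)⁻¹ • ∑ m : Fin q → ι, altForm b m v • f (fun i => b (m i)) := by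
  have := factorial_smul_alternatingMap b f.toAlternatingMap v
  rw [eq_inv_smul_iff₀ (by exact_mod_cast q.factorial_ne_zero)]
  exact this

variable {N : Type*} [NormedAddCommGroup N] [NormedSpace K N]

theorem analyticAt_apply_form {q : ℕ} {η : N → E [⋀^Fin q]→L[K] W} {z : N}
    (h : AnalyticAt K η z) (v : Fin q → E) : AnalyticAt K (fun z => η z v) z :=
  clm_comp_analyticAt (ContinuousAlternatingMap.apply K E W v) h

/-- A form is a fixed linear expression in its finitely many values on basis vectors. -/
theorem analyticAt_form_of_apply [CharZero K] (b : Basis ι K E) {q : ℕ}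
    {η : N → E [⋀^Fin q]→L[K] W} {z : N}
    (h : ∀ m : Fin q → ι, AnalyticAt K (fun z => η z (fun i => b (m i))) z) :
    AnalyticAt K η z := by
  have e : η = fun z => (q.factorial : K)⁻¹ •
      ∑ m : Fin q → ι, smulRightCLM (altForm b m) (η z (fun i => b (m i))) := by
    ext z v
    rw [form_apply_eq_sum b]
    rw [ContinuousAlternatingMap.smul_apply, ContinuousAlternatingMap.sum_apply]
    rfl
  rw [e]
  have h1 : AnalyticAt K (fun z =>
      ∑ m : Fin q → ι, smulRightCLM (altForm b m) (η z (fun i => b (m i)))) z :=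
    Finset.analyticAt_fun_sum _ fun m _ => clm_comp_analyticAt (smulRightCLM (altForm b m)) (h m)
  exact AnalyticAt.fun_const_smul h1

theorem analyticAt_altForm_apply (b : Basis ι K E) {q : ℕ} (m : Fin q → ι)
    {v : N → Fin q → E} {z : N} (hv : ∀ i, AnalyticAt K (fun z => v z i) z) :
    AnalyticAt K (fun z => altForm b m (v z)) z := by
  simp only [altForm_apply, Matrix.det_apply']
  refine Finset.analyticAt_fun_sum _ fun π _ => analyticAt_const.mul ?_
  refine Finset.analyticAt_fun_prod _ fun i _ => ?_
  exact clm_comp_analyticAt (LinearMap.toContinuousLinearMap (b.coord (m i))) (hv (π i))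

theorem analyticAt_form_apply [CharZero K] {q : ℕ} {η : N → E [⋀^Fin q]→L[K] W} {z : N}
    (h : AnalyticAt K η z) {v : N → Fin q → E} (hv : ∀ i, AnalyticAt K (fun z => v z i) z) :
    AnalyticAt K (fun z => η z (v z)) z := by
  let b := Module.finBasis K E
  have e : (fun z => η z (v z)) = fun z => (q.factorial : K)⁻¹ •
      ∑ m : Fin q → _, altForm b m (v z) • η z (fun i => b (m i)) := by
    ext z
    exact form_apply_eq_sum b _ _
  rw [e]
  refine AnalyticAt.fun_const_smul (Finset.analyticAt_fun_sum _ fun m _ => ?_)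
  exact (analyticAt_altForm_apply b m hv).smul (analyticAt_apply_form h _)

end AltForm

end LocAn

end
noncomputable section
namespace LocAn

/-! ### The de Rham complex of equivariant germs in a frame -/

section Frame

open Filter Module

set_option linter.unusedSectionVars false

/-- A germ of an analytic frame of the tangent bundle of `E`, indexed by a Lie algebra `L` whose
bracket is the bracket of the corresponding vector fields. -/
structure Frame (K E L : Type*) [NontriviallyNormedField K] [NormedAddCommGroup E]
    [NormedSpace K E] [LieRing L] [LieAlgebra K L] where
  B : E → E →L[K] E
  analyticAt : AnalyticAt K B 0
  isUnit : IsUnit (B 0)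
  θ : L ≃ₗ[K] E
  lie : ∀ a b, ∀ᶠ y in 𝓝 (0 : E), VectorField.lieBracket K (fun y => B y (θ a))
    (fun y => B y (θ b)) y = B y (θ ⁅a, b⁆)

variable {K : Type w} [NontriviallyNormedField K] [CompleteSpace K]
  {Γ : Type*} [NormedAddCommGroup Γ] [NormedSpace K Γ]
  {P : Type*} [NormedAddCommGroup P] [NormedSpace K P] [CompleteSpace P]
  {E : Type*} [NormedAddCommGroup E] [NormedSpace K E] [FiniteDimensional K E] [CompleteSpace E]
  {L : Type*} [LieRing L] [LieAlgebra K L]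
  {V : Type v} [AddCommGroup V] [Module K V] [TopologicalSpace V] [IsTopologicalAddGroup V]
  [T2Space V] [ContinuousSMul K V]

namespace Frame

variable (Fr : Frame K E L)

/-- The inverse frame. -/
def C (y : E) : E →L[K] E := Ring.inverse (Fr.B y)

theorem analyticAt_C : AnalyticAt K Fr.C 0 := by
  have h := analyticAt_inverse (𝕜 := K) (A := E →L[K] E) Fr.isUnit.unit
  exact AnalyticAt.comp (g := Ring.inverse) (f := Fr.B) h Fr.analyticAt

theorem eventually_isUnit : ∀ᶠ y in 𝓝 (0 : E), IsUnit (Fr.B y) :=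
  Fr.analyticAt.continuousAt.eventually (Units.isOpen.mem_nhds Fr.isUnit)

theorem eventually_inverse : ∀ᶠ y in 𝓝 (0 : E),
    (∀ v, Fr.B y (Fr.C y v) = v) ∧ ∀ v, Fr.C y (Fr.B y v) = v := by
  filter_upwards [Fr.eventually_isUnit] with y hy
  exact ⟨fun v => congrArg (fun l : E →L[K] E => l v) (Ring.mul_inverse_cancel _ hy),
    fun v => congrArg (fun l : E →L[K] E => l v) (Ring.inverse_mul_cancel _ hy)⟩

theorem analyticAt_apply (v : E) : AnalyticAt K (fun y => Fr.B y v) 0 :=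
  clm_comp_analyticAt (ContinuousLinearMap.apply K E v) Fr.analyticAt

theorem analyticAt_snd_apply (v : E) : AnalyticAt K (fun z : P × E => Fr.B z.2 v) 0 :=
  AnalyticAt.comp (f := fun z : P × E => z.2) (g := fun y => Fr.B y v) (x := 0)
    (Fr.analyticAt_apply v) analyticAt_snd

variable (A : LocAct K Γ P)

/-- The vector fields of the frame, as invariant vector fields on `P × E`. -/
def field (a : L) : InvField (A.prod (LocAct.triv K Γ E)) where
  ξ z := (0, Fr.B z.2 (Fr.θ a))
  analyticAt := analyticAt_const.prod (Fr.analyticAt_snd_apply _)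
  inv := by
    have h1 : Tendsto (fun z : Γ × (P × E) => (z.1, z.2.1)) (𝓝 0) (𝓝 0) :=
      Continuous.tendsto' (by fun_prop) _ _ rfl
    filter_upwards [h1.eventually A.analyticAt_slice] with z hz
    have h2 : HasFDerivAt (fun n : P × E => (A.act z.1 n.1, n.2))
        (((fderiv K (A.act z.1) z.2.1).comp (ContinuousLinearMap.fst K P E)).prod
          (ContinuousLinearMap.snd K P E)) z.2 := by
      refine HasFDerivAt.prodMk ?_ hasFDerivAt_snd
      exact HasFDerivAt.comp (g := A.act z.1) z.2 hz.differentiableAt.hasFDerivAt hasFDerivAt_fst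
    change fderiv K (fun n : P × E => (A.act z.1 n.1, n.2)) z.2 (0, _) = (0, _)
    rw [h2.fderiv]
    simp
    rfl

variable (r : Γ → V →L[K] V)

/-- The operation of `L` on equivariant germs. -/
def der : L →ₗ[K] eqGerm (A.prod (LocAct.triv K Γ E)) r →ₗ[K]
    eqGerm (A.prod (LocAct.triv K Γ E)) r :=
  InvField.derL (Fr.field A) (fun a b z => by simp [field]) (fun c a z => by simp [field])

variable {A r} {W : Type v} [NormedAddCommGroup W] [NormedSpace K W]

/-- The germ-valued alternating form `H` is represented by the differential form `η`. -/
def Represents {q : ℕ} (H : L [⋀^Fin q]→ₗ[K] eqGerm (A.prod (LocAct.triv K Γ E)) r) (j : W →L[K] V)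
    (η : P × E → E [⋀^Fin q]→L[K] W) : Prop :=
  ∀ a : Fin q → L, (H a).1 = germL K (P × E) V fun z => j (η z fun i => Fr.B z.2 (Fr.θ (a i)))

variable {Fr} in
-- The invariant formula for the exterior derivative on vector fields has the shape of the
-- Chevalley-Eilenberg differential: evaluated on frame fields, the derivative terms become the
-- operation of `L`, and the brackets of frame fields are the frame fields of the brackets in `L`.
theorem Represents.ceDiff [CompleteSpace W] [CharZero K] {q : ℕ}
    {H : L [⋀^Fin q]→ₗ[K] eqGerm (A.prod (LocAct.triv K Γ E)) r}
    {j : W →L[K] V} {η : P × E → E [⋀^Fin q]→L[K] W} (hη : AnalyticAt K η 0)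
    (h : Fr.Represents H j η) : Fr.Represents (ceDiff (Fr.der A r) q H) j (extDerivSnd η) := by
  have hder : ∀ (x : L) (a : Fin q → L), (Fr.der A r x (H a)).1 = germL K (P × E) V fun z =>
      j (fderiv K (fun y => η (z.1, y) fun i => Fr.B y (Fr.θ (a i))) z.2 (Fr.B z.2 (Fr.θ x))) := by
    intro x a
    have h1 : (Fr.der A r x (H a)).1 = germL K (P × E) V fun z =>
        fderiv K (fun z : P × E => j (η z fun i => Fr.B z.2 (Fr.θ (a i)))) z
          (0, Fr.B z.2 (Fr.θ x)) :=
      InvField.der_coe _ (h a)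
    rw [h1]
    refine Germ.coe_eq.2 ?_
    have han : AnalyticAt K (fun z : P × E => η z fun i => Fr.B z.2 (Fr.θ (a i))) 0 :=
      analyticAt_form_apply hη fun i => Fr.analyticAt_snd_apply _
    filter_upwards [eventually_fderiv_clm_comp j han (.of_forall fun _ => rfl),
      han.eventually_analyticAt] with z h3 h4
    rw [h3, fderiv_slice (f := fun z : P × E => η z fun i => Fr.B z.2 (Fr.θ (a i)))
      h4.differentiableAt]
    rfl
  have hs : Tendsto (fun z : P × E => z.2) (𝓝 0) (𝓝 0) := continuous_snd.tendsto' _ _ rfl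
  have hV : ∀ a : L, ∀ᶠ z : P × E in 𝓝 0,
      DifferentiableAt K (fun y => Fr.B y (Fr.θ a)) z.2 := fun a =>
    hs.eventually ((Fr.analyticAt_apply (Fr.θ a)).eventually_analyticAt.mono
      fun y hy => hy.differentiableAt)
  have hslice : ∀ᶠ z : P × E in 𝓝 0, DifferentiableAt K (fun y => η (z.1, y)) z.2 ∧
      extDerivSnd η z = extDeriv (fun y => η (z.1, y)) z.2 := by
    filter_upwards [hη.eventually_analyticAt] with z hz
    exact ⟨differentiableAt_slice hz.differentiableAt, (extDeriv_slice hz.differentiableAt).symm⟩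
  intro a
  cases q with
  | zero =>
    rw [ceDiff_zero_apply, hder]
    refine Germ.coe_eq.2 ?_
    filter_upwards [hslice, eventually_all.2 fun i => hV (a i)] with z h1 h3
    rw [h1.2]
    -- For a single vector field the commutation condition is vacuous.
    rw [extDeriv_apply_vectorField_of_pairwise_commute (V := fun i y => Fr.B y (Fr.θ (a i))) h1.1
      h3 (fun i j hij => (hij (Fin.ext (by omega))).elim)]
    rw [Fin.sum_univ_succ]
    simp only [Finset.univ_eq_empty, Finset.sum_empty, add_zero, Fin.val_zero, pow_zero, one_smul]
    congr 5
    ext y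
    congr 1
    exact Subsingleton.elim _ _
  | succ q =>
    rw [ceDiff_succ_apply]
    simp only [AddSubgroupClass.coe_sub, AddSubmonoidClass.coe_finsetSum,
      ← Int.cast_smul_eq_zsmul K, Submodule.coe_smul, hder, h _]
    simp only [← map_smul (germL K (P × E) V), ← map_sum (germL K (P × E) V),
      ← map_sub (germL K (P × E) V)]
    refine Germ.coe_eq.2 ?_
    filter_upwards [hslice, eventually_all.2 fun i => hV (a i),
      eventually_all.2 fun i => eventually_all.2 fun j => hs.eventually (Fr.lie (a i) (a j))]
      with z h1 h2 h3
    rw [h1.2, extDeriv_apply_vectorField (V := fun i y => Fr.B y (Fr.θ (a i))) h1.1 h2]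
    simp only [h3, map_sub, map_sum, Pi.sub_apply, Finset.sum_apply, Pi.smul_apply,
      Int.cast_smul_eq_zsmul K, map_zsmul]
    refine congrArg₂ _ (Finset.sum_congr rfl fun i _ => ?_)
      (Finset.sum_congr rfl fun i _ => Finset.sum_congr rfl fun k _ => ?_)
    · rfl
    · congr 3
      ext l
      refine Fin.cases rfl (fun l => rfl) l

/-- The finitely many values of `H` on tuples of basis vectors factor through a common Banach space;
they are the coefficients of `η` with respect to the coframe, which is obtained from the inverse
`Fr.C` of the frame. -/
theorem exists_represents [CharZero K] {q : ℕ}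
    (H : L [⋀^Fin q]→ₗ[K] eqGerm (A.prod (LocAct.triv K Γ E)) r) :
    ∃ (W : Type v) (_ : NormedAddCommGroup W) (_ : NormedSpace K W) (_ : CompleteSpace W)
      (_ : IsUltrametricDist W) (j : W →L[K] V) (η : P × E → E [⋀^Fin q]→L[K] W),
      Function.Injective j ∧ AnalyticAt K η 0 ∧ Fr.Represents H j η := by
  let b := finBasis K E
  let bL := b.map Fr.θ.symm
  have h0 : ∀ m : Fin q → Fin (finrank K E), ∃ F : P × E → V, LA K F 0 ∧
      (H fun i => bL (m i)).1 = germL K (P × E) V F := fun m => by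
    obtain ⟨F, h, h', e⟩ := eqGerm.exists_rep (H fun i => bL (m i))
    exact ⟨F, h, congrArg Subtype.val e⟩
  choose F hF e using h0
  obtain ⟨W, i1, i2, i3, i4, j, h, hj, H'⟩ := LA.exists_common hF
  refine ⟨W, i1, i2, i3, i4, j, fun z => (q.factorial : K)⁻¹ • ∑ m : Fin q → _,
    smulRightCLM ((altForm b m).compContinuousLinearMap (Fr.C z.2)) (h m z), hj, ?_, ?_⟩
  · refine analyticAt_form_of_apply b fun m' => ?_
    have : ∀ z : P × E, ((q.factorial : K)⁻¹ • ∑ m : Fin q → _,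
        smulRightCLM ((altForm b m).compContinuousLinearMap (Fr.C z.2)) (h m z)) (fun i => b (m' i))
        = (q.factorial : K)⁻¹ • ∑ m : Fin q → _,
          altForm b m (fun i => Fr.C z.2 (b (m' i))) • h m z := fun z => by
      rw [ContinuousAlternatingMap.smul_apply, ContinuousAlternatingMap.sum_apply]
      rfl
    simp only [this]
    refine AnalyticAt.fun_const_smul (Finset.analyticAt_fun_sum _ fun m _ => ?_)
    refine (analyticAt_altForm_apply b m fun i => ?_).smul (H' m).1
    exact AnalyticAt.comp (f := fun z : P × E => z.2) (g := fun y => Fr.C y (b (m' i))) (x := 0)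
      (clm_comp_analyticAt (ContinuousLinearMap.apply K E (b (m' i))) Fr.analyticAt_C)
      analyticAt_snd
  · intro a
    have h1 := factorial_smul_alternatingMap bL H a
    rw [← eq_inv_smul_iff₀ (by exact_mod_cast q.factorial_ne_zero)] at h1
    rw [h1]
    simp only [Submodule.coe_smul, AddSubmonoidClass.coe_finsetSum, e]
    simp only [← map_smul (germL K (P × E) V), ← map_sum (germL K (P × E) V)]
    refine Germ.coe_eq.2 ?_
    have hs : Tendsto (fun z : P × E => z.2) (𝓝 0) (𝓝 0) := continuous_snd.tendsto' _ _ rfl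
    filter_upwards [hs.eventually Fr.eventually_inverse, eventually_all.2 fun m => (H' m).2]
      with z h2 h3
    rw [ContinuousAlternatingMap.smul_apply, ContinuousAlternatingMap.sum_apply]
    simp only [Pi.smul_apply, Finset.sum_apply, map_smul, map_sum, smulRightCLM_apply, h3,
      ContinuousAlternatingMap.compContinuousLinearMap_apply, altForm_apply]
    refine congrArg _ (Finset.sum_congr rfl fun m _ => ?_)
    congr 3
    ext i k
    simp [bL, h2.2]

/-- To check an identity between forms it suffices to check it on a basis. -/
theorem form_ext [CharZero K] {q : ℕ} {X : Type*} [AddCommGroup X] [Module K X] {ι : Type*}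
    [Fintype ι] (b : Basis ι K E)
    {W' : Type*} [NormedAddCommGroup W'] [NormedSpace K W']
    (f : E [⋀^Fin q]→L[K] W) (f' : E [⋀^Fin q]→L[K] W') (J : W →ₗ[K] X) (J' : W' →ₗ[K] X)
    (h : ∀ m : Fin q → ι, J (f fun i => b (m i)) = J' (f' fun i => b (m i))) (v : Fin q → E) :
    J (f v) = J' (f' v) := by
  rw [form_apply_eq_sum b f, form_apply_eq_sum b f']
  simp only [map_smul, map_sum, h]

variable {Fr}

/-- On frame vectors this is the equivariance of the germs. The group does not move `y`, so the same
invertible frame `Fr.B y` occurs on both sides and all vectors are reached. -/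
theorem Represents.isEq [CharZero K] {q : ℕ}
    {H : L [⋀^Fin q]→ₗ[K] eqGerm (A.prod (LocAct.triv K Γ E)) r}
    {j : W →L[K] V} {η : P × E → E [⋀^Fin q]→L[K] W} (h : Fr.Represents H j η) :
    ∀ᶠ z : Γ × (P × E) in 𝓝 0, ∀ v, j (η (A.act z.1 z.2.1, z.2.2) v) = r z.1 (j (η z.2 v)) := by
  let b := finBasis K E
  have hs : Tendsto (fun z : Γ × P × E => z.2.2) (𝓝 0) (𝓝 0) :=
    Continuous.tendsto' (by fun_prop) _ _ rfl
  filter_upwards [hs.eventually Fr.eventually_inverse,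
    eventually_all.2 fun m : Fin q → Fin (finrank K E) =>
      isEq_of_coe (H fun i => Fr.θ.symm (b (m i))) (h _)] with z h1 h2 v
  have h2' : ∀ m : Fin q → Fin (finrank K E),
      j (η (A.act z.1 z.2.1, z.2.2) fun i => Fr.B z.2.2 (Fr.θ (Fr.θ.symm (b (m i))))) =
        r z.1 (j (η z.2 fun i => Fr.B z.2.2 (Fr.θ (Fr.θ.symm (b (m i)))))) := h2
  have h3 := form_ext b ((η (A.act z.1 z.2.1, z.2.2)).compContinuousLinearMap (Fr.B z.2.2))
    ((η z.2).compContinuousLinearMap (Fr.B z.2.2)) j.toLinearMap ((r z.1).comp j).toLinearMap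
    (fun m => by simpa [Function.comp_def] using h2' m) (fun i => Fr.C z.2.2 (v i))
  simpa [Function.comp_def, h1.1] using h3

theorem Represents.eventually_eq_zero [CharZero K] {q : ℕ}
    {j : W →L[K] V} (hj : Function.Injective j) {η : P × E → E [⋀^Fin q]→L[K] W}
    (h : Fr.Represents (0 : L [⋀^Fin q]→ₗ[K] eqGerm (A.prod (LocAct.triv K Γ E)) r) j η) :
    ∀ᶠ z in 𝓝 0, η z = 0 := by
  let b := finBasis K E
  have hs : Tendsto (fun z : P × E => z.2) (𝓝 0) (𝓝 0) := continuous_snd.tendsto' _ _ rfl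
  filter_upwards [hs.eventually Fr.eventually_inverse,
    eventually_all.2 fun m : Fin q → Fin (finrank K E) =>
      Germ.coe_eq.1 (h fun i => Fr.θ.symm (b (m i)))] with z h1 h2
  ext v
  refine hj ?_
  have h3 := form_ext b ((η z).compContinuousLinearMap (Fr.B z.2))
    ((η z).compContinuousLinearMap (Fr.B z.2)) j.toLinearMap 0
    (fun m => by simpa [Function.comp_def] using (h2 m).symm) (fun i => Fr.C z.2 (v i))
  simpa [Function.comp_def, h1.1] using h3

theorem Represents.congr {q : ℕ} {H : L [⋀^Fin q]→ₗ[K] eqGerm (A.prod (LocAct.triv K Γ E)) r}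
    {H' : L [⋀^Fin q]→ₗ[K] eqGerm (A.prod (LocAct.triv K Γ E)) r}
    {j : W →L[K] V} {η η' : P × E → E [⋀^Fin q]→L[K] W} (h : Fr.Represents H j η)
    (h' : Fr.Represents H' j η') (e : ∀ᶠ z in 𝓝 0, η z = η' z) : H = H' := by
  ext a
  rw [h a, h' a]
  refine Germ.coe_eq.2 ?_
  filter_upwards [e] with z hz
  rw [hz]

/-- The way back from forms to germ-valued cochains: evaluate on the frame; multilinearity and
alternation hold pointwise. -/
theorem exists_of_form [CharZero K] [CompleteSpace W] [IsUltrametricDist W] {q : ℕ} {j : W →L[K] V}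
    {η : P × E → E [⋀^Fin q]→L[K] W} (hη : AnalyticAt K η 0)
    (h : ∀ᶠ z : Γ × (P × E) in 𝓝 0, ∀ v,
      j (η (A.act z.1 z.2.1, z.2.2) v) = r z.1 (j (η z.2 v))) :
    ∃ H : L [⋀^Fin q]→ₗ[K] eqGerm (A.prod (LocAct.triv K Γ E)) r, Fr.Represents H j η := by
  let M : P × E → L [⋀^Fin q]→ₗ[K] V := fun z =>
    (j.toLinearMap.compAlternatingMap (η z).toAlternatingMap).compLinearMap
      ((Fr.B z.2).toLinearMap ∘ₗ Fr.θ.toLinearMap)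
  have hLA : ∀ a, LA K (fun z => M z a) 0 := fun a => ⟨W, _, _, ‹_›, ‹_›, j, _,
    analyticAt_form_apply hη fun i => Fr.analyticAt_snd_apply (Fr.θ (a i)), .of_forall fun _ => rfl⟩
  have hE : ∀ a, IsEq (A.prod (LocAct.triv K Γ E)) r (fun z => M z a) := fun a => by
    filter_upwards [h] with z hz
    exact hz _
  refine ⟨{ toFun := fun a => eqGerm.mk (fun z => M z a) (hLA a) (hE a), map_update_add' := ?_,
            map_update_smul' := ?_, map_eq_zero_of_eq' := ?_ }, fun a => rfl⟩
  · intro _ a i x y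
    refine Subtype.ext (Germ.coe_eq.2 (.of_forall fun z => ?_))
    have := (M z).map_update_add a i x y
    exact this
  · intro _ a i c x
    refine Subtype.ext (Germ.coe_eq.2 (.of_forall fun z => ?_))
    have := (M z).map_update_smul a i c x
    exact this
  · intro a i k e hik
    refine Subtype.ext (Germ.coe_eq.2 (.of_forall fun z => ?_))
    exact (M z).map_eq_zero_of_eq a e hik

/-- For fixed `γ` and `x`, both `t (γ x, y)` and `t (x, y)` solve Euler equations in `y` whose
right-hand sides correspond under `r γ`; uniqueness forces the solutions to correspond. The common
radius `R` is chosen before `γ` and `x`, so the result holds on a neighbourhood. -/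
theorem eventually_isEq_of_euler [CharZero K] [IsUltrametricDist K] [CompleteSpace W]
    {j : W →L[K] V} {t s : P × E → W} (ht : AnalyticAt K t 0) {k : ℕ} (hk : k ≠ 0)
    (he : ∀ᶠ z in 𝓝 (0 : P × E), fderiv K t z (0, z.2) + (k : K) • t z = s z)
    (hs : ∀ᶠ z : Γ × (P × E) in 𝓝 0, j (s (A.act z.1 z.2.1, z.2.2)) = r z.1 (j (s z.2))) :
    ∀ᶠ z : Γ × (P × E) in 𝓝 0, j (t (A.act z.1 z.2.1, z.2.2)) = r z.1 (j (t z.2)) := by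
  obtain ⟨R₁, hR₁, h₁⟩ := exists_slice_hasFPowerSeriesOnBall ht
  obtain ⟨R₂, hR₂, h₂⟩ := exists_eball_of_eventually (he.and
    (ht.eventually_analyticAt.mono fun z hz => hz.differentiableAt))
  obtain ⟨R₃, hR₃, h₃⟩ := exists_eball_of_eventually hs
  let R := min R₁ (min R₂ R₃)
  have hR : 0 < R := by simp [R, hR₁, hR₂, hR₃]
  have hR2 : R ≤ R₂ := (min_le_right _ _).trans (min_le_left _ _)
  have hR3 : R ≤ R₃ := (min_le_right _ _).trans (min_le_right _ _)
  have t1 : Tendsto (fun z : Γ × P × E => z.1) (𝓝 0) (𝓝 0) :=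
    Continuous.tendsto' (by fun_prop) _ _ rfl
  have t2 : Tendsto (fun z : Γ × P × E => z.2.1) (𝓝 0) (𝓝 0) :=
    Continuous.tendsto' (by fun_prop) _ _ rfl
  have t3 : Tendsto (fun z : Γ × P × E => z.2.2) (𝓝 0) (𝓝 0) :=
    Continuous.tendsto' (by fun_prop) _ _ rfl
  have t4 : Tendsto (fun z : Γ × P × E => A.act z.1 z.2.1) (𝓝 0) (𝓝 0) :=
    A.tendsto.comp (t1.prodMk_nhds t2)
  filter_upwards [t1.eventually (Metric.eball_mem_nhds _ hR),
    t2.eventually (Metric.eball_mem_nhds _ hR), t3.eventually (Metric.eball_mem_nhds _ hR),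
    t4.eventually (Metric.eball_mem_nhds _ hR)] with z k1 k2 k3 k4
  obtain ⟨γ, x, y₀⟩ := z
  simp only at k1 k2 k3 k4 ⊢
  obtain ⟨p, hp⟩ := h₁ R (min_le_left _ _) hR _ k4
  obtain ⟨p', hp'⟩ := h₁ R (min_le_left _ _) hR _ k2
  -- The operator `r γ` need not map `W` to itself. The relation between the two values is
  -- membership in the closed kernel `S` of `J`, hence vanishing in the Banach space `(W × W) ⧸ S`,
  -- where power series are available.
  let J : W × W →L[K] V := j.coprod (-((r γ).comp j))
  let S : Submodule K (W × W) := LinearMap.ker (J : W × W →ₗ[K] V)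
  have hS : IsClosed (S : Set (W × W)) := ContinuousLinearMap.isClosed_ker J
  have hu : HasFPowerSeriesOnBall (fun y => S.mkQL (t (A.act γ x, y), t (x, y))) _ 0 R :=
    S.mkQL.comp_hasFPowerSeriesOnBall (by simpa using hp.prod hp')
  have hJ : ∀ w, S.mkQL w = 0 ↔ J w = 0 := fun w => by
    change S.mkQ w = 0 ↔ _
    rw [Submodule.mkQ_apply, Submodule.Quotient.mk_eq_zero]
    rfl
  have hz : S.mkQL (t (A.act γ x, y₀), t (x, y₀)) = 0 := by
    refine eq_zero_of_euler hu hk (fun y hy => ?_) k3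
    obtain ⟨e1, d1⟩ := h₂ _ (Metric.eball_subset_eball hR2 k4) y (Metric.eball_subset_eball hR2 hy)
    obtain ⟨e2, d2⟩ := h₂ _ (Metric.eball_subset_eball hR2 k2) y (Metric.eball_subset_eball hR2 hy)
    have f1 := (differentiableAt_slice d1).hasFDerivAt
    have f2 := (differentiableAt_slice d2).hasFDerivAt
    have f3 : HasFDerivAt (fun y => S.mkQL (t (A.act γ x, y), t (x, y))) _ y :=
      S.mkQL.hasFDerivAt.comp y (f1.prodMk f2)
    rw [f3.fderiv]
    have f4 : ((S.mkQL.comp ((fderiv K (fun y => t (A.act γ x, y)) y).prod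
        (fderiv K (fun y => t (x, y)) y))) y) + (k : K) • S.mkQL (t (A.act γ x, y), t (x, y)) =
        S.mkQL (s (A.act γ x, y), s (x, y)) := by
      rw [← e1, ← e2, fderiv_slice (z := (A.act γ x, y)) d1, fderiv_slice (z := (x, y)) d2,
        ← map_smul]
      rw [ContinuousLinearMap.comp_apply, ← map_add]
      rfl
    refine f4.trans ((hJ _).2 ?_)
    have := h₃ γ (Metric.eball_subset_eball hR3 k1) (x, y) (by
      have hy' := Metric.eball_subset_eball hR3 hy
      have hx' := Metric.eball_subset_eball hR3 k2
      rw [Metric.mem_eball] at hx' hy' ⊢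
      rw [Prod.edist_eq]
      exact max_lt hx' hy')
    simp only [J, ContinuousLinearMap.coprod_apply, neg_apply, ContinuousLinearMap.comp_apply]
    rw [this, add_neg_cancel]
  have := (hJ _).1 hz
  simp only [J, ContinuousLinearMap.coprod_apply, neg_apply, ContinuousLinearMap.comp_apply] at this
  rwa [add_neg_eq_zero] at this

variable (Fr)

/-- Transported from `d ∘ d = 0` for differential forms by means of a representing form. -/
theorem ceDiff_ceDiff [CharZero K] {q : ℕ}
    (H : L [⋀^Fin q]→ₗ[K] eqGerm (A.prod (LocAct.triv K Γ E)) r) :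
    ceDiff (Fr.der A r) (q + 1) (ceDiff (Fr.der A r) q H) = 0 := by
  obtain ⟨W, _, _, _, _, j, η, hj, hη, h⟩ := Fr.exists_represents H
  have h1 := (h.ceDiff hη).ceDiff (analyticAt_extDerivSnd hη)
  refine h1.congr (η' := fun _ => 0) (fun a => ?_) ?_
  · change 0 = _
    rw [← map_zero (germL K (P × E) V)]
    congr 1
    ext z
    simp
  · filter_upwards [hη.eventually_analyticAt] with z hz
    exact extDerivSnd_extDerivSnd hz

/-- The Poincaré lemma for a representing form, where equivariance of `τ` is checked on each tuple
of basis vectors by uniqueness for the Euler equation. -/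
theorem exact [CharZero K] [IsUltrametricDist K] {q : ℕ}
    (H : L [⋀^Fin (q + 1)]→ₗ[K] eqGerm (A.prod (LocAct.triv K Γ E)) r)
    (hH : ceDiff (Fr.der A r) (q + 1) H = 0) : ∃ H', ceDiff (Fr.der A r) q H' = H := by
  obtain ⟨W, _, _, _, _, j, η, hj, hη, h⟩ := Fr.exists_represents H
  have h1 := h.ceDiff hη
  rw [hH] at h1
  obtain ⟨τ, hτ, he, hp⟩ := exists_primitive hη (h1.eventually_eq_zero hj)
  let b := finBasis K E
  have hτE : ∀ᶠ z : Γ × (P × E) in 𝓝 0, ∀ v,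
      j (τ (A.act z.1 z.2.1, z.2.2) v) = r z.1 (j (τ z.2 v)) := by
    have : ∀ m : Fin (q + 1) → Fin (finrank K E), ∀ᶠ z : Γ × (P × E) in 𝓝 0,
        j (τ (A.act z.1 z.2.1, z.2.2) fun i => b (m i)) = r z.1 (j (τ z.2 fun i => b (m i))) := by
      intro m
      refine eventually_isEq_of_euler (t := fun z => τ z fun i => b (m i))
        (s := fun z => η z fun i => b (m i)) (analyticAt_apply_form hτ _) (Nat.succ_ne_zero q) ?_
        (h.isEq.mono fun z hz => hz _)
      filter_upwards [he, hτ.eventually_analyticAt] with z h1 h2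
      rw [← h1, ContinuousAlternatingMap.add_apply, ContinuousAlternatingMap.smul_apply]
      congr 1
      have h3 : HasFDerivAt (fun z => τ z fun i => b (m i)) _ z :=
        (ContinuousAlternatingMap.apply K E W fun i => b (m i)).hasFDerivAt.comp z
          h2.differentiableAt.hasFDerivAt
      rw [h3.fderiv]
      rfl
    filter_upwards [eventually_all.2 this] with z hz v
    exact form_ext b (τ (A.act z.1 z.2.1, z.2.2)) (τ z.2) j.toLinearMap
      ((r z.1).comp j).toLinearMap hz v
  -- The Euler field `y` is fixed by the group, so contracting with it preserves equivariance.
  obtain ⟨H', hH'⟩ := Fr.exists_of_form (A := A) (r := r) (analyticAt_curryLeft_apply hτ)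
    (hτE.mono fun z hz v => hz (Matrix.vecCons z.2.2 v))
  exact ⟨H', (hH'.ceDiff (analyticAt_curryLeft_apply hτ)).congr h hp⟩

/-- The frame fields span the directions of `E`; in particular the radial derivative vanishes, and
the Euler equation of weight `0` has only solutions constant in `y`. -/
theorem eventually_eq_of_der_eq_zero [CharZero K] [IsUltrametricDist K] {F : P × E → V}
    (h : LA K F 0) (h' : IsEq (A.prod (LocAct.triv K Γ E)) r F)
    (hd : ∀ a, Fr.der A r a (eqGerm.mk F h h') = 0) : ∀ᶠ z in 𝓝 0, F z = F (z.1, 0) := by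
  obtain ⟨W, _, _, _, _, j, k, hj, hk, e⟩ := h.exists_inj
  let b := finBasis K E
  have hs : Tendsto (fun z : P × E => z.2) (𝓝 0) (𝓝 0) := continuous_snd.tendsto' _ _ rfl
  have hs1 : Tendsto (fun z : P × E => (z.1, (0 : E))) (𝓝 0) (𝓝 0) :=
    Continuous.tendsto' (by fun_prop) _ _ rfl
  have h1 : ∀ᶠ z in 𝓝 (0 : P × E), fderiv K k z (0, z.2) = 0 := by
    have h2 : ∀ i, ∀ᶠ z in 𝓝 (0 : P × E), fderiv K F z (0, Fr.B z.2 (b i)) = 0 := fun i => by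
      have := congrArg Subtype.val (hd (Fr.θ.symm (b i)))
      have := Germ.coe_eq.1 this
      filter_upwards [this] with z hz
      have e : (Fr.field A (Fr.θ.symm (b i))).ξ z = (0, Fr.B z.2 (b i)) := by simp [field]
      rw [← e]
      exact hz
    filter_upwards [eventually_all.2 h2, eventually_fderiv_clm_comp j hk e,
      hs.eventually Fr.eventually_inverse] with z h3 h4 h5
    have h6 : (fderiv K k z).toLinearMap ∘ₗ LinearMap.inr K P E ∘ₗ (Fr.B z.2).toLinearMap = 0 := by
      refine b.ext fun i => hj ?_
      have := h3 i
      rw [h4] at this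
      simpa using this
    have h7 := LinearMap.congr_fun h6 (Fr.C z.2 z.2)
    simpa [h5.1] using h7
  filter_upwards [eventually_eq_of_fderiv_eq_zero hk h1, e, hs1.eventually e] with z h2 h3 h4
  rw [h3, h4, h2]

end Frame

end Frame

end LocAn

end
noncomputable section
namespace LocAn

/-! ### Local groups and the van Est double complex -/

section LocRep

open Filter Module

set_option linter.unusedSectionVars false

/-- A germ of an analytic group, given by a multiplication near `0` in `E`, together with a germ of
a locally analytic representation on `V`, and its Lie algebra `L` with the operation on `V`. -/
structure LocRep (K : Type w) (E : Type*) (V : Type v) (L : Type*) [NontriviallyNormedField K]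
    [NormedAddCommGroup E] [NormedSpace K E] [LieRing L] [LieAlgebra K L] [AddCommGroup V]
    [Module K V] [TopologicalSpace V] where
  mul : E → E → E
  inv : E → E
  mul_an : AnalyticAt K (fun z : E × E => mul z.1 z.2) 0
  inv_an : AnalyticAt K inv 0
  inv_zero : inv 0 = 0
  mul_zero : ∀ᶠ x in 𝓝 (0 : E), mul x 0 = x
  zero_mul : ∀ᶠ x in 𝓝 (0 : E), mul 0 x = x
  mul_assoc : ∀ᶠ z in 𝓝 (0 : E × E × E),
    mul (mul z.1 z.2.1) z.2.2 = mul z.1 (mul z.2.1 z.2.2)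
  mul_inv : ∀ᶠ x in 𝓝 (0 : E), mul x (inv x) = 0
  inv_mul : ∀ᶠ x in 𝓝 (0 : E), mul (inv x) x = 0
  r : E → V →L[K] V
  r_zero : ∀ v, r 0 v = v
  r_mul : ∀ᶠ z in 𝓝 (0 : E × E), ∀ v, r (mul z.1 z.2) v = r z.1 (r z.2 v)
  r_LA : ∀ v, LA K (fun x => r x v) 0
  θ : L ≃ₗ[K] E
  lie : ∀ a b, ∀ᶠ y in 𝓝 (0 : E), VectorField.lieBracket K (fun y => fderiv K (mul y) 0 (θ a))
    (fun y => fderiv K (mul y) 0 (θ b)) y = fderiv K (mul y) 0 (θ ⁅a, b⁆)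
  act : L →ₗ[K] V →ₗ[K] V
  act_eq : ∀ a v, act a v = fderiv K (fun x => r x v) 0 (θ a)

namespace LocRep

variable {K : Type w} [NontriviallyNormedField K] [CompleteSpace K]
  {E : Type*} [NormedAddCommGroup E] [NormedSpace K E] [FiniteDimensional K E] [CompleteSpace E]
  {L : Type*} [LieRing L] [LieAlgebra K L]
  {V : Type v} [AddCommGroup V] [Module K V] [TopologicalSpace V] [IsTopologicalAddGroup V]
  [T2Space V] [ContinuousSMul K V]
  (R : LocRep K E V L)

/-- The action by multiplication from the left. -/
def mulAct : LocAct K E E where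
  act := R.mul
  analyticAt := R.mul_an
  act_zero := R.mul_zero.self_of_nhds

theorem mul_tendsto : Tendsto (fun z : E × E => R.mul z.1 z.2) (𝓝 0) (𝓝 0) := R.mulAct.tendsto

theorem inv_tendsto : Tendsto R.inv (𝓝 0) (𝓝 0) := by
  have := R.inv_an.continuousAt
  rwa [ContinuousAt, R.inv_zero] at this

theorem inv_mul_cancel_left : ∀ᶠ z in 𝓝 (0 : E × E), R.mul (R.inv z.1) (R.mul z.1 z.2) = z.2 := by
  have t1 : Tendsto (fun z : E × E => z.1) (𝓝 0) (𝓝 0) := Continuous.tendsto' (by fun_prop) _ _ rfl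
  have t2 : Tendsto (fun z : E × E => z.2) (𝓝 0) (𝓝 0) := Continuous.tendsto' (by fun_prop) _ _ rfl
  have t3 : Tendsto (fun z : E × E => (R.inv z.1, z.1, z.2)) (𝓝 0) (𝓝 0) :=
    (R.inv_tendsto.comp t1).prodMk_nhds (t1.prodMk_nhds t2)
  filter_upwards [t3.eventually R.mul_assoc, t1.eventually R.inv_mul, t2.eventually R.zero_mul]
    with z h1 h2 h3
  rw [← h1, h2, h3]

theorem mul_inv_cancel_left : ∀ᶠ z in 𝓝 (0 : E × E), R.mul z.1 (R.mul (R.inv z.1) z.2) = z.2 := by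
  have t1 : Tendsto (fun z : E × E => z.1) (𝓝 0) (𝓝 0) := Continuous.tendsto' (by fun_prop) _ _ rfl
  have t2 : Tendsto (fun z : E × E => z.2) (𝓝 0) (𝓝 0) := Continuous.tendsto' (by fun_prop) _ _ rfl
  have t3 : Tendsto (fun z : E × E => (z.1, R.inv z.1, z.2)) (𝓝 0) (𝓝 0) :=
    t1.prodMk_nhds ((R.inv_tendsto.comp t1).prodMk_nhds t2)
  filter_upwards [t3.eventually R.mul_assoc, t1.eventually R.mul_inv, t2.eventually R.zero_mul]
    with z h1 h2 h3
  rw [← h1, h2, h3]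

/-- The left invariant frame. -/
def frame : Frame K E L where
  B y := fderiv K (R.mul y) 0
  analyticAt := by
    have h1 : AnalyticAt K (fun y : E => fderiv K (fun z : E × E => R.mul z.1 z.2) (y, 0)) 0 :=
      AnalyticAt.comp (f := fun y : E => (y, (0 : E)))
        (g := fderiv K (fun z : E × E => R.mul z.1 z.2)) R.mul_an.fderiv
        (analyticAt_id.prod analyticAt_const)
    have h2 := clm_comp_analyticAt
      ((ContinuousLinearMap.compL K E (E × E) E).flip (ContinuousLinearMap.inr K E E)) h1
    refine h2.congr ?_
    have t : Tendsto (fun y : E => (y, (0 : E))) (𝓝 0) (𝓝 0) :=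
      Continuous.tendsto' (by fun_prop) _ _ rfl
    filter_upwards [t.eventually R.mul_an.eventually_analyticAt] with y hy
    exact (fderiv_slice hy.differentiableAt).symm
  isUnit := by
    have : fderiv K (R.mul 0) 0 = 1 := by
      rw [Filter.EventuallyEq.fderiv_eq (𝕜 := K) (f := fun x => x) R.zero_mul]
      exact fderiv_fun_id
    rw [this]
    exact isUnit_one
  θ := R.θ
  lie := R.lie

/-- Differentiate the associative law in the last factor at `0`. -/
theorem left_invariant : ∀ᶠ z in 𝓝 (0 : E × E), ∀ v,
    fderiv K (R.mul z.1) z.2 (R.frame.B z.2 v) = R.frame.B (R.mul z.1 z.2) v := by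
  have t1 : Tendsto (fun z : E × E => z.1) (𝓝 0) (𝓝 0) := Continuous.tendsto' (by fun_prop) _ _ rfl
  have t2 : Tendsto (fun z : E × E => z.2) (𝓝 0) (𝓝 0) := Continuous.tendsto' (by fun_prop) _ _ rfl
  have t3 : Tendsto (fun z : E × E => (z.1, z.2, (0 : E))) (𝓝 0) (𝓝 0) :=
    Continuous.tendsto' (by fun_prop) _ _ rfl
  have t4 : Tendsto (fun z : E × E => (z.2, (0 : E))) (𝓝 0) (𝓝 0) :=
    Continuous.tendsto' (by fun_prop) _ _ rfl
  filter_upwards [t3.eventually R.mul_assoc.eventually_nhds, t2.eventually R.mul_zero,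
    R.mulAct.analyticAt_slice, t4.eventually R.mulAct.analyticAt_slice] with z h1 h2 h3 h4 v
  have t5 : Tendsto (fun y : E => (z.1, z.2, y)) (𝓝 0) (𝓝 (z.1, z.2, 0)) :=
    Continuous.tendsto' (by fun_prop) _ _ rfl
  have h5 : fderiv K (R.mul (R.mul z.1 z.2)) 0 = fderiv K (R.mul z.1 ∘ R.mul z.2) 0 :=
    Filter.EventuallyEq.fderiv_eq (𝕜 := K) (t5.eventually h1)
  change _ = fderiv K (R.mul (R.mul z.1 z.2)) 0 v
  rw [h5, fderiv_comp (𝕜 := K) (f := R.mul z.2) (g := R.mul z.1) 0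
    (by rw [h2]; exact h3.differentiableAt) h4.differentiableAt, h2]
  rfl

/-- The left invariant vector fields on the second factor of a product. -/
def field {P : Type*} [NormedAddCommGroup P] [NormedSpace K P] [CompleteSpace P]
    (A : LocAct K E P) (a : L) : InvField (A.prod R.mulAct) where
  ξ z := (0, R.frame.B z.2 (R.θ a))
  analyticAt := analyticAt_const.prod (R.frame.analyticAt_snd_apply _)
  inv := by
    have h1 : Tendsto (fun z : E × (P × E) => (z.1, z.2.1)) (𝓝 0) (𝓝 0) :=
      Continuous.tendsto' (by fun_prop) _ _ rfl
    have h2 : Tendsto (fun z : E × (P × E) => (z.1, z.2.2)) (𝓝 0) (𝓝 0) :=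
      Continuous.tendsto' (by fun_prop) _ _ rfl
    filter_upwards [h1.eventually A.analyticAt_slice, h2.eventually R.mulAct.analyticAt_slice,
      h2.eventually R.left_invariant] with z hz hz2 hz3
    have h3 : HasFDerivAt (fun n : P × E => (A.act z.1 n.1, R.mul z.1 n.2))
        (((fderiv K (A.act z.1) z.2.1).comp (ContinuousLinearMap.fst K P E)).prod
          ((fderiv K (R.mul z.1) z.2.2).comp (ContinuousLinearMap.snd K P E))) z.2 := by
      refine HasFDerivAt.prodMk ?_ ?_
      · exact HasFDerivAt.comp (g := A.act z.1) z.2 hz.differentiableAt.hasFDerivAt hasFDerivAt_fst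
      · exact HasFDerivAt.comp (g := R.mul z.1) z.2 hz2.differentiableAt.hasFDerivAt hasFDerivAt_snd
    change fderiv K (fun n : P × E => (A.act z.1 n.1, R.mul z.1 n.2)) z.2 (0, _) = (0, _)
    rw [h3.fderiv]
    simp only [ContinuousLinearMap.prod_apply, ContinuousLinearMap.comp_apply,
      ContinuousLinearMap.coe_fst', ContinuousLinearMap.coe_snd', map_zero, hz3]
    rfl

/-- The action on `(p + 1)`-tuples. -/
abbrev powAct (p : ℕ) : LocAct K E (Fin (p + 1) → E) := R.mulAct.pi (Fin (p + 1))

/-- The germs of homogeneous cochains. -/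
abbrev Cg (p : ℕ) : Submodule K ((𝓝 (0 : Fin (p + 1) → E)).Germ V) := eqGerm (R.powAct p) R.r

/-- The germs of equivariant functions of `(x₀, …, x_p; g)`. -/
abbrev Og (p : ℕ) : Submodule K ((𝓝 (0 : (Fin (p + 1) → E) × E)).Germ V) :=
  eqGerm ((R.powAct p).prod R.mulAct) R.r

/-- The operation of the Lie algebra on germs. -/
def der (p : ℕ) : L →ₗ[K] R.Og p →ₗ[K] R.Og p :=
  InvField.derL (R.field (R.powAct p)) (fun a b z => by simp [field])
    (fun c a z => by simp [field])

/-! #### Faces and the contraction -/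

variable (K E) in
/-- Omitting a component, as a continuous linear map. -/
def removeNthL {p : ℕ} (i : Fin (p + 2)) : (Fin (p + 2) → E) →L[K] (Fin (p + 1) → E) :=
  ContinuousLinearMap.pi fun k => ContinuousLinearMap.proj (i.succAbove k)

def faceC (p : ℕ) (i : Fin (p + 2)) : R.Cg p →ₗ[K] R.Cg (p + 1) :=
  (EqMap.ofCLM (A := R.powAct p) (A' := R.powAct (p + 1)) R.r (removeNthL K E i)
    fun _ _ => rfl).pullback

def faceO (p : ℕ) (i : Fin (p + 2)) : R.Og p →ₗ[K] R.Og (p + 1) :=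
  (EqMap.ofCLM (A := (R.powAct p).prod R.mulAct) (A' := (R.powAct (p + 1)).prod R.mulAct) R.r
    (((removeNthL K E i).comp (ContinuousLinearMap.fst K _ _)).prod
      (ContinuousLinearMap.snd K _ _)) fun _ _ => rfl).pullback

/-- The differential of the complex of germs of homogeneous cochains. -/
def diffC (p : ℕ) : R.Cg p →ₗ[K] R.Cg (p + 1) := ∑ i : Fin (p + 2), (-1 : K) ^ (i : ℕ) • R.faceC p i

def diffO (p : ℕ) : R.Og p →ₗ[K] R.Og (p + 1) := ∑ i : Fin (p + 2), (-1 : K) ^ (i : ℕ) • R.faceO p i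

theorem diffC_coe {p : ℕ} {φ : R.Cg p} {F : (Fin (p + 1) → E) → V} (h : φ.1 = germL K _ V F) :
    (R.diffC p φ).1 = germL K _ V fun x =>
      ∑ i : Fin (p + 2), (-1 : K) ^ (i : ℕ) • F (i.removeNth x) := by
  have h1 : ∀ i, (R.faceC p i φ).1 = germL K _ V fun x => F (i.removeNth x) := fun i =>
    EqMap.pullback_coe _ h
  simp only [diffC, LinearMap.sum_apply, LinearMap.smul_apply, AddSubmonoidClass.coe_finsetSum,
    Submodule.coe_smul, h1]
  simp only [← map_smul (germL K _ V), ← map_sum (germL K _ V)]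
  congr 1
  ext x
  simp

theorem diffO_coe {p : ℕ} {φ : R.Og p} {F : (Fin (p + 1) → E) × E → V} (h : φ.1 = germL K _ V F) :
    (R.diffO p φ).1 =
      germL K _ V fun z => ∑ i : Fin (p + 2), (-1 : K) ^ (i : ℕ) • F (i.removeNth z.1, z.2) := by
  have h1 : ∀ i, (R.faceO p i φ).1 = germL K _ V fun z => F (i.removeNth z.1, z.2) := fun i =>
    EqMap.pullback_coe _ h
  simp only [diffO, LinearMap.sum_apply, LinearMap.smul_apply, AddSubmonoidClass.coe_finsetSum,
    Submodule.coe_smul, h1]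
  simp only [← map_smul (germL K _ V), ← map_sum (germL K _ V)]
  congr 1
  ext x
  simp

theorem sum_removeNth_removeNth {K V α : Type*} [Field K] [AddCommGroup V] [Module K V] {n : ℕ}
    (F : (Fin n → α) → V) (x : Fin (n + 2) → α) :
    ∑ i : Fin (n + 2), (-1 : K) ^ (i : ℕ) • ∑ j : Fin (n + 1), (-1 : K) ^ (j : ℕ) •
      F (j.removeNth (i.removeNth x)) = 0 := by
  simp only [Finset.smul_sum]
  rw [Fin.sum_sum_eq_sum_triangle_add]
  refine Finset.sum_eq_zero fun i _ => Finset.sum_eq_zero fun j hj => ?_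
  rw [Finset.mem_Ici] at hj
  rw [Fin.removeNth_removeNth_eq_swap]
  have H₁ : i.castSucc.succAbove j = j.succ := by simp [Fin.succAbove_of_le_castSucc, hj]
  have H₂ : j.predAbove i.castSucc = i := by simp [Fin.predAbove_of_le_castSucc, hj]
  rw [H₁, H₂]
  simp only [Fin.val_castSucc, Fin.val_succ, pow_succ, smul_smul]
  rw [← add_smul]
  have : (-1 : K) ^ (i : ℕ) * (-1) ^ (j : ℕ) + (-1) ^ (j : ℕ) * -1 * (-1) ^ (i : ℕ) = 0 := by ring
  rw [this, zero_smul]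

theorem diffO_diffO {p : ℕ} (φ : R.Og p) : R.diffO (p + 1) (R.diffO p φ) = 0 := by
  obtain ⟨F, -, -, h⟩ := eqGerm.exists_germL φ
  refine Subtype.ext ?_
  rw [R.diffO_coe (R.diffO_coe h)]
  refine Germ.coe_eq.2 (.of_forall fun z => ?_)
  exact sum_removeNth_removeNth (fun x => F (x, z.2)) z.1

variable (K E) in
/-- The map `(x, g) ↦ (g, x)` as a continuous linear map. -/
def consL (p : ℕ) : (Fin (p + 1) → E) × E →L[K] (Fin (p + 2) → E) :=
  ContinuousLinearMap.pi fun k => Fin.cases (ContinuousLinearMap.snd K (Fin (p + 1) → E) E)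
    (fun k => (ContinuousLinearMap.proj k).comp (ContinuousLinearMap.fst K (Fin (p + 1) → E) E)) k

theorem consL_apply {p : ℕ} (z : (Fin (p + 1) → E) × E) : consL K E p z = Fin.cons z.2 z.1 := by
  funext k
  refine Fin.cases rfl (fun k => rfl) k

/-- The contraction `(s F)(x; g) = F(g, x; g)`. -/
def contr (p : ℕ) : R.Og (p + 1) →ₗ[K] R.Og p :=
  (EqMap.ofCLM (A := (R.powAct (p + 1)).prod R.mulAct) (A' := (R.powAct p).prod R.mulAct) R.r
    ((consL K E p).prod (ContinuousLinearMap.snd K (Fin (p + 1) → E) E)) fun γ n => by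
      refine Prod.ext (funext fun k => ?_) rfl
      refine Fin.cases rfl (fun k => rfl) k).pullback

theorem contr_coe {p : ℕ} {φ : R.Og (p + 1)} {F : (Fin (p + 2) → E) × E → V}
    (h : φ.1 = germL K _ V F) :
    (R.contr p φ).1 = germL K _ V fun z => F (Fin.cons z.2 z.1, z.2) := by
  refine (EqMap.pullback_coe _ h).trans ?_
  congr 1
  ext z
  change F (consL K E p z, z.2) = _
  rw [consL_apply]

/-- The contraction `s` satisfies `d s + s d = 1`: in `s d F` the face that omits the inserted `g`
returns `F`, and the other faces are those of `d s F` with opposite sign. -/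
theorem diffO_contr {p : ℕ} (φ : R.Og (p + 1)) (hφ : R.diffO (p + 1) φ = 0) :
    R.diffO p (R.contr p φ) = φ := by
  obtain ⟨F, -, -, h⟩ := eqGerm.exists_germL φ
  have h1 := R.contr_coe (R.diffO_coe h)
  rw [hφ, map_zero] at h1
  refine Subtype.ext ?_
  rw [R.diffO_coe (R.contr_coe h), h, ← sub_eq_zero, ← neg_eq_zero]
  change (0 : (𝓝 (0 : (Fin (p + 1 + 1) → E) × E)).Germ V) = _ at h1
  rw [h1, ← map_sub, ← map_neg]
  congr 1
  ext z
  rw [Fin.sum_univ_succ]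
  simp only [Pi.neg_apply, Pi.sub_apply, Fin.val_zero, pow_zero, one_smul, Fin.val_succ, pow_succ,
    mul_neg, mul_one, neg_smul, Finset.sum_neg_distrib, neg_sub]
  rw [sub_eq_add_neg]
  congr 2
  refine Finset.sum_congr rfl fun i _ => ?_
  congr 3
  funext k
  refine Fin.cases ?_ (fun k => ?_) k
  · simp [Fin.removeNth]
  · simp [Fin.removeNth]

/-- The value at `0`. -/
def evalO : R.Og 0 →ₗ[K] V where
  toFun φ := Germ.value φ.1
  map_add' φ φ' := by
    obtain ⟨F, h, h', rfl⟩ := eqGerm.exists_rep φ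
    obtain ⟨F', k, k', rfl⟩ := eqGerm.exists_rep φ'
    rfl
  map_smul' c φ := by
    obtain ⟨F, h, h', rfl⟩ := eqGerm.exists_rep φ
    rfl

/-- `v ↦ ((x₀; g) ↦ g v)`. -/
def orbit : V →ₗ[K] R.Og 0 where
  toFun v := eqGerm.mk (fun z => R.r z.2 v)
    (LA.comp (ψ := fun z : (Fin 1 → E) × E => z.2) (x := 0) (R.r_LA v) analyticAt_snd) (by
      have t : Tendsto (fun z : E × ((Fin 1 → E) × E) => (z.1, z.2.2)) (𝓝 0) (𝓝 0) :=
        Continuous.tendsto' (by fun_prop) _ _ rfl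
      filter_upwards [t.eventually R.r_mul] with z hz
      exact hz v)
  map_add' v v' := Subtype.ext (Germ.coe_eq.2 (.of_forall fun z => map_add (R.r z.2) v v'))
  map_smul' c v := Subtype.ext (Germ.coe_eq.2 (.of_forall fun z => map_smul (R.r z.2) c v))

theorem evalO_orbit (v : V) : R.evalO (R.orbit v) = v := R.r_zero v

theorem diffO_orbit (v : V) : R.diffO 0 (R.orbit v) = 0 := by
  refine Subtype.ext ((R.diffO_coe (F := fun z => R.r z.2 v) rfl).trans ?_)
  refine Germ.coe_eq.2 (.of_forall fun z => ?_)
  simp [Fin.sum_univ_succ]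

/-- Closedness says that `F(x₀; g)` does not depend on `x₀`, so `F(x₀; g) = F(g; g)`, and this is `g
F(0; 0)` by equivariance. -/
theorem orbit_evalO (φ : R.Og 0) (hφ : R.diffO 0 φ = 0) : R.orbit (R.evalO φ) = φ := by
  obtain ⟨F, h1, h2, rfl⟩ := eqGerm.exists_rep φ
  refine Subtype.ext (Germ.coe_eq.2 ?_)
  change (fun z : (Fin 1 → E) × E => R.r z.2 (F 0)) =ᶠ[𝓝 0] F
  have h3 := (R.diffO_coe (φ := eqGerm.mk F h1 h2) (F := F) rfl)
  rw [hφ] at h3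
  have h4 : ∀ᶠ z : (Fin 2 → E) × E in 𝓝 0,
    0 = ∑ i : Fin 2, (-1 : K) ^ (i : ℕ) • F (i.removeNth z.1, z.2) := Germ.coe_eq.1 h3
  have t : Tendsto (fun z : (Fin 1 → E) × E => ((![z.2, z.1 0] : Fin 2 → E), z.2)) (𝓝 0) (𝓝 0) := by
    refine Continuous.tendsto' ?_ _ _ ?_
    · refine Continuous.prodMk (continuous_pi fun i => ?_) continuous_snd
      fin_cases i
      · exact continuous_snd
      · exact (continuous_apply 0).comp continuous_fst
    · refine Prod.ext (funext fun i => ?_) rfl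
      fin_cases i <;> rfl
  have t2 : Tendsto (fun z : (Fin 1 → E) × E => (z.2, (0 : (Fin 1 → E) × E))) (𝓝 0) (𝓝 0) :=
    Continuous.tendsto' (by fun_prop) _ _ rfl
  have t3 : Tendsto (fun z : (Fin 1 → E) × E => z.2) (𝓝 0) (𝓝 0) :=
    Continuous.tendsto' (by fun_prop) _ _ rfl
  filter_upwards [t.eventually h4, t2.eventually h2, t3.eventually R.mul_zero] with z e1 e2 e3
  rw [← e2]
  rw [Fin.sum_univ_two] at e1
  simp only [Fin.val_zero, pow_zero, one_smul, Fin.val_one, pow_one, neg_smul] at e1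
  rw [eq_comm, add_neg_eq_zero] at e1
  have a1 : (Fin.removeNth 0 ![z.2, z.1 0] : Fin 1 → E) = z.1 := by
    funext k; rw [Subsingleton.elim k 0]; rfl
  have a2 : ((R.powAct 0).prod R.mulAct).act z.2 (0 : (Fin 1 → E) × E) =
      (Fin.removeNth 1 ![z.2, z.1 0], z.2) := by
    refine Prod.ext (funext fun k => ?_) e3
    rw [show k = 0 from Fin.ext (by omega)]
    exact e3
  rw [a1] at e1
  rw [a2]
  exact e1.symm

/-- Differentiate `r (g y) v = r g (r y v)` at `y = 0`. -/
theorem der_orbit (a : L) (v : V) : R.der 0 a (R.orbit v) = R.orbit (R.act a v) := by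
  refine Subtype.ext ((InvField.der_coe _ (F := fun z => R.r z.2 v) rfl).trans ?_)
  refine Germ.coe_eq.2 ?_
  have t2 : Tendsto (fun z : (Fin 1 → E) × E => z.2) (𝓝 0) (𝓝 0) :=
    Continuous.tendsto' (by fun_prop) _ _ rfl
  have t3 : Tendsto (fun z : (Fin 1 → E) × E => (z.2, (0 : E))) (𝓝 0) (𝓝 0) :=
    Continuous.tendsto' (by fun_prop) _ _ rfl
  filter_upwards [t2.eventually (R.r_LA v).eventually, t2.eventually R.mul_zero,
    t3.eventually R.r_mul.eventually_nhds, t3.eventually R.mulAct.analyticAt_slice]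
    with z h1 h2 h3 h4
  rw [LA.fderiv_comp (f := fun x => R.r x v) (ψ := fun z : (Fin 1 → E) × E => z.2) h1
    differentiableAt_snd, fderiv_snd]
  change fderiv K (fun x => R.r x v) z.2 (fderiv K (R.mul z.2) 0 (R.θ a)) = _
  have t5 : Tendsto (fun y => (z.2, y)) (𝓝 0) (𝓝 (z.2, (0 : E))) :=
    Continuous.tendsto' (by fun_prop) _ _ rfl
  have h5 : fderiv K (fun y => R.r (R.mul z.2 y) v) 0 = fderiv K (fun y => R.r z.2 (R.r y v)) 0 :=
    Filter.EventuallyEq.fderiv_eq (𝕜 := K) ((t5.eventually h3).mono fun y hy => hy v)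
  rw [LA.fderiv_comp (f := fun x => R.r x v) (ψ := R.mul z.2) (by rwa [h2]) h4.differentiableAt,
    h2, ((R.r_LA v).fderiv_clm (R.r z.2)).self_of_nhds] at h5
  rw [R.act_eq]
  exact congrArg (fun l => l (R.θ a)) h5

/-- The faces do not touch the variable `g`, along which the field points. -/
theorem der_diffO {p : ℕ} (a : L) (φ : R.Og p) :
    R.diffO p (R.der p a φ) = R.der (p + 1) a (R.diffO p φ) := by
  simp only [diffO, LinearMap.sum_apply, LinearMap.smul_apply, map_sum, map_smul]
  refine Finset.sum_congr rfl fun i _ => ?_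
  congr 1
  refine InvField.pullback_der _ _ _ (.of_forall fun n => ?_) φ
  change fderiv K (⇑(((removeNthL K E i).comp (ContinuousLinearMap.fst K _ _)).prod
      (ContinuousLinearMap.snd K _ _))) n _ = _
  rw [ContinuousLinearMap.fderiv]
  refine Prod.ext ?_ rfl
  change removeNthL K E i 0 = 0
  exact map_zero _

/-! #### The inclusion of cochains -/

/-- A cochain, as a function that does not depend on `g`. -/
def incl (p : ℕ) : R.Cg p →ₗ[K] R.Og p :=
  (EqMap.ofCLM (A := R.powAct p) (A' := (R.powAct p).prod R.mulAct) R.r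
    (ContinuousLinearMap.fst K _ _) fun _ _ => rfl).pullback

/-- The restriction to `g = x₀`. -/
def diagO (p : ℕ) : R.Og p →ₗ[K] R.Cg p :=
  (EqMap.ofCLM (A := (R.powAct p).prod R.mulAct) (A' := R.powAct p) R.r
    ((ContinuousLinearMap.id K _).prod (ContinuousLinearMap.proj 0)) fun _ _ => rfl).pullback

theorem incl_coe {p : ℕ} {φ : R.Cg p} {F : (Fin (p + 1) → E) → V} (h : φ.1 = germL K _ V F) :
    (R.incl p φ).1 = germL K _ V fun z => F z.1 := EqMap.pullback_coe _ h

theorem diagO_coe {p : ℕ} {φ : R.Og p} {F : (Fin (p + 1) → E) × E → V} (h : φ.1 = germL K _ V F) :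
    (R.diagO p φ).1 = germL K _ V fun x => F (x, x 0) := EqMap.pullback_coe _ h

theorem diagO_incl {p : ℕ} (φ : R.Cg p) : R.diagO p (R.incl p φ) = φ := by
  obtain ⟨F, -, -, h⟩ := eqGerm.exists_germL φ
  refine Subtype.ext ?_
  rw [R.diagO_coe (R.incl_coe h), h]

theorem diffO_incl {p : ℕ} (φ : R.Cg p) :
    R.diffO p (R.incl p φ) = R.incl (p + 1) (R.diffC p φ) := by
  obtain ⟨F, -, -, h⟩ := eqGerm.exists_germL φ
  refine Subtype.ext ?_
  rw [R.diffO_coe (R.incl_coe h), R.incl_coe (R.diffC_coe h)]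

theorem der_incl {p : ℕ} (a : L) (φ : R.Cg p) : R.der p a (R.incl p φ) = 0 := by
  obtain ⟨F, h1, -, h⟩ := eqGerm.exists_germL φ
  refine Subtype.ext ((InvField.der_coe _ (R.incl_coe h)).trans (Germ.coe_eq.2 ?_))
  have t : Tendsto (fun z : (Fin (p + 1) → E) × E => z.1) (𝓝 0) (𝓝 0) :=
    Continuous.tendsto' (by fun_prop) _ _ rfl
  filter_upwards [t.eventually h1.eventually] with z hz
  rw [LA.fderiv_comp hz differentiableAt_fst, fderiv_fst]
  change fderiv K F z.1 0 = 0
  exact map_zero _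

/-! #### Straightening the action -/

/-- The straightening `(x, y) ↦ (x; x₀ y)`. -/
def toTriv (p : ℕ) : EqMap ((R.powAct p).prod R.mulAct) R.r
    ((R.powAct p).prod (LocAct.triv K E E)) R.r where
  f := id
  f_tendsto := tendsto_id
  ψ z := (z.1, R.mul (z.1 0) z.2)
  analyticAt := by
    refine analyticAt_fst.prod ?_
    refine AnalyticAt.comp (g := fun z : E × E => R.mul z.1 z.2)
      (f := fun z : (Fin (p + 1) → E) × E => (z.1 0, z.2)) R.mul_an ?_
    exact (((ContinuousLinearMap.proj 0).comp
      (ContinuousLinearMap.fst K (Fin (p + 1) → E) E)).analyticAt _).prod analyticAt_snd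
  map_zero := Prod.ext rfl R.mul_zero.self_of_nhds
  map_act := by
    have t : Tendsto (fun z : E × ((Fin (p + 1) → E) × E) => (z.1, z.2.1 0, z.2.2)) (𝓝 0) (𝓝 0) :=
      Continuous.tendsto' (by fun_prop) _ _ rfl
    filter_upwards [t.eventually R.mul_assoc] with z hz
    exact Prod.ext rfl hz
  T := ContinuousLinearMap.id K V
  map_rep := .of_forall fun _ _ => rfl

/-- The inverse `(x, g) ↦ (x, x₀⁻¹ g)` of the straightening. -/
def ofTriv (p : ℕ) : EqMap ((R.powAct p).prod (LocAct.triv K E E)) R.r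
    ((R.powAct p).prod R.mulAct) R.r where
  f := id
  f_tendsto := tendsto_id
  ψ z := (z.1, R.mul (R.inv (z.1 0)) z.2)
  analyticAt := by
    refine analyticAt_fst.prod ?_
    refine AnalyticAt.comp (g := fun z : E × E => R.mul z.1 z.2)
      (f := fun z : (Fin (p + 1) → E) × E => (R.inv (z.1 0), z.2))
      (by
        simp only [Prod.fst_zero, Prod.snd_zero, Pi.zero_apply, R.inv_zero]
        exact R.mul_an) ?_
    refine AnalyticAt.prod ?_ analyticAt_snd
    exact AnalyticAt.comp (g := R.inv) (f := fun z : (Fin (p + 1) → E) × E => z.1 0) R.inv_an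
      (((ContinuousLinearMap.proj 0).comp
      (ContinuousLinearMap.fst K (Fin (p + 1) → E) E)).analyticAt _)
  map_zero := by
    refine Prod.ext rfl ?_
    change R.mul (R.inv 0) 0 = 0
    rw [R.inv_zero, R.mul_zero.self_of_nhds]
  map_act := by
    have t0 : Tendsto (fun z : E × ((Fin (p + 1) → E) × E) => (z.2.1 0, z.2.2)) (𝓝 0) (𝓝 0) :=
      Continuous.tendsto' (by fun_prop) _ _ rfl
    have t2 : Tendsto (fun z : E × ((Fin (p + 1) → E) × E) => z.1) (𝓝 0) (𝓝 0) :=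
      Continuous.tendsto' (by fun_prop) _ _ rfl
    have t3 : Tendsto (fun z : E × ((Fin (p + 1) → E) × E) => z.2.1 0) (𝓝 0) (𝓝 0) :=
      Continuous.tendsto' (by fun_prop) _ _ rfl
    have t4 : Tendsto (fun z : E × ((Fin (p + 1) → E) × E) => z.2.2) (𝓝 0) (𝓝 0) :=
      Continuous.tendsto' (by fun_prop) _ _ rfl
    have t5 := R.mul_tendsto.comp (t2.prodMk_nhds t3)
    have t6 := R.mul_tendsto.comp ((R.inv_tendsto.comp t3).prodMk_nhds t4)
    filter_upwards [t0.eventually R.mul_inv_cancel_left,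
      (t2.prodMk_nhds (t3.prodMk_nhds t6)).eventually R.mul_assoc,
      (t5.prodMk_nhds t6).eventually R.inv_mul_cancel_left] with z h1 h2 h3
    refine Prod.ext rfl ?_
    change R.mul (R.inv (R.mul z.1 (z.2.1 0))) (R.mul z.1 z.2.2) = R.mul (R.inv (z.2.1 0)) z.2.2
    simp only [Function.comp_apply] at h1 h2 h3
    rw [h2, h1] at h3
    exact h3
  T := ContinuousLinearMap.id K V
  map_rep := .of_forall fun _ _ => rfl

theorem toTriv_ofTriv {p : ℕ} (φ : eqGerm ((R.powAct p).prod (LocAct.triv K E E)) R.r) :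
    (R.toTriv p).pullback ((R.ofTriv p).pullback φ) = φ := by
  obtain ⟨F, -, -, h⟩ := eqGerm.exists_germL φ
  refine Subtype.ext ((EqMap.pullback_coe _ (EqMap.pullback_coe _ h)).trans ?_)
  rw [h]
  have t : Tendsto (fun z : (Fin (p + 1) → E) × E => (z.1 0, z.2)) (𝓝 0) (𝓝 0) :=
    Continuous.tendsto' (by fun_prop) _ _ rfl
  refine Germ.coe_eq.2 ?_
  filter_upwards [t.eventually R.inv_mul_cancel_left] with z hz
  change F (z.1, R.mul (R.inv (z.1 0)) (R.mul (z.1 0) z.2)) = F z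
  rw [hz]

theorem ofTriv_toTriv {p : ℕ} (φ : R.Og p) :
    (R.ofTriv p).pullback ((R.toTriv p).pullback φ) = φ := by
  obtain ⟨F, -, -, h⟩ := eqGerm.exists_germL φ
  refine Subtype.ext ((EqMap.pullback_coe _ (EqMap.pullback_coe _ h)).trans ?_)
  rw [h]
  have t : Tendsto (fun z : (Fin (p + 1) → E) × E => (z.1 0, z.2)) (𝓝 0) (𝓝 0) :=
    Continuous.tendsto' (by fun_prop) _ _ rfl
  refine Germ.coe_eq.2 ?_
  filter_upwards [t.eventually R.mul_inv_cancel_left] with z hz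
  change F (z.1, R.mul (z.1 0) (R.mul (R.inv (z.1 0)) z.2)) = F z
  rw [hz]

/-- The straightening is, for each `x`, left translation by `x₀` in the last variable, and the
fields are left invariant. -/
theorem toTriv_der {p : ℕ} (a : L) (φ : R.Og p) :
    (R.toTriv p).pullback (R.der p a φ) =
      R.frame.der (R.powAct p) R.r a ((R.toTriv p).pullback φ) := by
  refine InvField.pullback_der _ _ _ ?_ φ
  have t : Tendsto (fun z : (Fin (p + 1) → E) × E => (z.1 0, z.2)) (𝓝 0) (𝓝 0) :=
    Continuous.tendsto' (by fun_prop) _ _ rfl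
  filter_upwards [(R.toTriv p).analyticAt.eventually_analyticAt, t.eventually R.left_invariant]
    with z h1 h2
  have h3 := congrArg (fun l => l (R.frame.B z.2 (R.θ a))) (fderiv_slice h1.differentiableAt)
  have h4 : fderiv K (fun y => (R.toTriv p).ψ (z.1, y)) z.2 (R.frame.B z.2 (R.θ a)) =
      (0, fderiv K (R.mul (z.1 0)) z.2 (R.frame.B z.2 (R.θ a))) := by
    have hd : DifferentiableAt K (R.mul (z.1 0)) z.2 :=
      (differentiableAt_slice h1.differentiableAt).snd
    change fderiv K (fun y => (z.1, R.mul (z.1 0) y)) z.2 _ = _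
    rw [((hasFDerivAt_const z.1 z.2).prodMk hd.hasFDerivAt).fderiv]
    rfl
  refine h3.symm.trans (h4.trans ?_)
  rw [h2]
  rfl

/-! #### The double complex -/

/-- The van Est double complex. -/
def double [CharZero K] [IsUltrametricDist K] :
    DoubleResolution (C := fun p => R.Cg p) (L := fun q => L [⋀^Fin q]→ₗ[K] V) R.diffC
      (ceDiff R.act) (fun p q => L [⋀^Fin q]→ₗ[K] R.Og p) where
  d₁ p q :=
    { toFun := fun H => (R.diffO p).compAlternatingMap H
      map_add' := fun _ _ => by ext; simp
      map_smul' := fun _ _ => by ext; simp }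
  d₂ p q := ceDiff (R.der p) q
  ι p :=
    { toFun := fun c => AlternatingMap.constOfIsEmpty K L (Fin 0) (R.incl p c)
      map_add' := fun _ _ => by ext; simp
      map_smul' := fun _ _ => by ext; simp }
  κ q :=
    { toFun := fun l => R.orbit.compAlternatingMap l
      map_add' := fun _ _ => by ext; simp
      map_smul' := fun _ _ => by ext; simp }
  d₁_d₁ p q H := AlternatingMap.ext fun a => R.diffO_diffO (H a)
  d₂_d₂ p q H := by
    -- The statement is known after straightening and is transported back by the inverse `ofTriv`.
    have h1 := R.frame.ceDiff_ceDiff ((R.toTriv p).pullback.compAlternatingMap H)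
    rw [ceDiff_comp (R.der p) _ (R.toTriv p).pullback (R.toTriv_der (p := p)),
      ceDiff_comp (R.der p) _ (R.toTriv p).pullback (R.toTriv_der (p := p))] at h1
    refine AlternatingMap.ext fun a => ?_
    rw [← R.ofTriv_toTriv (ceDiff (R.der p) (q + 1) (ceDiff (R.der p) q H) a)]
    have h2 := DFunLike.congr_fun h1 a
    rw [LinearMap.compAlternatingMap_apply] at h2
    rw [h2]
    exact map_zero _
  comm p q H := (ceDiff_comp (R.der p) (R.der (p + 1)) (R.diffO p) R.der_diffO q H).symm
  ι_injective p c c' h := by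
    have h1 := DFunLike.congr_fun h ![]
    rw [← R.diagO_incl c, ← R.diagO_incl c']
    exact congrArg _ h1
  κ_injective q l l' h := AlternatingMap.ext fun a => by
    have h1 := DFunLike.congr_fun h a
    rw [← R.evalO_orbit (l a), ← R.evalO_orbit (l' a)]
    exact congrArg _ h1
  d₁_ι p c := AlternatingMap.ext fun a => R.diffO_incl c
  d₂_κ q l := ceDiff_comp R.act (R.der 0) R.orbit (fun a v => (R.der_orbit a v).symm) q l
  d₂_ι p c := AlternatingMap.ext fun a => by
    change ceDiff (R.der p) 0 _ a = 0
    rw [ceDiff_zero_apply]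
    exact R.der_incl _ _
  d₁_κ q l := AlternatingMap.ext fun a => R.diffO_orbit (l a)
  row_exact p q H h := ⟨(R.contr p).compAlternatingMap H, AlternatingMap.ext fun a =>
    R.diffO_contr _ (DFunLike.congr_fun h a)⟩
  row_exact_zero q H h := ⟨R.evalO.compAlternatingMap H, AlternatingMap.ext fun a =>
    R.orbit_evalO _ (DFunLike.congr_fun h a)⟩
  col_exact p q H h := by
    change ceDiff (R.der p) (q + 1) H = 0 at h
    obtain ⟨H', hH'⟩ := R.frame.exact ((R.toTriv p).pullback.compAlternatingMap H) (by
      rw [ceDiff_comp (R.der p) _ (R.toTriv p).pullback (R.toTriv_der (p := p)), h]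
      ext a
      simp)
    refine ⟨(R.ofTriv p).pullback.compAlternatingMap H', AlternatingMap.ext fun a => ?_⟩
    have h1 : (R.toTriv p).pullback.compAlternatingMap
        ((R.ofTriv p).pullback.compAlternatingMap H') = H' :=
      AlternatingMap.ext fun a => R.toTriv_ofTriv _
    rw [← R.ofTriv_toTriv (H a), ← R.ofTriv_toTriv (ceDiff (R.der p) q _ a)]
    congr 1
    have h2 := ceDiff_comp (R.der p) (R.frame.der (R.powAct p) R.r) (R.toTriv p).pullback
      (R.toTriv_der (p := p)) q ((R.ofTriv p).pullback.compAlternatingMap H')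
    rw [h1, hH'] at h2
    exact (DFunLike.congr_fun h2 a).symm
  col_exact_zero p H h := by
    change ceDiff (R.der p) 0 H = 0 at h
    have h0 : ∀ a, R.der p a (H ![]) = 0 := fun a => by
      have := DFunLike.congr_fun h ![a]
      rwa [ceDiff_zero_apply] at this
    refine ⟨R.diagO p (H ![]), AlternatingMap.ext fun a => ?_⟩
    rw [Subsingleton.elim a ![]]
    change R.incl p (R.diagO p (H ![])) = H ![]
    generalize H ![] = φ at h0
    obtain ⟨F, k, k', rfl⟩ := eqGerm.exists_rep φ
    refine Subtype.ext ((R.incl_coe (R.diagO_coe (F := F) rfl)).trans (Germ.coe_eq.2 ?_))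
    -- In straightened coordinates `F(x; x₀ y)` does not depend on `y`; comparing `y = x₀⁻¹ g` with
    -- `y = 0` gives `F(x; g) = F(x; x₀)`.
    have h1 := R.frame.eventually_eq_of_der_eq_zero ((R.toTriv p).pullback_LA k)
      ((R.toTriv p).pullback_isEq k') (fun a => by
        rw [← EqMap.pullback_mk _ k k', ← R.toTriv_der, h0, map_zero])
    have t : Tendsto (fun z : (Fin (p + 1) → E) × E => (z.1 0, z.2)) (𝓝 0) (𝓝 0) :=
      Continuous.tendsto' (by fun_prop) _ _ rfl
    have t1 : Tendsto (fun z : (Fin (p + 1) → E) × E => z.1 0) (𝓝 0) (𝓝 0) :=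
      Continuous.tendsto' (by fun_prop) _ _ rfl
    filter_upwards [(R.ofTriv p).tendsto.eventually h1, t.eventually R.mul_inv_cancel_left,
      t1.eventually R.mul_zero] with z e1 e2 e3
    change F (z.1, R.mul (z.1 0) (R.mul (R.inv (z.1 0)) z.2)) = F (z.1, R.mul (z.1 0) 0) at e1
    rw [e2, e3] at e1
    exact e1.symm

end LocRep

end LocRep

end LocAn

end
noncomputable section
namespace LocAn

/-! ### Naturality of the comparison for local groups -/

section LocHom

open Filter Module

set_option linter.unusedSectionVars false

namespace LocRep

variable {K : Type w} [NontriviallyNormedField K] [CompleteSpace K]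
  {E : Type*} [NormedAddCommGroup E] [NormedSpace K E] [FiniteDimensional K E] [CompleteSpace E]
  {L : Type*} [LieRing L] [LieAlgebra K L]
  {V : Type v} [AddCommGroup V] [Module K V] [TopologicalSpace V] [IsTopologicalAddGroup V]
  [T2Space V] [ContinuousSMul K V]
  {E' : Type*} [NormedAddCommGroup E'] [NormedSpace K E'] [FiniteDimensional K E']
  [CompleteSpace E'] {L' : Type*} [LieRing L'] [LieAlgebra K L']
  {V' : Type v} [AddCommGroup V'] [Module K V'] [TopologicalSpace V'] [IsTopologicalAddGroup V']
  [T2Space V'] [ContinuousSMul K V']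

/-- A morphism of germs of representations. -/
structure LocHom (R : LocRep K E V L) (S : LocRep K E' V' L') where
  φ : E → E'
  analyticAt : AnalyticAt K φ 0
  map_zero : φ 0 = 0
  map_mul : ∀ᶠ z in 𝓝 (0 : E × E), φ (R.mul z.1 z.2) = S.mul (φ z.1) (φ z.2)
  T : V' →L[K] V
  map_rep : ∀ᶠ x in 𝓝 (0 : E), ∀ v, T (S.r (φ x) v) = R.r x (T v)
  D : L →ₗ[K] L'
  θ_D : ∀ a, S.θ (D a) = fderiv K φ 0 (R.θ a)

variable {R : LocRep K E V L} {S : LocRep K E' V' L'}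

theorem frame_zero (R : LocRep K E V L) (v : E) : R.frame.B 0 v = v := by
  change fderiv K (R.mul 0) 0 v = v
  rw [Filter.EventuallyEq.fderiv_eq (𝕜 := K) (f := fun x => x) R.zero_mul, fderiv_fun_id]
  rfl

/-- The bracket of related vector fields is related. -/
theorem lieBracket_related {φ : E → E'} {X Y : E → E} {X' Y' : E' → E'} {x : E}
    (hφ : AnalyticAt K φ x) (hX : DifferentiableAt K X x) (hY : DifferentiableAt K Y x)
    (hX' : DifferentiableAt K X' (φ x)) (hY' : DifferentiableAt K Y' (φ x))
    (eX : ∀ᶠ y in 𝓝 x, fderiv K φ y (X y) = X' (φ y))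
    (eY : ∀ᶠ y in 𝓝 x, fderiv K φ y (Y y) = Y' (φ y)) :
    fderiv K φ x (VectorField.lieBracket K X Y x) = VectorField.lieBracket K X' Y' (φ x) := by
  have key : ∀ {Z : E → E} {Z' : E' → E'} (_ : DifferentiableAt K Z x)
      (_ : DifferentiableAt K Z' (φ x)) (_ : ∀ᶠ y in 𝓝 x, fderiv K φ y (Z y) = Z' (φ y)) (v : E),
      fderiv K (fderiv K φ) x v (Z x) + fderiv K φ x (fderiv K Z x v) =
        fderiv K Z' (φ x) (fderiv K φ x v) := by
    intro Z Z' hZ hZ' e v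
    have h1 := (hφ.fderiv.differentiableAt.hasFDerivAt.clm_apply hZ.hasFDerivAt)
    have h2 := hZ'.hasFDerivAt.comp x hφ.differentiableAt.hasFDerivAt
    have h3 := congrArg (fun l => l v) (h1.congr_of_eventuallyEq
      (f₁ := Z' ∘ φ) (e.mono fun y hy => hy.symm) |>.unique h2)
    simp only [add_apply, ContinuousLinearMap.comp_apply, ContinuousLinearMap.flip_apply] at h3
    rw [← h3, add_comm]
  -- The second derivative of `φ` enters both halves of the bracket and cancels by symmetry.
  have hs : IsSymmSndFDerivAt K φ x := hφ.contDiffAt.isSymmSndFDerivAt (n := ω) le_top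
  rw [VectorField.lieBracket_eq, VectorField.lieBracket_eq]
  simp only [map_sub]
  have h1 := key hY hY' eY (X x)
  have h2 := key hX hX' eX (Y x)
  rw [eX.self_of_nhds] at h1
  rw [eY.self_of_nhds] at h2
  rw [← h1, ← h2, hs.eq (X x) (Y x)]
  abel

namespace LocHom

variable (m : LocHom R S)

theorem tendsto : Tendsto m.φ (𝓝 0) (𝓝 0) := by
  have := m.analyticAt.continuousAt
  rwa [ContinuousAt, m.map_zero] at this

/-- Differentiate `φ (x y) = φ x φ y` in `y` at `0`. -/
theorem related (a : L) : ∀ᶠ x in 𝓝 (0 : E),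
    fderiv K m.φ x (R.frame.B x (R.θ a)) = S.frame.B (m.φ x) (S.θ (m.D a)) := by
  have t : Tendsto (fun x : E => (x, (0 : E))) (𝓝 0) (𝓝 0) :=
    Continuous.tendsto' (by fun_prop) _ _ rfl
  have t' : Tendsto (fun x : E' => (x, (0 : E'))) (𝓝 0) (𝓝 0) :=
    Continuous.tendsto' (by fun_prop) _ _ rfl
  filter_upwards [t.eventually m.map_mul.eventually_nhds, R.mul_zero,
    m.analyticAt.eventually_analyticAt, t.eventually R.mulAct.analyticAt_slice,
    (t'.comp m.tendsto).eventually S.mulAct.analyticAt_slice] with x h1 h2 h3 h4 h5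
  have t5 : Tendsto (fun y : E => (x, y)) (𝓝 0) (𝓝 (x, 0)) :=
    Continuous.tendsto' (by fun_prop) _ _ rfl
  have e : fderiv K (m.φ ∘ R.mul x) 0 = fderiv K (S.mul (m.φ x) ∘ m.φ) 0 :=
    Filter.EventuallyEq.fderiv_eq (𝕜 := K) (t5.eventually h1)
  rw [fderiv_comp (𝕜 := K) (f := R.mul x) (g := m.φ) 0 (by rw [h2]; exact h3.differentiableAt)
    h4.differentiableAt, fderiv_comp (𝕜 := K) (f := m.φ) (g := S.mul (m.φ x)) 0
    (by rw [m.map_zero]; exact h5.differentiableAt) m.analyticAt.differentiableAt, h2,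
    m.map_zero] at e
  rw [m.θ_D]
  exact congrArg (fun l => l (R.θ a)) e

/-- Brackets of related fields are related; evaluate at `0`, where both frames are the identity. -/
theorem map_lie (a b : L) : m.D ⁅a, b⁆ = ⁅m.D a, m.D b⁆ := by
  refine S.θ.injective ?_
  have h := lieBracket_related (x := 0) m.analyticAt
    (R.frame.analyticAt_apply (R.θ a)).differentiableAt
    (R.frame.analyticAt_apply (R.θ b)).differentiableAt
    (by rw [m.map_zero]; exact (S.frame.analyticAt_apply (S.θ (m.D a))).differentiableAt)
    (by rw [m.map_zero]; exact (S.frame.analyticAt_apply (S.θ (m.D b))).differentiableAt)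
    (m.related a) (m.related b)
  have h1 := (R.frame.lie a b).self_of_nhds
  have h2 := (S.frame.lie (m.D a) (m.D b)).self_of_nhds
  rw [m.map_zero] at h
  rw [m.θ_D, ← R.frame_zero (R.θ ⁅a, b⁆), ← S.frame_zero (S.θ ⁅m.D a, m.D b⁆)]
  exact (congrArg _ h1).symm.trans (h.trans h2)

/-- Differentiate the equivariance of `T` on orbit maps at `0`. -/
theorem map_act (a : L) (v : V') : m.T (S.act (m.D a) v) = R.act a (m.T v) := by
  rw [S.act_eq, R.act_eq, m.θ_D]
  have e : fderiv K (fun x => m.T (S.r (m.φ x) v)) 0 = fderiv K (fun x => R.r x (m.T v)) 0 :=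
    Filter.EventuallyEq.fderiv_eq (𝕜 := K) (m.map_rep.mono fun x hx => hx v)
  have hLA : LA K (fun x => S.r x v) (m.φ 0) := by rw [m.map_zero]; exact S.r_LA v
  rw [((hLA.comp m.analyticAt).fderiv_clm m.T).self_of_nhds,
    LA.fderiv_comp hLA m.analyticAt.differentiableAt, m.map_zero] at e
  exact congrArg (fun l => l (R.θ a)) e

/-- Application of `φ` to all components of a tuple. -/
theorem analyticAt_comp_pi (ι : Type*) [Fintype ι] :
    AnalyticAt K (fun (x : ι → E) i => m.φ (x i)) 0 := by
  rw [analyticAt_pi_iff]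
  intro i
  exact AnalyticAt.comp (g := m.φ) (f := fun x : ι → E => x i) m.analyticAt
    ((ContinuousLinearMap.proj (R := K) (φ := fun _ : ι => E) i).analyticAt _)

def eqMapC (p : ℕ) : EqMap (S.powAct p) S.r (R.powAct p) R.r where
  f := m.φ
  f_tendsto := m.tendsto
  ψ x i := m.φ (x i)
  analyticAt := m.analyticAt_comp_pi _
  map_zero := funext fun _ => m.map_zero
  map_act := by
    have t : ∀ i, Tendsto (fun z : E × (Fin (p + 1) → E) => (z.1, z.2 i)) (𝓝 0) (𝓝 0) := fun i =>
      Continuous.tendsto' (by fun_prop) _ _ rfl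
    filter_upwards [eventually_all.2 fun i => (t i).eventually m.map_mul] with z hz
    exact funext hz
  T := m.T
  map_rep := m.map_rep

def eqMapO (p : ℕ) : EqMap ((S.powAct p).prod S.mulAct) S.r ((R.powAct p).prod R.mulAct) R.r where
  f := m.φ
  f_tendsto := m.tendsto
  ψ z := (fun i => m.φ (z.1 i), m.φ z.2)
  analyticAt := by
    refine AnalyticAt.prod ?_ ?_
    · exact AnalyticAt.comp (g := fun (x : Fin (p + 1) → E) i => m.φ (x i))
        (f := fun z : (Fin (p + 1) → E) × E => z.1) (m.analyticAt_comp_pi _) analyticAt_fst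
    · exact AnalyticAt.comp (g := m.φ) (f := fun z : (Fin (p + 1) → E) × E => z.2) m.analyticAt
        analyticAt_snd
  map_zero := Prod.ext (funext fun _ => m.map_zero) m.map_zero
  map_act := by
    have t : ∀ i, Tendsto (fun z : E × ((Fin (p + 1) → E) × E) => (z.1, z.2.1 i)) (𝓝 0) (𝓝 0) :=
      fun i => Continuous.tendsto' (by fun_prop) _ _ rfl
    have t' : Tendsto (fun z : E × ((Fin (p + 1) → E) × E) => (z.1, z.2.2)) (𝓝 0) (𝓝 0) :=
      Continuous.tendsto' (by fun_prop) _ _ rfl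
    filter_upwards [eventually_all.2 fun i => (t i).eventually m.map_mul,
      t'.eventually m.map_mul] with z hz hz'
    exact Prod.ext (funext hz) hz'
  T := m.T
  map_rep := m.map_rep

/-- The pullback of germs of cochains. -/
def mapC (p : ℕ) : S.Cg p →ₗ[K] R.Cg p := (m.eqMapC p).pullback

def mapO (p : ℕ) : S.Og p →ₗ[K] R.Og p := (m.eqMapO p).pullback

theorem mapC_coe {p : ℕ} {φ : S.Cg p} {F : (Fin (p + 1) → E') → V'} (h : φ.1 = germL K _ V' F) :
    (m.mapC p φ).1 = germL K _ V fun x => m.T (F fun i => m.φ (x i)) := EqMap.pullback_coe _ h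

theorem mapO_coe {p : ℕ} {φ : S.Og p} {F : (Fin (p + 1) → E') × E' → V'}
    (h : φ.1 = germL K _ V' F) :
    (m.mapO p φ).1 = germL K _ V fun z => m.T (F (fun i => m.φ (z.1 i), m.φ z.2)) :=
  EqMap.pullback_coe _ h

theorem mapC_diffC {p : ℕ} (φ : S.Cg p) :
    m.mapC (p + 1) (S.diffC p φ) = R.diffC p (m.mapC p φ) := by
  obtain ⟨F, -, -, h⟩ := eqGerm.exists_germL φ
  refine Subtype.ext ?_
  rw [m.mapC_coe (S.diffC_coe h), R.diffC_coe (m.mapC_coe h)]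
  congr 1
  ext x
  simp only [map_sum, map_smul]
  rfl

theorem mapO_diffO {p : ℕ} (φ : S.Og p) :
    m.mapO (p + 1) (S.diffO p φ) = R.diffO p (m.mapO p φ) := by
  obtain ⟨F, -, -, h⟩ := eqGerm.exists_germL φ
  refine Subtype.ext ?_
  rw [m.mapO_coe (S.diffO_coe h), R.diffO_coe (m.mapO_coe h)]
  congr 1
  ext x
  simp only [map_sum, map_smul]
  rfl

theorem mapO_incl {p : ℕ} (φ : S.Cg p) : m.mapO p (S.incl p φ) = R.incl p (m.mapC p φ) := by
  obtain ⟨F, -, -, h⟩ := eqGerm.exists_germL φ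
  refine Subtype.ext ?_
  rw [m.mapO_coe (S.incl_coe h), R.incl_coe (m.mapC_coe h)]

theorem mapO_orbit (v : V') : m.mapO 0 (S.orbit v) = R.orbit (m.T v) := by
  refine Subtype.ext ((m.mapO_coe (F := fun z => S.r z.2 v) rfl).trans (Germ.coe_eq.2 ?_))
  have t : Tendsto (fun z : (Fin 1 → E) × E => z.2) (𝓝 0) (𝓝 0) :=
    Continuous.tendsto' (by fun_prop) _ _ rfl
  filter_upwards [t.eventually m.map_rep] with z hz
  exact hz v

theorem mapO_der {p : ℕ} (a : L) (φ : S.Og p) :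
    m.mapO p (S.der p (m.D a) φ) = R.der p a (m.mapO p φ) := by
  refine InvField.pullback_der _ _ _ ?_ φ
  have t : Tendsto (fun z : (Fin (p + 1) → E) × E => z.2) (𝓝 0) (𝓝 0) :=
    Continuous.tendsto' (by fun_prop) _ _ rfl
  filter_upwards [(m.eqMapO p).analyticAt.eventually_analyticAt, t.eventually (m.related a),
    t.eventually m.analyticAt.eventually_analyticAt] with z h1 h2 h3
  have h4 := congrArg (fun l => l (R.frame.B z.2 (R.θ a))) (fderiv_slice h1.differentiableAt)
  have h5 : fderiv K (fun y => (m.eqMapO p).ψ (z.1, y)) z.2 (R.frame.B z.2 (R.θ a)) =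
      (0, fderiv K m.φ z.2 (R.frame.B z.2 (R.θ a))) := by
    change fderiv K (fun y => ((fun i => m.φ (z.1 i)), m.φ y)) z.2 _ = _
    rw [((hasFDerivAt_const (fun i => m.φ (z.1 i)) z.2).prodMk
      h3.differentiableAt.hasFDerivAt).fderiv]
    rfl
  refine h4.symm.trans (h5.trans ?_)
  rw [h2]
  rfl

/-- The induced map on Lie algebra cochains. -/
def mapL (n : ℕ) : (L' [⋀^Fin n]→ₗ[K] V') →ₗ[K] (L [⋀^Fin n]→ₗ[K] V) where
  toFun z := ((m.T : V' →ₗ[K] V).compAlternatingMap z).compLinearMap m.D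
  map_add' _ _ := by ext; simp
  map_smul' _ _ := by ext; simp

end LocHom

variable [CharZero K] [IsUltrametricDist K]

theorem LocHom.mapL_ceDiff (m : LocHom R S) (n : ℕ) (z : L' [⋀^Fin n]→ₗ[K] V') :
    m.mapL (n + 1) (ceDiff S.act n z) = ceDiff R.act n (m.mapL n z) :=
  (ceDiff_map S.act R.act m.D m.map_lie (m.T : V' →ₗ[K] V) m.map_act n z).symm

/-- The isomorphism of van Est for germs. -/
def equiv (R : LocRep K E V L) (n : ℕ) :
    Cohomology (C := fun p => R.Cg p) R.diffC n ≃ₗ[K]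
      Cohomology (C := fun q => L [⋀^Fin q]→ₗ[K] V) (ceDiff R.act) n :=
  Classical.choose (R.double.exists_equiv n)

/-- Following staircases determines the chosen isomorphism, and no other property of it is needed
for naturality. -/
theorem equiv_mk (R : LocRep K E V L) {n : ℕ} (c : R.Cg n) (hc : R.diffC n c = 0)
    (l : L [⋀^Fin n]→ₗ[K] V) (hl : ceDiff R.act n l = 0)
    (h : R.double.Stair l n 0 (R.double.ι n c)) :
    R.equiv n (Cohomology.mk (C := fun p => R.Cg p) R.diffC c hc) =
      Cohomology.mk (C := fun q => L [⋀^Fin q]→ₗ[K] V) (ceDiff R.act) l hl :=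
  Classical.choose_spec (R.double.exists_equiv n) c hc l hl h

/-- Pulling back functions along `φ` and forms along `D` commutes with both differentials and with
both edge inclusions. -/
theorem LocHom.stair_map (m : LocHom R S) {n : ℕ} {l : L' [⋀^Fin n]→ₗ[K] V'} {c : S.Cg n}
    (h : S.double.Stair l n 0 (S.double.ι n c)) :
    R.double.Stair (m.mapL n l) n 0 (R.double.ι n (m.mapC n c)) := by
  let FA : ∀ p q, (L' [⋀^Fin q]→ₗ[K] S.Og p) → (L [⋀^Fin q]→ₗ[K] R.Og p) := fun p q H =>
    ((m.mapO p).compAlternatingMap H).compLinearMap m.D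
  have h₁ : ∀ p q H, FA (p + 1) q (S.double.d₁ p q H) = R.double.d₁ p q (FA p q H) :=
    fun p q H => AlternatingMap.ext fun a => m.mapO_diffO (H fun i => m.D (a i))
  have h₂ : ∀ p q H, FA p (q + 1) (S.double.d₂ p q H) = R.double.d₂ p q (FA p q H) :=
    fun p q H => (ceDiff_map (S.der p) (R.der p) m.D m.map_lie (m.mapO p)
      (fun a φ => m.mapO_der a φ) q H).symm
  have hκ : ∀ q l, FA 0 q (S.double.κ q l) = R.double.κ q (m.mapL q l) :=
    fun q l => AlternatingMap.ext fun a => m.mapO_orbit (l fun i => m.D (a i))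
  have hι : FA n 0 (S.double.ι n c) = R.double.ι n (m.mapC n c) :=
    AlternatingMap.ext fun a => m.mapO_incl c
  rw [← hι]
  exact h.map (D' := R.double) FA (fun q => m.mapL q) h₁ h₂ hκ

theorem LocHom.equiv_natural (m : LocHom R S) {n : ℕ}
    (ξ : Cohomology (C := fun p => S.Cg p) S.diffC n) :
    R.equiv n (Cohomology.map (C := fun p => S.Cg p) (C' := fun p => R.Cg p) m.mapC
      (fun _ => m.mapC_diffC) n ξ) =
    Cohomology.map (C := fun q => L' [⋀^Fin q]→ₗ[K] V') (C' := fun q => L [⋀^Fin q]→ₗ[K] V)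
      m.mapL m.mapL_ceDiff n (S.equiv n ξ) := by
  obtain ⟨⟨c, hc⟩, rfl⟩ := Submodule.Quotient.mk_surjective _ ξ
  rw [LinearMap.mem_ker] at hc
  obtain ⟨l, hl, hst⟩ := S.double.exists_stair_of_mem (n := n) (p := n) (q := 0) (by simp)
    (S.double.ι n c) (by rw [S.double.d₁_ι, hc, _root_.map_zero]) (S.double.d₂_ι _ _)
  have h1 := S.equiv_mk c hc l hl hst
  have h2 := m.stair_map hst
  have h3 := R.equiv_mk (m.mapC n c) (by rw [← m.mapC_diffC, hc, _root_.map_zero]) (m.mapL n l)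
    (by rw [← m.mapL_ceDiff, hl, _root_.map_zero]) h2
  refine h3.trans ?_
  change _ = Cohomology.map (C := fun q => L' [⋀^Fin q]→ₗ[K] V')
    (C' := fun q => L [⋀^Fin q]→ₗ[K] V) m.mapL m.mapL_ceDiff n (S.equiv n
      (Cohomology.mk (C := fun p => S.Cg p) S.diffC c hc))
  rw [h1]
  rfl

end LocRep

end LocHom

end LocAn

end
noncomputable section
namespace LocAn

/-! ### The chart at the unit element of a Lie group -/

section Chart

open Filter VectorField

set_option linter.unusedSectionVars false

variable {K : Type w} [NontriviallyNormedField K] [CompleteSpace K] {d : ℕ}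
  {G : Type*} [Group G] [TopologicalSpace G] [ChartedSpace (Fin d → K) G]

/-- The inverse of the chart at `1`, centred at `0`. -/
def toG (G : Type*) [Group G] [TopologicalSpace G] [ChartedSpace (Fin d → K) G]
    (x : Fin d → K) : G :=
  (chartAt (Fin d → K) (1 : G)).symm (x + chartAt (Fin d → K) (1 : G) 1)

variable (K d) in
/-- The chart at `1`, centred at `0`. -/
def toE (g : G) : Fin d → K := chartAt (Fin d → K) (1 : G) g - chartAt (Fin d → K) (1 : G) 1

variable (K d G) in
/-- The domain of the chart at `1`. -/
def dom : Set G := (chartAt (Fin d → K) (1 : G)).source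

theorem isOpen_dom : IsOpen (dom K d G) := (chartAt (Fin d → K) (1 : G)).open_source

theorem one_mem_dom : (1 : G) ∈ dom K d G := mem_chart_source _ _

theorem toE_one : toE K d (1 : G) = 0 := sub_self _

theorem toG_zero : toG G (0 : Fin d → K) = 1 := by
  rw [toG, zero_add]
  exact (chartAt (Fin d → K) (1 : G)).left_inv (mem_chart_source _ _)

theorem toG_toE {g : G} (hg : g ∈ dom K d G) : toG G (toE K d g) = g := by
  rw [toG, toE, sub_add_cancel]
  exact (chartAt (Fin d → K) (1 : G)).left_inv hg

theorem eventually_target : ∀ᶠ x in 𝓝 (0 : Fin d → K),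
    x + chartAt (Fin d → K) (1 : G) 1 ∈ (chartAt (Fin d → K) (1 : G)).target := by
  have t : Tendsto (fun x => x + chartAt (Fin d → K) (1 : G) 1) (𝓝 0)
      (𝓝 (chartAt (Fin d → K) (1 : G) 1)) := Continuous.tendsto' (by fun_prop) _ _ (zero_add _)
  exact t.eventually ((chartAt (Fin d → K) (1 : G)).open_target.mem_nhds (mem_chart_target _ _))

theorem toE_toG : ∀ᶠ x in 𝓝 (0 : Fin d → K), toG G x ∈ dom K d G ∧ toE K d (toG G x) = x := by
  filter_upwards [eventually_target (G := G)] with x hx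
  refine ⟨(chartAt (Fin d → K) (1 : G)).map_target hx, ?_⟩
  rw [toE, toG, (chartAt (Fin d → K) (1 : G)).right_inv hx, add_sub_cancel_right]

theorem contMDiffAt_toE [IsManifold 𝓘(K, Fin d → K) ω G] {g : G} (hg : g ∈ dom K d G) :
    ContMDiffAt 𝓘(K, Fin d → K) 𝓘(K, Fin d → K) ω (toE K d : G → Fin d → K) g := by
  have h1 : ContMDiffAt 𝓘(K, Fin d → K) 𝓘(K, Fin d → K) ω (extChartAt 𝓘(K, Fin d → K) (1 : G)) g :=
    contMDiffAt_extChartAt' hg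
  have h2 : ContDiff K ω fun x : Fin d → K => x - chartAt (Fin d → K) (1 : G) 1 := by fun_prop
  exact h2.contMDiff.contMDiffAt.comp g h1

theorem contMDiffAt_toG [IsManifold 𝓘(K, Fin d → K) ω G] : ∀ᶠ x in 𝓝 (0 : Fin d → K),
    ContMDiffAt 𝓘(K, Fin d → K) 𝓘(K, Fin d → K) ω (toG G : (Fin d → K) → G) x := by
  filter_upwards [eventually_target (G := G)] with x hx
  have h1 : ContMDiffAt 𝓘(K, Fin d → K) 𝓘(K, Fin d → K) ω
      (extChartAt 𝓘(K, Fin d → K) (1 : G)).symm (x + chartAt (Fin d → K) (1 : G) 1) := by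
    refine (contMDiffOn_extChartAt_symm (1 : G)).contMDiffAt ?_
    have := (chartAt (Fin d → K) (1 : G)).open_target.mem_nhds hx
    simpa using this
  have h2 : ContDiff K ω fun x : Fin d → K => x + chartAt (Fin d → K) (1 : G) 1 := by fun_prop
  exact ContMDiffAt.comp (g := (extChartAt 𝓘(K, Fin d → K) (1 : G)).symm) x h1
    h2.contMDiff.contMDiffAt

theorem tendsto_toG : Tendsto (toG G : (Fin d → K) → G) (𝓝 0) (𝓝 1) := by
  have h1 : ContinuousAt (chartAt (Fin d → K) (1 : G)).symm (chartAt (Fin d → K) (1 : G) 1) :=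
    (chartAt (Fin d → K) (1 : G)).continuousAt_symm (mem_chart_target _ _)
  rw [ContinuousAt, (chartAt (Fin d → K) (1 : G)).left_inv (mem_chart_source _ _)] at h1
  exact h1.comp (Continuous.tendsto' (by fun_prop) _ _ (zero_add _))

/-- The derivative of the centred chart is the identity. -/
theorem mfderiv_toG_zero [IsManifold 𝓘(K, Fin d → K) ω G] (v : Fin d → K) :
    (mfderiv 𝓘(K, Fin d → K) 𝓘(K, Fin d → K) (toG G : (Fin d → K) → G) 0 v : Fin d → K) = v := by
  have h2 : writtenInExtChartAt 𝓘(K, Fin d → K) 𝓘(K, Fin d → K) 0 (toG G : (Fin d → K) → G)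
      =ᶠ[𝓝 0] fun x => x + chartAt (Fin d → K) (1 : G) 1 := by
    filter_upwards [eventually_target (G := G)] with x hx
    simp only [writtenInExtChartAt, toG_zero]
    exact (chartAt (Fin d → K) (1 : G)).right_inv hx
  have h3 : HasFDerivWithinAt (writtenInExtChartAt 𝓘(K, Fin d → K) 𝓘(K, Fin d → K) 0
      (toG G : (Fin d → K) → G)) (ContinuousLinearMap.id K (Fin d → K))
      (Set.range 𝓘(K, Fin d → K)) (extChartAt 𝓘(K, Fin d → K) (0 : Fin d → K) 0) := by
    rw [modelWithCornersSelf_coe, Set.range_id, hasFDerivWithinAt_univ]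
    exact ((hasFDerivAt_id (0 : Fin d → K)).add_const _).congr_of_eventuallyEq h2
  have h4 : HasMFDerivAt 𝓘(K, Fin d → K) 𝓘(K, Fin d → K) (toG G : (Fin d → K) → G) 0
      (by exact ContinuousLinearMap.id K (Fin d → K)) :=
    ⟨(contMDiffAt_toG (G := G)).self_of_nhds.continuousAt, h3⟩
  rw [h4.mfderiv]
  rfl

variable [LieGroup 𝓘(K, Fin d → K) ω G]

variable (K d G) in
/-- The multiplication in the centred chart at `1`. -/
def mulE (x y : Fin d → K) : Fin d → K := toE K d (toG G x * toG G y)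

variable (K d G) in
/-- The inverse in the centred chart at `1`. -/
def invE (x : Fin d → K) : Fin d → K := toE K d (toG G x)⁻¹

theorem analyticAt_mulE :
    AnalyticAt K (fun z : (Fin d → K) × (Fin d → K) => mulE K d G z.1 z.2) 0 := by
  have h0 := (contMDiffAt_toG (K := K) (d := d) (G := G)).self_of_nhds
  have h1 : ContMDiffAt 𝓘(K, (Fin d → K) × (Fin d → K)) 𝓘(K, Fin d → K) ω
      (fun z : (Fin d → K) × (Fin d → K) => toG G z.1) 0 :=
    ContMDiffAt.comp (I' := 𝓘(K, Fin d → K)) (g := toG G) 0 h0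
      contDiff_fst.contMDiff.contMDiffAt
  have h2 : ContMDiffAt 𝓘(K, (Fin d → K) × (Fin d → K)) 𝓘(K, Fin d → K) ω
      (fun z : (Fin d → K) × (Fin d → K) => toG G z.2) 0 :=
    ContMDiffAt.comp (I' := 𝓘(K, Fin d → K)) (g := toG G) 0 h0
      contDiff_snd.contMDiff.contMDiffAt
  have h3 := h1.mul h2
  have h4 : ContMDiffAt 𝓘(K, (Fin d → K) × (Fin d → K)) 𝓘(K, Fin d → K) ω
      (fun z : (Fin d → K) × (Fin d → K) => mulE K d G z.1 z.2) 0 :=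
    ContMDiffAt.comp (g := toE K d) 0 (contMDiffAt_toE (by
      simp only [Prod.fst_zero, Prod.snd_zero, toG_zero, mul_one]; exact one_mem_dom)) h3
  exact h4.contDiffAt.analyticAt

theorem analyticAt_invE : AnalyticAt K (invE K d G) 0 := by
  have h0 := (contMDiffAt_toG (K := K) (d := d) (G := G)).self_of_nhds
  have h4 : ContMDiffAt 𝓘(K, Fin d → K) 𝓘(K, Fin d → K) ω (invE K d G) 0 :=
    ContMDiffAt.comp (g := toE K d) 0 (contMDiffAt_toE (by
      simp only [toG_zero, inv_one]; exact one_mem_dom)) h0.inv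
  exact h4.contDiffAt.analyticAt

theorem tendsto_toG_mul : Tendsto (fun z : (Fin d → K) × (Fin d → K) => toG G z.1 * toG G z.2)
    (𝓝 0) (𝓝 1) := by
  have := topologicalGroup_of_lieGroup 𝓘(K, Fin d → K) ω (G := G)
  have t1 : Tendsto (fun z : (Fin d → K) × (Fin d → K) => toG G z.1) (𝓝 0) (𝓝 1) :=
    tendsto_toG.comp (continuous_fst.tendsto' _ _ rfl)
  have t2 : Tendsto (fun z : (Fin d → K) × (Fin d → K) => toG G z.2) (𝓝 0) (𝓝 1) :=
    tendsto_toG.comp (continuous_snd.tendsto' _ _ rfl)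
  simpa using t1.mul t2

theorem eventually_toG_mulE : ∀ᶠ z in 𝓝 (0 : (Fin d → K) × (Fin d → K)),
    toG G (mulE K d G z.1 z.2) = toG G z.1 * toG G z.2 := by
  filter_upwards [(tendsto_toG_mul (G := G)).eventually
    ((isOpen_dom (K := K) (d := d)).mem_nhds one_mem_dom)] with z hz
  exact toG_toE hz

theorem eventually_toG_invE : ∀ᶠ x in 𝓝 (0 : Fin d → K),
    toG G (invE K d G x) = (toG G x)⁻¹ ∧ (toG G x)⁻¹ ∈ dom K d G := by
  have := topologicalGroup_of_lieGroup 𝓘(K, Fin d → K) ω (G := G)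
  have t1 : Tendsto (fun x : Fin d → K => (toG G x)⁻¹) (𝓝 0) (𝓝 1) := by
    simpa using (tendsto_toG (K := K) (d := d) (G := G)).inv
  filter_upwards [t1.eventually ((isOpen_dom (K := K) (d := d)).mem_nhds one_mem_dom)] with z hz
  exact ⟨toG_toE hz, hz⟩

/-- In finite dimension a one-sided inverse is two-sided; thus only one of the two composites of the
chart and its inverse has to be differentiated. -/
theorem comp_eq_id_comm {E : Type*} [NormedAddCommGroup E] [NormedSpace K E]
    [FiniteDimensional K E] {A B : E →L[K] E} (h : A.comp B = ContinuousLinearMap.id K E) :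
    B.comp A = ContinuousLinearMap.id K E := by
  have h1 : A.toLinearMap * B.toLinearMap = 1 := congrArg ContinuousLinearMap.toLinearMap h
  have h2 := mul_eq_one_comm.1 h1
  ext x
  exact LinearMap.congr_fun h2 x

/-- The left invariant vector fields in the centred chart. -/
theorem mpullback_toG (a : GroupLieAlgebra 𝓘(K, Fin d → K) G) : ∀ᶠ y in 𝓝 (0 : Fin d → K),
    mpullback 𝓘(K, Fin d → K) 𝓘(K, Fin d → K) (toG G) (mulInvariantVectorField a) y =
      fderiv K (mulE K d G y) 0 a := by
  filter_upwards [(toE_toG (K := K) (d := d) (G := G)).eventually_nhds,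
    contMDiffAt_toG (K := K) (d := d) (G := G)] with y h1 h2
  obtain ⟨h3, h4⟩ := h1.self_of_nhds
  have d1 : MDifferentiableAt 𝓘(K, Fin d → K) 𝓘(K, Fin d → K) (toG G : (Fin d → K) → G) y :=
    h2.mdifferentiableAt (by simp)
  have d2 : MDifferentiableAt 𝓘(K, Fin d → K) 𝓘(K, Fin d → K) (toE K d : G → Fin d → K)
    (toG G y) := (contMDiffAt_toE h3).mdifferentiableAt (by simp)
  have e1 : (mfderiv 𝓘(K, Fin d → K) 𝓘(K, Fin d → K) (toE K d : G → Fin d → K) (toG G y)).comp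
      (mfderiv 𝓘(K, Fin d → K) 𝓘(K, Fin d → K) (toG G : (Fin d → K) → G) y) =
      ContinuousLinearMap.id K (TangentSpace 𝓘(K, Fin d → K) y) := by
    rw [← mfderiv_comp y d2 d1, ← mfderiv_id]
    exact Filter.EventuallyEq.mfderiv_eq (h1.mono fun x hx => hx.2)
  have e2 : (mfderiv 𝓘(K, Fin d → K) 𝓘(K, Fin d → K) (toG G : (Fin d → K) → G) y).comp
      (mfderiv 𝓘(K, Fin d → K) 𝓘(K, Fin d → K) (toE K d : G → Fin d → K) (toG G y)) =
      ContinuousLinearMap.id K (TangentSpace 𝓘(K, Fin d → K) (toG G y)) := by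
    exact comp_eq_id_comm (E := Fin d → K)
      (A := mfderiv 𝓘(K, Fin d → K) 𝓘(K, Fin d → K) (toE K d : G → Fin d → K) (toG G y))
      (B := mfderiv 𝓘(K, Fin d → K) 𝓘(K, Fin d → K) (toG G : (Fin d → K) → G) y) e1
  have e3 : (mfderiv 𝓘(K, Fin d → K) 𝓘(K, Fin d → K) (toG G : (Fin d → K) → G) y).inverse =
      mfderiv 𝓘(K, Fin d → K) 𝓘(K, Fin d → K) (toE K d : G → Fin d → K) (toG G y) :=
    ContinuousLinearMap.inverse_eq e2 e1
  -- The base points `toG G 0` and `1`, and `toG G y * 1` and `toG G y`, are only propositionally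
  -- equal; generalising them avoids casts between tangent spaces.
  have e4 : ∀ p, toG G (0 : Fin d → K) = p → ∀ q, toG G y * p = q → q ∈ dom K d G →
      (mfderiv 𝓘(K, Fin d → K) 𝓘(K, Fin d → K) (toE K d : G → Fin d → K) q
        (mfderiv 𝓘(K, Fin d → K) 𝓘(K, Fin d → K) (toG G y * ·) p
          (mfderiv 𝓘(K, Fin d → K) 𝓘(K, Fin d → K) (toG G : (Fin d → K) → G) 0 a)) : Fin d → K) =
        fderiv K (mulE K d G y) 0 a := by
    rintro _ rfl _ rfl hq
    have f1 : MDifferentiableAt 𝓘(K, Fin d → K) 𝓘(K, Fin d → K) (toG G : (Fin d → K) → G) 0 :=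
      (contMDiffAt_toG (G := G)).self_of_nhds.mdifferentiableAt (by simp)
    have f2 : MDifferentiableAt 𝓘(K, Fin d → K) 𝓘(K, Fin d → K) (toG G y * · : G → G)
        (toG G (0 : Fin d → K)) :=
      (contMDiff_mul_left (I := 𝓘(K, Fin d → K)) (n := ω)).contMDiffAt.mdifferentiableAt (by simp)
    have f3 : MDifferentiableAt 𝓘(K, Fin d → K) 𝓘(K, Fin d → K) (toE K d : G → Fin d → K)
        (toG G y * toG G (0 : Fin d → K)) := (contMDiffAt_toE hq).mdifferentiableAt (by simp)
    have f4 := (f3.hasMFDerivAt.comp (toG G (0 : Fin d → K)) f2.hasMFDerivAt).comp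
      (0 : Fin d → K) f1.hasMFDerivAt
    rw [← mfderiv_eq_fderiv]
    exact (congrArg (fun l => l (show TangentSpace 𝓘(K, Fin d → K) (0 : Fin d → K) from a))
      f4.mfderiv).symm
  have e5 := e4 1 toG_zero (toG G y) (mul_one _) h3
  rw [mpullback_apply, e3]
  refine Eq.trans ?_ e5
  refine congrArg (fun b => (mfderiv 𝓘(K, Fin d → K) 𝓘(K, Fin d → K) (toE K d : G → Fin d → K)
    (toG G y) (mfderiv 𝓘(K, Fin d → K) 𝓘(K, Fin d → K) (toG G y * ·) (1 : G) b) : Fin d → K)) ?_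
  exact (mfderiv_toG_zero a).symm

/-- Pullback along the chart commutes with brackets of vector fields, and the bracket of the Lie
algebra is defined through left invariant fields. -/
theorem lieBracket_mulE (a b : GroupLieAlgebra 𝓘(K, Fin d → K) G) : ∀ᶠ y in 𝓝 (0 : Fin d → K),
    lieBracket K (fun y => fderiv K (mulE K d G y) 0 a) (fun y => fderiv K (mulE K d G y) 0 b) y =
      fderiv K (mulE K d G y) 0 (⁅a, b⁆ : GroupLieAlgebra 𝓘(K, Fin d → K) G) := by
  filter_upwards [(mpullback_toG (G := G) a).eventually_nhds,
    (mpullback_toG (G := G) b).eventually_nhds, mpullback_toG (G := G) ⁅a, b⁆,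
    contMDiffAt_toG (K := K) (d := d) (G := G)] with y ha hb hab h2
  have h1 : mpullback 𝓘(K, Fin d → K) 𝓘(K, Fin d → K) (toG G)
      (mlieBracket 𝓘(K, Fin d → K) (mulInvariantVectorField a : ∀ g : G, _)
        (mulInvariantVectorField b)) y = _ :=
    mpullback_mlieBracket (n := ω) (mdifferentiableAt_mulInvariantVectorField a)
      (mdifferentiableAt_mulInvariantVectorField b) h2 (by simp)
  rw [← mulInvariantVector_mlieBracket] at h1
  replace h1 := hab.symm.trans h1
  rw [← mlieBracketWithin_univ, mlieBracketWithin_eq_lieBracketWithin] at h1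
  exact (Filter.EventuallyEq.lieBracket_vectorField_eq ha hb).symm.trans
    ((congrFun lieBracketWithin_univ y).symm.trans h1.symm)

end Chart

end LocAn

end
noncomputable section
namespace LocAn

/-! ### Locally analytic functions in charts -/

section Convert

set_option linter.unusedSectionVars false

variable {K : Type w} [NontriviallyNormedField K]
  {E : Type*} [NormedAddCommGroup E] [NormedSpace K E] {H : Type*} [TopologicalSpace H]
  {M : Type*} [TopologicalSpace M] [ChartedSpace H M]
  {E' : Type*} [NormedAddCommGroup E'] [NormedSpace K E'] {H' : Type*} [TopologicalSpace H']
  {M' : Type*} [TopologicalSpace M'] [ChartedSpace H' M']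
  {N : Type*} [NormedAddCommGroup N] [NormedSpace K N]
  {V : Type v} [AddCommGroup V] [Module K V] [TopologicalSpace V]

theorem IsLocAnalyticAt.LA_comp {I : ModelWithCorners K E H} {f : M → V} {ψ : N → M} {x : N}
    (hf : IsLocAnalyticAt I f (ψ x)) (hψ : ContMDiffAt 𝓘(K, N) I ω ψ x) :
    LA K (fun y => f (ψ y)) x := by
  obtain ⟨W, i1, i2, i3, i4, j, h, -, c, e⟩ := hf
  refine ⟨W, i1, i2, i3, i4, j, fun y => h (ψ y), ?_, hψ.continuousAt.eventually e⟩
  have : ContMDiffAt 𝓘(K, N) 𝓘(K, W) ω (fun y => h (ψ y)) x := c.comp x hψ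
  exact this.contDiffAt.analyticAt

theorem LA.isLocAnalyticAt_comp [T1Space V] {I : ModelWithCorners K E H} {F : N → V} {ψ : M → N}
    {x : M} (hF : LA K F (ψ x)) (hψ : ContMDiffAt I 𝓘(K, N) ω ψ x) :
    IsLocAnalyticAt I (fun y => F (ψ y)) x := by
  obtain ⟨W, i1, i2, i3, i4, j, h, hh, e⟩ := hF
  refine IsLocAnalyticAt.of_factor j (h := fun y => h (ψ y)) ?_ (hψ.continuousAt.eventually e)
  exact hh.contDiffAt.contMDiffAt.comp x hψ

variable {ι : Type*} [Fintype ι]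

theorem contMDiffAt_pi_of {I : ModelWithCorners K E H} {I' : ModelWithCorners K E' H'}
    {f : M' → ι → M} {x : M'} (h : ∀ i, ContMDiffAt I' I ω (fun y => f y i) x) :
    ContMDiffAt I' (ModelWithCorners.pi fun _ : ι => I) ω f x := by
  rw [contMDiffAt_iff]
  exact ⟨continuousAt_pi.2 fun i => (h i).continuousAt,
    contDiffWithinAt_pi.2 fun i => (contMDiffAt_iff.1 (h i)).2⟩

theorem contMDiffAt_eval {I : ModelWithCorners K E H} (x : ι → M) (i : ι) :
    ContMDiffAt (ModelWithCorners.pi fun _ : ι => I) I ω (fun x : ι → M => x i) x := by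
  rw [contMDiffAt_iff]
  refine ⟨(continuous_apply i).continuousAt, ?_⟩
  have h1 := (contMDiffAt_iff.1 (contMDiffAt_id (I := I) (n := ω) (x := x i))).2
  refine ContDiffWithinAt.comp (t := Set.range I) (f := fun y : ι → E => y i)
    (g := extChartAt I (x i) ∘ id ∘ (extChartAt I (x i)).symm) _ h1
    (contDiff_apply K E i).contDiffWithinAt ?_
  rintro _ ⟨y, rfl⟩
  exact ⟨y i, rfl⟩

end Convert

/-! ### The local representation attached to a locally analytic representation -/

section Loc

open Filter

set_option linter.unusedSectionVars false

variable {K : Type w} [NontriviallyNormedField K] [CompleteSpace K] {d : ℕ}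
  {G : Type*} [Group G] [TopologicalSpace G] [ChartedSpace (Fin d → K) G]
  [LieGroup 𝓘(K, Fin d → K) ω G]
  {V : Type v} [AddCommGroup V] [Module K V] [TopologicalSpace V] [IsTopologicalAddGroup V]
  [ContinuousSMul K V] [T2Space V]

variable (K d G) in
/-- The tangent space at `1` in the chart. -/
def lieE : GroupLieAlgebra 𝓘(K, Fin d → K) G ≃ₗ[K] (Fin d → K) where
  toFun a := a
  invFun a := a
  map_add' _ _ := rfl
  map_smul' _ _ := rfl
  left_inv _ := rfl
  right_inv _ := rfl

/-- A locally analytic representation in the chart at `1`. -/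
def locRep {ρ : G →* (V ≃L[K] V)} (hρ : IsLocAnalyticRep d ρ) :
    LocRep K (Fin d → K) V (GroupLieAlgebra 𝓘(K, Fin d → K) G) where
  mul := mulE K d G
  inv := invE K d G
  mul_an := analyticAt_mulE
  inv_an := analyticAt_invE
  inv_zero := by rw [invE, toG_zero, inv_one, toE_one]
  mul_zero := by
    filter_upwards [toE_toG (G := G)] with x hx
    rw [mulE, toG_zero, mul_one, hx.2]
  zero_mul := by
    filter_upwards [toE_toG (G := G)] with x hx
    rw [mulE, toG_zero, one_mul, hx.2]
  mul_assoc := by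
    have t1 : Tendsto (fun z : (Fin d → K) × (Fin d → K) × (Fin d → K) => (z.1, z.2.1)) (𝓝 0)
      (𝓝 0) := Continuous.tendsto' (by fun_prop) _ _ rfl
    have t2 : Tendsto (fun z : (Fin d → K) × (Fin d → K) × (Fin d → K) => z.2) (𝓝 0)
      (𝓝 0) := Continuous.tendsto' (by fun_prop) _ _ rfl
    filter_upwards [t1.eventually (eventually_toG_mulE (G := G)),
      t2.eventually (eventually_toG_mulE (G := G))] with z h1 h2
    rw [mulE, h1, mulE, h2, mul_assoc]
  mul_inv := by
    filter_upwards [eventually_toG_invE (G := G)] with x hx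
    rw [mulE, hx.1, mul_inv_cancel, toE_one]
  inv_mul := by
    filter_upwards [eventually_toG_invE (G := G)] with x hx
    rw [mulE, hx.1, inv_mul_cancel, toE_one]
  r x := (ρ (toG G x) : V →L[K] V)
  r_zero v := by rw [toG_zero, map_one]; rfl
  r_mul := by
    filter_upwards [eventually_toG_mulE (G := G)] with z hz v
    rw [hz, map_mul]
    rfl
  r_LA v := by
    refine IsLocAnalyticAt.LA_comp (f := fun g => ρ g v) (ψ := toG G) ?_
      (contMDiffAt_toG (G := G)).self_of_nhds
    exact hρ v _
  θ := lieE K d G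
  lie := lieBracket_mulE
  act := lieAction d hρ
  act_eq a v := by
    have h1 : LA K (fun x : Fin d → K => ρ (toG G x) v) 0 :=
      IsLocAnalyticAt.LA_comp (f := fun g => ρ g v) (ψ := toG G) (hρ v _)
      (contMDiffAt_toG (G := G)).self_of_nhds
    have h2 : DifferentiableAt K (fun y : Fin d → K => y - chartAt (Fin d → K) (1 : G) 1)
      (chartAt (Fin d → K) (1 : G) 1) := by fun_prop
    have h3 := LA.fderiv_comp (f := fun x : Fin d → K => ρ (toG G x) v)
      (ψ := fun y : Fin d → K => y - chartAt (Fin d → K) (1 : G) 1)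
      (x := chartAt (Fin d → K) (1 : G) 1) (by rwa [sub_self]) h2
    rw [fderiv_sub_const, fderiv_fun_id, sub_self, ContinuousLinearMap.comp_id] at h3
    simp only [toG, sub_add_cancel] at h3
    exact DFunLike.congr_fun h3 (lieE K d G a)

variable {d' : ℕ} {G' : Type*} [Group G'] [TopologicalSpace G'] [ChartedSpace (Fin d' → K) G']
  [LieGroup 𝓘(K, Fin d' → K) ω G']
  {V' : Type v} [AddCommGroup V'] [Module K V'] [TopologicalSpace V'] [IsTopologicalAddGroup V']
  [ContinuousSMul K V'] [T2Space V']

/-- A homomorphism in the charts at `1`. -/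
def homE (φ : G →* G') (x : Fin d → K) : Fin d' → K := toE K d' (φ (toG G x))

theorem tendsto_hom_toG {φ : G →* G'} (hφ : ContMDiff 𝓘(K, Fin d → K) 𝓘(K, Fin d' → K) ω φ) :
    Tendsto (fun x : Fin d → K => φ (toG G x)) (𝓝 0) (𝓝 1) := by
  have := hφ.continuous.tendsto (1 : G)
  rw [map_one] at this
  exact this.comp tendsto_toG

theorem eventually_toG_homE {φ : G →* G'}
    (hφ : ContMDiff 𝓘(K, Fin d → K) 𝓘(K, Fin d' → K) ω φ) :
    ∀ᶠ x in 𝓝 (0 : Fin d → K), toG G' (homE φ x : Fin d' → K) = φ (toG G x) := by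
  filter_upwards [(tendsto_hom_toG hφ).eventually
    ((isOpen_dom (K := K) (d := d')).mem_nhds one_mem_dom)] with x hx
  exact toG_toE hx

theorem analyticAt_homE {φ : G →* G'} (hφ : ContMDiff 𝓘(K, Fin d → K) 𝓘(K, Fin d' → K) ω φ) :
    AnalyticAt K (homE φ : (Fin d → K) → (Fin d' → K)) 0 := by
  have h1 : ContMDiffAt 𝓘(K, Fin d → K) 𝓘(K, Fin d' → K) ω
      (fun x : Fin d → K => φ (toG G x)) 0 :=
    (hφ _).comp 0 (contMDiffAt_toG (G := G)).self_of_nhds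
  have h2 : ContMDiffAt 𝓘(K, Fin d → K) 𝓘(K, Fin d' → K) ω
      (homE φ : (Fin d → K) → (Fin d' → K)) 0 :=
    ContMDiffAt.comp (g := toE K d') 0 (contMDiffAt_toE (by
      simp only [toG_zero, map_one]; exact one_mem_dom)) h1
  exact h2.contDiffAt.analyticAt

/-- The derivative on manifolds is that of the expression of `φ` in the charts at `1`, from which
`homE` differs by translations. -/
theorem fderiv_homE {φ : G →* G'} (hφ : ContMDiff 𝓘(K, Fin d → K) 𝓘(K, Fin d' → K) ω φ)
    (a : GroupLieAlgebra 𝓘(K, Fin d → K) G) :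
    (mfderiv 𝓘(K, Fin d → K) 𝓘(K, Fin d' → K) φ 1 a : Fin d' → K) =
      fderiv K (homE φ : (Fin d → K) → (Fin d' → K)) 0 (lieE K d G a) := by
  have h1 : MDifferentiableAt 𝓘(K, Fin d → K) 𝓘(K, Fin d' → K) φ 1 :=
    (hφ 1).mdifferentiableAt (by simp)
  obtain ⟨X, hX⟩ : ∃ X : (Fin d → K) →L[K] (Fin d' → K),
      X = mfderiv 𝓘(K, Fin d → K) 𝓘(K, Fin d' → K) φ 1 := ⟨_, rfl⟩
  have h2 : HasFDerivWithinAt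
      (writtenInExtChartAt 𝓘(K, Fin d → K) 𝓘(K, Fin d' → K) (1 : G) φ) X
      (Set.range 𝓘(K, Fin d → K)) (extChartAt 𝓘(K, Fin d → K) (1 : G) 1) := by
    rw [hX]
    exact h1.hasMFDerivAt.2
  rw [modelWithCornersSelf_coe, Set.range_id, hasFDerivWithinAt_univ] at h2
  have h3 : HasFDerivAt (fun x : Fin d → K => x + chartAt (Fin d → K) (1 : G) 1)
      (ContinuousLinearMap.id K (Fin d → K)) 0 := (hasFDerivAt_id _).add_const _
  have h4 : HasFDerivAt (homE φ : (Fin d → K) → (Fin d' → K)) _ 0 :=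
    (HasFDerivAt.comp (g := writtenInExtChartAt 𝓘(K, Fin d → K) 𝓘(K, Fin d' → K) (1 : G) φ) 0
      (by rw [zero_add]; exact h2) h3).sub_const (chartAt (Fin d' → K) (1 : G') 1)
      |>.congr_of_eventuallyEq (.of_forall fun x => by
        simp only [writtenInExtChartAt, map_one]
        rfl)
  rw [h4.fderiv, ContinuousLinearMap.comp_id, hX]
  rfl

/-- A morphism of locally analytic representations in the charts at `1`. -/
def locHom {ρ : G →* (V ≃L[K] V)} (hρ : IsLocAnalyticRep d ρ) {ρ' : G' →* (V' ≃L[K] V')}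
    (hρ' : IsLocAnalyticRep d' ρ') {φ : G →* G'}
    (hφ : ContMDiff 𝓘(K, Fin d → K) 𝓘(K, Fin d' → K) ω φ) (T : V' →L[K] V)
    (hT : ∀ g v, T (ρ' (φ g) v) = ρ g (T v)) : LocRep.LocHom (locRep hρ) (locRep hρ') where
  φ := homE φ
  analyticAt := analyticAt_homE hφ
  map_zero := by rw [homE, toG_zero, map_one, toE_one]
  map_mul := by
    have t1 : Tendsto (fun z : (Fin d → K) × (Fin d → K) => z.1) (𝓝 0) (𝓝 0) :=
      Continuous.tendsto' (by fun_prop) _ _ rfl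
    have t2 : Tendsto (fun z : (Fin d → K) × (Fin d → K) => z.2) (𝓝 0) (𝓝 0) :=
      Continuous.tendsto' (by fun_prop) _ _ rfl
    filter_upwards [eventually_toG_mulE (G := G), t1.eventually (eventually_toG_homE hφ),
      t2.eventually (eventually_toG_homE hφ)] with z h1 h2 h3
    change toE K d' (φ (toG G (mulE K d G z.1 z.2))) = toE K d' (_ * _)
    rw [h1, h2, h3, map_mul]
  T := T
  map_rep := by
    filter_upwards [eventually_toG_homE hφ] with x hx v
    change T (ρ' (toG G' (homE φ x : Fin d' → K)) v) = ρ (toG G x) (T v)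
    rw [hx, hT]
  D := (mfderiv 𝓘(K, Fin d → K) 𝓘(K, Fin d' → K) φ 1).toLinearMap
  θ_D a := fderiv_homE hφ a

end Loc

end LocAn

end
noncomputable section
namespace LocAn

/-! ### Small open subgroups -/

section Small

open Filter

set_option linter.unusedSectionVars false

/-- Near `0` the error of the linear approximation is at most `‖z‖`, and in an ultrametric space the
sum of two such terms is no larger. So a map with contracting derivative preserves small balls. -/
theorem eventually_norm_le {K : Type*} [NontriviallyNormedField K]
    {E : Type*} [NormedAddCommGroup E] [NormedSpace K E]
    {F : Type*} [NormedAddCommGroup F] [NormedSpace K F] [IsUltrametricDist F]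
    {f : E → F} {A : E →L[K] F} (hf : HasFDerivAt f A 0) (h0 : f 0 = 0)
    (hA : ∀ z, ‖A z‖ ≤ ‖z‖) : ∀ᶠ z in 𝓝 (0 : E), ‖f z‖ ≤ ‖z‖ := by
  filter_upwards [(hasFDerivAt_iff_isLittleO.1 hf).bound one_pos] with z hz
  rw [h0, sub_zero, sub_zero, one_mul] at hz
  have := IsUltrametricDist.norm_add_le_max (f z - A z) (A z)
  rw [sub_add_cancel] at this
  exact this.trans (max_le hz (hA z))

variable {K : Type w} [NontriviallyNormedField K] [CompleteSpace K] {d : ℕ}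
  {G : Type*} [Group G] [TopologicalSpace G] [ChartedSpace (Fin d → K) G]
  [LieGroup 𝓘(K, Fin d → K) ω G]

theorem mulE_zero : ∀ᶠ x in 𝓝 (0 : Fin d → K), mulE K d G x 0 = x := by
  filter_upwards [toE_toG (G := G)] with x hx
  rw [mulE, toG_zero, mul_one, hx.2]

theorem zero_mulE : ∀ᶠ x in 𝓝 (0 : Fin d → K), mulE K d G 0 x = x := by
  filter_upwards [toE_toG (G := G)] with x hx
  rw [mulE, toG_zero, one_mul, hx.2]

/-- The derivative is determined on the two axes, where multiplication by the unit is the identity.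
-/
theorem hasFDerivAt_mulE :
    HasFDerivAt (fun z : (Fin d → K) × (Fin d → K) => mulE K d G z.1 z.2)
      (ContinuousLinearMap.fst K (Fin d → K) (Fin d → K) + ContinuousLinearMap.snd K _ _) 0 := by
  obtain ⟨A, hA⟩ := (analyticAt_mulE (K := K) (d := d) (G := G)).differentiableAt
  have h1 : HasFDerivAt (fun x : Fin d → K => mulE K d G x 0)
      (A.comp (ContinuousLinearMap.inl K _ _)) 0 :=
    HasFDerivAt.comp (g := fun z : (Fin d → K) × (Fin d → K) => mulE K d G z.1 z.2)
      (f := ContinuousLinearMap.inl K (Fin d → K) (Fin d → K)) 0 (by rw [map_zero]; exact hA)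
      (ContinuousLinearMap.inl K (Fin d → K) (Fin d → K)).hasFDerivAt
  have h2 : HasFDerivAt (fun x : Fin d → K => mulE K d G 0 x)
      (A.comp (ContinuousLinearMap.inr K _ _)) 0 :=
    HasFDerivAt.comp (g := fun z : (Fin d → K) × (Fin d → K) => mulE K d G z.1 z.2)
      (f := ContinuousLinearMap.inr K (Fin d → K) (Fin d → K)) 0 (by rw [map_zero]; exact hA)
      (ContinuousLinearMap.inr K (Fin d → K) (Fin d → K)).hasFDerivAt
  have e1 := h1.unique ((hasFDerivAt_id (𝕜 := K) (0 : Fin d → K)).congr_of_eventuallyEq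
    (mulE_zero (G := G)))
  have e2 := h2.unique ((hasFDerivAt_id (𝕜 := K) (0 : Fin d → K)).congr_of_eventuallyEq
    (zero_mulE (G := G)))
  suffices h : ContinuousLinearMap.fst K (Fin d → K) (Fin d → K) +
      ContinuousLinearMap.snd K _ _ = A by rwa [h]
  refine ContinuousLinearMap.ext fun z => ?_
  have e3 : A (z.1, 0) = z.1 := DFunLike.congr_fun e1 z.1
  have e4 : A (0, z.2) = z.2 := DFunLike.congr_fun e2 z.2
  calc z.1 + z.2 = A (z.1, 0) + A (0, z.2) := by rw [e3, e4]
    _ = A z := by rw [← map_add]; simp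

/-- Differentiate `x x⁻¹ = 1` at the unit. -/
theorem hasFDerivAt_invE :
    HasFDerivAt (invE K d G) (-ContinuousLinearMap.id K (Fin d → K)) 0 := by
  obtain ⟨B, hB⟩ := (analyticAt_invE (K := K) (d := d) (G := G)).differentiableAt
  have h0 : invE K d G 0 = 0 := by rw [invE, toG_zero, inv_one, toE_one]
  have h1 : HasFDerivAt (fun x => mulE K d G x (invE K d G x))
      ((ContinuousLinearMap.fst K (Fin d → K) (Fin d → K) + ContinuousLinearMap.snd K _ _).comp
        ((ContinuousLinearMap.id K (Fin d → K)).prod B)) 0 :=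
    HasFDerivAt.comp (g := fun z : (Fin d → K) × (Fin d → K) => mulE K d G z.1 z.2)
      (f := fun x : Fin d → K => (x, invE K d G x)) 0
      (by rw [h0]; exact hasFDerivAt_mulE) ((hasFDerivAt_id _).prodMk hB)
  have h2 := h1.unique ((hasFDerivAt_const (𝕜 := K) (0 : Fin d → K)
    (0 : Fin d → K)).congr_of_eventuallyEq (by
      filter_upwards [eventually_toG_invE (G := G)] with x hx
      rw [mulE, hx.1, mul_inv_cancel, toE_one]))
  have h3 : B = -ContinuousLinearMap.id K (Fin d → K) :=
    ContinuousLinearMap.ext fun x => eq_neg_of_add_eq_zero_right (DFunLike.congr_fun h2 x)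
  rwa [← h3]

variable (K d) in
/-- The subgroup `U` lies in the ball of radius `r` of the chart at `1`. -/
def IsSmall (r : ℝ) (U : OpenSubgroup G) : Prop := ∀ g ∈ U, g ∈ dom K d G ∧ ‖toE K d g‖ < r

variable [IsUltrametricDist K]

theorem exists_isSmall {r : ℝ} (hr : 0 < r) (U₀ : OpenSubgroup G) :
    ∃ U ≤ U₀, IsSmall K d r U := by
  have hm := eventually_norm_le (hasFDerivAt_mulE (K := K) (d := d) (G := G))
    (by simp [mulE, toG_zero, toE_one]) fun z => by
      have := IsUltrametricDist.norm_add_le_max z.1 z.2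
      exact this
  have hi := eventually_norm_le (hasFDerivAt_invE (K := K) (d := d) (G := G))
    (by simp [invE, toG_zero, toE_one]) fun z => by simp
  obtain ⟨ε₁, h₁, hm'⟩ := Metric.eventually_nhds_iff.1 (hm.and
    ((tendsto_toG_mul (G := G)).eventually ((isOpen_dom (K := K) (d := d)).mem_nhds one_mem_dom)))
  obtain ⟨ε₂, h₂, hi'⟩ := Metric.eventually_nhds_iff.1 (hi.and (eventually_toG_invE (G := G)))
  -- Within `ε₁` products stay in the chart domain and in the ball, within `ε₂` inverses do; the
  -- ball of radius `ε` is then a subgroup.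
  let ε := min r (min ε₁ ε₂)
  have hε : 0 < ε := lt_min hr (lt_min h₁ h₂)
  let U : OpenSubgroup G :=
    { carrier := {g | g ∈ dom K d G ∧ ‖toE K d g‖ < ε}
      one_mem' := ⟨one_mem_dom, by rw [toE_one, norm_zero]; exact hε⟩
      mul_mem' := by
        rintro a b ⟨ha, ha'⟩ ⟨hb, hb'⟩
        have hlt : ‖(toE K d a, toE K d b)‖ < ε := max_lt ha' hb'
        obtain ⟨k1, k2⟩ := @hm' (toE K d a, toE K d b) (by
          rw [dist_zero_right]
          exact hlt.trans_le ((min_le_right _ _).trans (min_le_left _ _)))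
        simp only [mulE, toG_toE ha, toG_toE hb] at k1 k2
        exact ⟨k2, k1.trans_lt hlt⟩
      inv_mem' := by
        rintro a ⟨ha, ha'⟩
        obtain ⟨k1, -, k2⟩ := @hi' (toE K d a) (by
          rw [dist_zero_right]
          exact ha'.trans_le ((min_le_right _ _).trans (min_le_right _ _)))
        simp only [invE, toG_toE ha] at k1 k2
        exact ⟨k2, k1.trans_lt ha'⟩
      isOpen' := by
        have := (chartAt (Fin d → K) (1 : G)).isOpen_inter_preimage
          (s := {x | ‖x - chartAt (Fin d → K) (1 : G) 1‖ < ε})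
          (isOpen_lt (by fun_prop) continuous_const)
        exact this }
  exact ⟨U ⊓ U₀, inf_le_right, fun g hg =>
    ⟨hg.1.1, hg.1.2.trans_le (min_le_left _ _)⟩⟩

end Small

/-! ### Germs of cochains on open subgroups -/

section Germs

open Filter

set_option linter.unusedSectionVars false

variable {K : Type w} [NontriviallyNormedField K] [CompleteSpace K] {d : ℕ}
  {G : Type*} [Group G] [TopologicalSpace G] [ChartedSpace (Fin d → K) G]
  [LieGroup 𝓘(K, Fin d → K) ω G]
  {V : Type v} [AddCommGroup V] [Module K V] [TopologicalSpace V] [IsTopologicalAddGroup V]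
  [ContinuousSMul K V] [T2Space V]

open Classical in
/-- The inverse of the chart at `1`, as a map to an open subgroup. -/
def toU (U : OpenSubgroup G) (x : Fin d → K) : U :=
  if h : toG G x ∈ U then ⟨toG G x, h⟩ else 1

theorem eventually_toU (U : OpenSubgroup G) :
    ∀ᶠ x in 𝓝 (0 : Fin d → K), (toU U x : G) = toG G x := by
  filter_upwards [tendsto_toG.eventually (U.isOpen.mem_nhds U.one_mem)] with x hx
  rw [toU, dif_pos (show toG G x ∈ U from hx)]

theorem toU_of_eq (U : OpenSubgroup G) {x : Fin d → K} {u : U} (h : toG G x = u) : toU U x = u := by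
  have h' : toG G x ∈ U := h ▸ u.2
  rw [toU, dif_pos h']
  exact Subtype.ext h

theorem contMDiffAt_toU (U : OpenSubgroup G) :
    ContMDiffAt 𝓘(K, Fin d → K) 𝓘(K, Fin d → K) ω (toU U : (Fin d → K) → U) 0 := by
  have h : ContMDiffAt 𝓘(K, Fin d → K) 𝓘(K, Fin d → K) ω
      (fun x : Fin d → K => (toU U x : G)) 0 :=
    (contMDiffAt_toG (G := G)).self_of_nhds.congr_of_eventuallyEq (eventually_toU U)
  have h3 := contMDiffAt_iff.1 h
  exact contMDiffAt_iff.2 ⟨Topology.IsInducing.subtypeVal.continuousAt_iff.2 h3.1, h3.2⟩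

theorem eventually_toU_mulE (U : OpenSubgroup G) :
    ∀ᶠ z in 𝓝 (0 : (Fin d → K) × (Fin d → K)),
      toU U (mulE K d G z.1 z.2) = toU U z.1 * toU U z.2 := by
  have t1 : Tendsto (fun z : (Fin d → K) × (Fin d → K) => z.1) (𝓝 0) (𝓝 0) :=
    Continuous.tendsto' (by fun_prop) _ _ rfl
  have t2 : Tendsto (fun z : (Fin d → K) × (Fin d → K) => z.2) (𝓝 0) (𝓝 0) :=
    Continuous.tendsto' (by fun_prop) _ _ rfl
  filter_upwards [eventually_toG_mulE (G := G), t1.eventually (eventually_toU U),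
    t2.eventually (eventually_toU U)] with z h1 h2 h3
  refine toU_of_eq U ?_
  rw [h1, Subgroup.coe_mul, h2, h3]

theorem eventually_pi {ι N : Type*} [Finite ι] [TopologicalSpace N] [Zero N] {p : N → Prop}
    (h : ∀ᶠ x in 𝓝 (0 : N), p x) : ∀ᶠ x in 𝓝 (0 : ι → N), ∀ i, p (x i) :=
  eventually_all.2 fun i =>
    ((continuous_apply i).tendsto' (0 : ι → N) (0 : N) rfl).eventually h

variable {ρ : G →* (V ≃L[K] V)} (hρ : IsLocAnalyticRep d ρ)

/-- The germ of an analytic cochain on an open subgroup. -/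
def germC (U : OpenSubgroup G) (p : ℕ) : anCochain d (resRep ρ U) p →ₗ[K] (locRep hρ).Cg p where
  toFun f := eqGerm.mk (fun x => f.1 fun i => toU U (x i))
    (by
      refine IsLocAnalyticAt.LA_comp (f := f.1)
        (ψ := fun (x : Fin (p + 1) → Fin d → K) i => toU U (x i)) (f.2.1 _) ?_
      refine contMDiffAt_pi_of fun i => ?_
      exact ContMDiffAt.comp (I' := 𝓘(K, Fin d → K)) (g := toU U)
        (f := fun x : Fin (p + 1) → Fin d → K => x i) 0 (contMDiffAt_toU U)
        (contDiff_apply K (Fin d → K) i).contMDiff.contMDiffAt)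
    (by
      have t : ∀ i, Tendsto (fun z : (Fin d → K) × (Fin (p + 1) → Fin d → K) => (z.1, z.2 i))
          (𝓝 0) (𝓝 0) := fun i => Continuous.tendsto' (by fun_prop) _ _ rfl
      have t1 : Tendsto (fun z : (Fin d → K) × (Fin (p + 1) → Fin d → K) => z.1) (𝓝 0) (𝓝 0) :=
        Continuous.tendsto' (by fun_prop) _ _ rfl
      filter_upwards [eventually_all.2 fun i => (t i).eventually (eventually_toU_mulE U),
        t1.eventually (eventually_toU U)] with z h1 h2
      have h3 := f.2.2 (toU U z.1) fun i => toU U (z.2 i)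
      simp only [← h1] at h3
      refine h3.trans ?_
      change ρ (toU U z.1 : G) _ = ρ (toG G z.1) _
      rw [h2])
  map_add' _ _ := rfl
  map_smul' _ _ := rfl

theorem germC_coe (U : OpenSubgroup G) {p : ℕ} (f : anCochain d (resRep ρ U) p) :
    (germC hρ U p f).1 = germL K _ V fun x => f.1 fun i => toU U (x i) := rfl

theorem germC_anDiff (U : OpenSubgroup G) (p : ℕ) (f : anCochain d (resRep ρ U) p) :
    germC hρ U (p + 1) (anDiff d (resRep ρ U) p f) = (locRep hρ).diffC p (germC hρ U p f) :=
  Subtype.ext (((locRep hρ).diffC_coe (germC_coe hρ U f)).symm)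

/-- The map from the cohomology of an open subgroup to the cohomology of germs. -/
def germH (U : OpenSubgroup G) (n : ℕ) : anCohomology d (resRep ρ U) n →ₗ[K]
    Cohomology (C := fun p => (locRep hρ).Cg p) (locRep hρ).diffC n :=
  Cohomology.map (C := fun p => anCochain d (resRep ρ U) p) (C' := fun p => (locRep hρ).Cg p)
    (germC hρ U) (germC_anDiff hρ U) n

/-- The extension of a germ to a small open subgroup. -/
theorem exists_anCochain {p : ℕ} (φ : (locRep hρ).Cg p) :
    ∃ r > 0, ∀ U : OpenSubgroup G, IsSmall K d r U →
      ∃ f : anCochain d (resRep ρ U) p, germC hρ U p f = φ := by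
  obtain ⟨F, hF, hF', h⟩ := eqGerm.exists_germL φ
  obtain ⟨r₁, h₁, k₁⟩ := Metric.eventually_nhds_iff.1 hF.eventually
  obtain ⟨r₂, h₂, k₂⟩ := Metric.eventually_nhds_iff.1 hF'
  -- Within `r₁` the representative is locally analytic, within `r₂` it is equivariant. For the sup
  -- norm it suffices to bound each component, so on tuples from a small `U` the function is a
  -- genuine cochain.
  refine ⟨min r₁ r₂, lt_min h₁ h₂, fun U hU => ?_⟩
  have hn : ∀ u : Fin (p + 1) → U, ‖fun i => toE K d (u i : G)‖ < min r₁ r₂ := fun u =>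
    (pi_norm_lt_iff (lt_min h₁ h₂)).2 fun i => (hU _ (u i).2).2
  refine ⟨⟨fun u => F fun i => toE K d (u i : G), fun u => ?_, fun g u => ?_⟩, ?_⟩
  · refine LA.isLocAnalyticAt_comp (F := F)
      (ψ := fun (u : Fin (p + 1) → U) i => toE K d (u i : G)) (k₁ ?_) ?_
    · rw [dist_zero_right]
      exact (hn u).trans_le (min_le_left _ _)
    · have : ∀ i, ContMDiffAt (ModelWithCorners.pi fun _ : Fin (p + 1) => 𝓘(K, Fin d → K))
          𝓘(K, Fin d → K) ω (fun u : Fin (p + 1) → U => toE K d (u i : G)) u := fun i => by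
        have e1 : ContMDiff 𝓘(K, Fin d → K) 𝓘(K, Fin d → K) ω
          (Subtype.val : ↥(U : TopologicalSpace.Opens G) → G) := contMDiff_subtype_val
        have e2 : ContMDiffAt 𝓘(K, Fin d → K) 𝓘(K, Fin d → K) ω
          (fun g : U => toE K d (g : G)) (u i) :=
          ContMDiffAt.comp (g := toE K d) (u i) (contMDiffAt_toE (hU _ (u i).2).1) (e1 (u i))
        exact ContMDiffAt.comp (g := fun g : U => toE K d (g : G)) u e2 (contMDiffAt_eval u i)
      exact contMDiffAt_pi_space.2 this
  · have e := @k₂ (toE K d (g : G), fun i => toE K d (u i : G)) (by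
      rw [dist_zero_right]
      exact (max_lt (hU _ g.2).2 (hn u)).trans_le (min_le_right _ _))
    have e1 : ((locRep hρ).powAct p).act (toE K d (g : G)) (fun i => toE K d (u i : G)) =
        fun i => toE K d ((g * u i : U) : G) := by
      ext1 i
      change toE K d (toG G (toE K d (g : G)) * toG G (toE K d (u i : G))) = _
      rw [toG_toE (hU _ g.2).1, toG_toE (hU _ (u i).2).1]
      rfl
    refine (congrArg F e1.symm).trans (e.trans ?_)
    change ρ (toG G (toE K d (g : G))) _ = ρ (g : G) _
    rw [toG_toE (hU _ g.2).1]
  · refine Subtype.ext ?_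
    rw [germC_coe, h, germL_eq_iff]
    filter_upwards [eventually_pi (ι := Fin (p + 1)) (eventually_toU (K := K) U),
      eventually_pi (ι := Fin (p + 1)) (toE_toG (K := K) (G := G))] with x h3 h4
    congr 1
    ext1 i
    rw [h3, (h4 i).2]

/-- A cochain with trivial germ vanishes on a small open subgroup. -/
theorem eq_zero_of_germC {U : OpenSubgroup G} {p : ℕ} {f : anCochain d (resRep ρ U) p}
    (hf : germC hρ U p f = 0) : ∃ r > 0, ∀ U' : OpenSubgroup G, IsSmall K d r U' →
      ∀ x : Fin (p + 1) → U, (∀ i, (x i : G) ∈ U') → f.1 x = 0 := by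
  have h1 : (fun x : Fin (p + 1) → Fin d → K => f.1 fun i => toU U (x i)) =ᶠ[𝓝 0] fun _ => 0 :=
    (germL_eq_iff (K := K)).1 (congrArg Subtype.val hf)
  obtain ⟨r, hr, k⟩ := Metric.eventually_nhds_iff.1 h1
  refine ⟨r, hr, fun U' hU' x hx => ?_⟩
  have e := @k (fun i => toE K d (x i : G)) (by
    rw [dist_zero_right]
    exact (pi_norm_lt_iff hr).2 fun i => (hU' _ (hx i)).2)
  refine Eq.trans (congrArg f.1 (funext fun i => ?_)) e
  exact (toU_of_eq U (toG_toE (hU' _ (hx i)).1)).symm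

variable {d' : ℕ} {G' : Type*} [Group G'] [TopologicalSpace G'] [ChartedSpace (Fin d' → K) G']
  [LieGroup 𝓘(K, Fin d' → K) ω G']
  {V' : Type v} [AddCommGroup V'] [Module K V'] [TopologicalSpace V'] [IsTopologicalAddGroup V']
  [ContinuousSMul K V'] [T2Space V']

/-- The germ of the pullback of a cochain. -/
theorem germC_anCochainMap {ρ' : G' →* (V' ≃L[K] V')} (hρ' : IsLocAnalyticRep d' ρ')
    {φ : G →* G'} (hφ : ContMDiff 𝓘(K, Fin d → K) 𝓘(K, Fin d' → K) ω φ) (T : V' →L[K] V)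
    (hT : ∀ g v, T (ρ' (φ g) v) = ρ g (T v)) (U : OpenSubgroup G) (U' : OpenSubgroup G')
    (h : ∀ g ∈ U, φ g ∈ U') {p : ℕ} (f : anCochain d' (resRep ρ' U') p) :
    germC hρ U p (anCochainMap (ρ := resRep ρ U) (resHom φ U U' h) (contMDiff_resHom hφ U U' h) T
      (fun g v => hT g v) p f) = (locHom hρ hρ' hφ T hT).mapC p (germC hρ' U' p f) := by
  refine Subtype.ext ?_
  rw [LocRep.LocHom.mapC_coe _ (germC_coe hρ' U' f), germC_coe, germL_eq_iff]
  filter_upwards [eventually_pi (ι := Fin (p + 1)) (eventually_toU (K := K) U),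
    eventually_pi (ι := Fin (p + 1)) (eventually_toG_homE hφ)] with x h1 h2
  refine congrArg (fun y => T (f.1 y)) (funext fun i => ?_)
  refine (toU_of_eq U' ?_).symm
  change toG G' (homE φ (x i) : Fin d' → K) = φ (toU U (x i) : G)
  rw [h1, h2]

theorem germH_resMap {ρ' : G' →* (V' ≃L[K] V')} (hρ' : IsLocAnalyticRep d' ρ')
    {φ : G →* G'} (hφ : ContMDiff 𝓘(K, Fin d → K) 𝓘(K, Fin d' → K) ω φ) (T : V' →L[K] V)
    (hT : ∀ g v, T (ρ' (φ g) v) = ρ g (T v)) (U : OpenSubgroup G) (U' : OpenSubgroup G')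
    (h : ∀ g ∈ U, φ g ∈ U') {n : ℕ} (x : anCohomology d' (resRep ρ' U') n) :
    germH hρ U n (resMap φ hφ T hT U U' h n x) =
      Cohomology.map (C := fun p => (locRep hρ').Cg p) (C' := fun p => (locRep hρ).Cg p)
        (locHom hρ hρ' hφ T hT).mapC (fun _ => (locHom hρ hρ' hφ T hT).mapC_diffC) n
        (germH hρ' U' n x) := by
  obtain ⟨⟨f, hf⟩, rfl⟩ := Submodule.Quotient.mk_surjective _ x
  refine congrArg Submodule.Quotient.mk (Subtype.ext ?_)
  exact germC_anCochainMap hρ hρ' hφ T hT U U' h f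

theorem germC_res {U U' : OpenSubgroup G} (h : U ≤ U') {p : ℕ}
    (f : anCochain d (resRep ρ U') p) :
    germC hρ U p (anCochainMap (ρ := resRep ρ U) (resHom (MonoidHom.id G) U U' fun _ hg => h hg)
      (contMDiff_resHom contMDiff_id U U' fun _ hg => h hg) (ContinuousLinearMap.id K V)
      (fun _ _ => rfl) p f) = germC hρ U' p f := by
  refine Subtype.ext ?_
  rw [germC_coe, germC_coe, germL_eq_iff]
  filter_upwards [eventually_pi (ι := Fin (p + 1)) (eventually_toU (K := K) U)] with x h1
  refine congrArg f.1 (funext fun i => ?_)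
  exact (toU_of_eq U' (h1 i).symm).symm

theorem germH_resOpen {U U' : OpenSubgroup G} (h : U ≤ U') {n : ℕ}
    (x : anCohomology d (resRep ρ U') n) : germH hρ U n (resOpen ρ h n x) = germH hρ U' n x := by
  obtain ⟨⟨f, hf⟩, rfl⟩ := Submodule.Quotient.mk_surjective _ x
  refine congrArg Submodule.Quotient.mk (Subtype.ext ?_)
  exact germC_res hρ h f

end Germs

end LocAn

end
noncomputable section
namespace LocAn

theorem Cohomology.mk_eq_zero_iff {K : Type*} [Field K] {C : ℕ → Type*}
    [∀ n, AddCommGroup (C n)] [∀ n, Module K (C n)] {d : ∀ n, C n →ₗ[K] C (n + 1)} {n : ℕ}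
    (z : C n) (hz : d n z = 0) : Cohomology.mk d z hz = 0 ↔ z ∈ coboundaries d n :=
  Submodule.Quotient.mk_eq_zero _

/-! ### The colimit over the open subgroups -/

section Colimit

set_option linter.unusedSectionVars false

variable {K : Type w} [NontriviallyNormedField K] [CompleteSpace K] {d : ℕ}
  {G : Type*} [Group G] [TopologicalSpace G] [ChartedSpace (Fin d → K) G]
  [LieGroup 𝓘(K, Fin d → K) ω G]
  {V : Type v} [AddCommGroup V] [Module K V] [TopologicalSpace V] [IsTopologicalAddGroup V]
  [ContinuousSMul K V] [T2Space V]
  {ρ : G →* (V ≃L[K] V)}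

/-- The restriction of cochains to a smaller open subgroup. -/
def resC (d : ℕ) [ChartedSpace (Fin d → K) G] (ρ : G →* (V ≃L[K] V)) {U U' : OpenSubgroup G}
    (h : U ≤ U') (p : ℕ) : anCochain d (resRep ρ U') p →ₗ[K] anCochain d (resRep ρ U) p :=
  anCochainMap (ρ := resRep ρ U) (resHom (MonoidHom.id G) U U' fun _ hg => h hg)
    (contMDiff_resHom contMDiff_id U U' fun _ hg => h hg) (ContinuousLinearMap.id K V)
    (fun _ _ => rfl) p

theorem resC_anDiff {U U' : OpenSubgroup G} (h : U ≤ U') {p : ℕ}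
    (f : anCochain d (resRep ρ U') p) :
    resC d ρ h (p + 1) (anDiff d (resRep ρ U') p f) =
      anDiff d (resRep ρ U) p (resC d ρ h p f) := rfl

theorem resC_resC {U U' U'' : OpenSubgroup G} (h : U ≤ U') (h' : U' ≤ U'') {p : ℕ}
    (f : anCochain d (resRep ρ U'') p) :
    resC d ρ h p (resC d ρ h' p f) = resC d ρ (h.trans h') p f := rfl

variable (hρ : IsLocAnalyticRep d ρ)

theorem germC_resC {U U' : OpenSubgroup G} (h : U ≤ U') {p : ℕ}
    (f : anCochain d (resRep ρ U') p) : germC hρ U p (resC d ρ h p f) = germC hρ U' p f :=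
  germC_res hρ h f

variable [IsUltrametricDist K]

theorem exists_germC_eq {p : ℕ} (φ : (locRep hρ).Cg p) (U₀ : OpenSubgroup G) :
    ∃ U ≤ U₀, ∃ f : anCochain d (resRep ρ U) p, germC hρ U p f = φ := by
  obtain ⟨r, hr, H⟩ := exists_anCochain hρ φ
  obtain ⟨U, hU, hs⟩ := exists_isSmall (K := K) (d := d) hr U₀
  exact ⟨U, hU, H U hs⟩

theorem exists_resC_eq_zero {U : OpenSubgroup G} {p : ℕ} {f : anCochain d (resRep ρ U) p}
    (hf : germC hρ U p f = 0) : ∃ (U' : OpenSubgroup G) (h : U' ≤ U), resC d ρ h p f = 0 := by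
  obtain ⟨r, hr, H⟩ := eq_zero_of_germC hρ hf
  obtain ⟨U', hU, hs⟩ := exists_isSmall (K := K) (d := d) hr U
  exact ⟨U', hU, Subtype.ext (funext fun x => H U' hs _ fun i => (x i).2)⟩

/-- A lift of a cocycle of germs to an open subgroup need not be a cocycle, but its differential has
trivial germ and vanishes after restriction. -/
theorem exists_germH_eq {n : ℕ}
    (ξ : Cohomology (C := fun p => (locRep hρ).Cg p) (locRep hρ).diffC n) :
    ∃ (U : OpenSubgroup G) (x : anCohomology d (resRep ρ U) n), germH hρ U n x = ξ := by
  obtain ⟨⟨φ, hφ⟩, rfl⟩ := Submodule.Quotient.mk_surjective _ ξ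
  obtain ⟨U, -, f, rfl⟩ := exists_germC_eq hρ φ ⊤
  have h1 : germC hρ U (n + 1) (anDiff d (resRep ρ U) n f) = 0 := by
    rw [germC_anDiff]
    exact hφ
  obtain ⟨U', h, h2⟩ := exists_resC_eq_zero hρ h1
  refine ⟨U', Cohomology.mk (C := fun p => anCochain d (resRep ρ U') p) _ (resC d ρ h n f) h2, ?_⟩
  exact congrArg Submodule.Quotient.mk (Subtype.ext (germC_resC hρ h f))

theorem exists_resOpen_eq_zero {n : ℕ} {U : OpenSubgroup G} {x : anCohomology d (resRep ρ U) n}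
    (hx : germH hρ U n x = 0) :
    ∃ (U' : OpenSubgroup G) (h : U' ≤ U), resOpen ρ h n x = 0 := by
  obtain ⟨⟨f, hf⟩, rfl⟩ := Submodule.Quotient.mk_surjective _ x
  have hx' := (Cohomology.mk_eq_zero_iff (C := fun p => (locRep hρ).Cg p)
    (germC hρ U n f) (by rw [← germC_anDiff, LinearMap.mem_ker.1 hf, map_zero])).1 hx
  suffices h : ∃ (U' : OpenSubgroup G) (h : U' ≤ U), resC d ρ h n f ∈
      coboundaries (C := fun p => anCochain d (resRep ρ U') p) (anDiff d (resRep ρ U')) n by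
    obtain ⟨U', h, h'⟩ := h
    exact ⟨U', h, (Cohomology.mk_eq_zero_iff (C := fun p => anCochain d (resRep ρ U') p)
      (resC d ρ h n f) (by rw [← resC_anDiff, LinearMap.mem_ker.1 hf, map_zero])).2 h'⟩
  cases n with
  | zero =>
    obtain ⟨U', h, h'⟩ := exists_resC_eq_zero hρ (f := f) hx'
    exact ⟨U', h, h'⟩
  | succ n =>
    obtain ⟨φ, hφ⟩ := hx'
    obtain ⟨U₁, h₁, k, rfl⟩ := exists_germC_eq hρ φ U
    -- A primitive of the germ lifts to `k` on `U₁`; it becomes a primitive of `f` once the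
    -- difference, whose germ is trivial, has been restricted to `0`.
    have h2 : germC hρ U₁ (n + 1) (resC d ρ h₁ (n + 1) f - anDiff d (resRep ρ U₁) n k) = 0 := by
      rw [map_sub, germC_resC, germC_anDiff, hφ, sub_self]
    obtain ⟨U', h, h'⟩ := exists_resC_eq_zero hρ h2
    rw [map_sub, sub_eq_zero, resC_anDiff, resC_resC] at h'
    exact ⟨U', h.trans h₁, resC d ρ h n k, h'.symm⟩

open Classical in
/-- The map from the colimit to the cohomology of germs. -/
def colimGerm (n : ℕ) : colimAnCohomology d ρ n →ₗ[K]
    Cohomology (C := fun p => (locRep hρ).Cg p) (locRep hρ).diffC n :=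
  Module.DirectLimit.lift K _ _ _ (fun U => germH hρ (OrderDual.ofDual U) n)
    (fun _ _ h x => germH_resOpen hρ h x)

variable (d ρ) in
open Classical in
/-- The map from the cohomology of an open subgroup to the colimit. -/
def toColim (n : ℕ) (U : OpenSubgroup G) :
    anCohomology d (resRep ρ U) n →ₗ[K] colimAnCohomology d ρ n :=
  Module.DirectLimit.of K (OpenSubgroup G)ᵒᵈ
    (fun U => anCohomology d (resRep ρ (OrderDual.ofDual U)) n)
    (fun U U' h => resOpen ρ (U := OrderDual.ofDual U') (U' := OrderDual.ofDual U) h n)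
    (OrderDual.toDual U)

open Classical in
theorem colimGerm_toColim {n : ℕ} (U : OpenSubgroup G) (x : anCohomology d (resRep ρ U) n) :
    colimGerm hρ n (toColim d ρ n U x) = germH hρ U n x :=
  Module.DirectLimit.lift_of _ _ _

open Classical in
theorem toColim_resOpen {n : ℕ} {U U' : OpenSubgroup G} (h : U ≤ U')
    (x : anCohomology d (resRep ρ U') n) :
    toColim d ρ n U (resOpen ρ h n x) = toColim d ρ n U' x :=
  Module.DirectLimit.of_f (R := K) (ι := (OpenSubgroup G)ᵒᵈ)
    (G := fun U => anCohomology d (resRep ρ (OrderDual.ofDual U)) n)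
    (f := fun U U' h => resOpen ρ (U := OrderDual.ofDual U') (U' := OrderDual.ofDual U) h n)
    (i := OrderDual.toDual U') (j := OrderDual.toDual U) (hij := h)

open Classical in
theorem exists_toColim {n : ℕ} (ξ : colimAnCohomology d ρ n) :
    ∃ (U : OpenSubgroup G) (x : anCohomology d (resRep ρ U) n), toColim d ρ n U x = ξ :=
  let ⟨U, x, hx⟩ := Module.DirectLimit.exists_of ξ
  ⟨OrderDual.ofDual U, x, hx⟩

/-- The colimit is the cohomology of germs. -/
def colimEquiv (n : ℕ) : colimAnCohomology d ρ n ≃ₗ[K]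
    Cohomology (C := fun p => (locRep hρ).Cg p) (locRep hρ).diffC n :=
  LinearEquiv.ofBijective (colimGerm hρ n) (by
    constructor
    · rw [injective_iff_map_eq_zero]
      intro ξ hξ
      obtain ⟨U, x, rfl⟩ := exists_toColim ξ
      rw [colimGerm_toColim] at hξ
      obtain ⟨U', h, hx⟩ := exists_resOpen_eq_zero hρ hξ
      rw [← toColim_resOpen h, hx, map_zero]
    · intro ξ
      obtain ⟨U, x, rfl⟩ := exists_germH_eq hρ ξ
      exact ⟨_, colimGerm_toColim hρ U x⟩)

variable {d' : ℕ} {G' : Type*} [Group G'] [TopologicalSpace G'] [ChartedSpace (Fin d' → K) G']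
  [LieGroup 𝓘(K, Fin d' → K) ω G']
  {V' : Type v} [AddCommGroup V'] [Module K V'] [TopologicalSpace V'] [IsTopologicalAddGroup V']
  [ContinuousSMul K V'] [T2Space V']

/-- It suffices to compare classes that come from one open subgroup `U`, where both sides are
computed by the germ of the pullback to the preimage of `U`. -/
theorem colimEquiv_colimMap {ρ' : G' →* (V' ≃L[K] V')} (hρ' : IsLocAnalyticRep d' ρ')
    {φ : G →* G'} (hφ : ContMDiff 𝓘(K, Fin d → K) 𝓘(K, Fin d' → K) ω φ) (T : V' →L[K] V)
    (hT : ∀ g v, T (ρ' (φ g) v) = ρ g (T v)) {n : ℕ} (ξ : colimAnCohomology d' ρ' n) :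
    colimEquiv hρ n (colimMap φ hφ T hT n ξ) =
      Cohomology.map (C := fun p => (locRep hρ').Cg p) (C' := fun p => (locRep hρ).Cg p)
        (locHom hρ hρ' hφ T hT).mapC (fun _ => (locHom hρ hρ' hφ T hT).mapC_diffC) n
        (colimEquiv hρ' n ξ) := by
  obtain ⟨U, x, rfl⟩ := exists_toColim ξ
  have h1 : colimMap φ hφ T hT n (toColim d' ρ' n U x) =
      toColim d ρ n (U.comap φ hφ.continuous) (resMap φ hφ T hT _ U (fun _ hg => hg) n x) := by
    classical
    exact Module.DirectLimit.lift_of _ _ _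
  have h2 : colimEquiv hρ' n (toColim d' ρ' n U x) = germH hρ' U n x := colimGerm_toColim hρ' U x
  rw [h1, h2]
  exact (colimGerm_toColim hρ _ _).trans (germH_resMap hρ hρ' hφ T hT _ U _ x)

end Colimit

end LocAn

end

/-! ### The comparison isomorphism and its naturality. -/

theorem mainTheorem1 (K : Type w) [NontriviallyNormedField K] [IsUltrametricDist K]
    [CompleteSpace K] [CharZero K] :
    ∃ Φ : ∀ (R : LocAn.LocAnRep.{w, u, v} K) (n : ℕ), R.colimH n ≃ₗ[K] R.lieH n,
      ∀ (R S : LocAn.LocAnRep.{w, u, v} K) (m : LocAn.LocAnRep.Hom R S) (n : ℕ)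
        (ξ : S.colimH n)
        (z : GroupLieAlgebra 𝓘(K, Fin S.dim → K) S.G [⋀^Fin n]→ₗ[K] S.V)
        (hz : S.lieD n z = 0), Φ S n ξ = LocAn.Cohomology.mk S.lieD z hz →
        ∃ hz' : R.lieD n (m.lieCochainMap n z) = 0,
          Φ R n (m.colimMap n ξ) = LocAn.Cohomology.mk R.lieD (m.lieCochainMap n z) hz' := by
  refine ⟨fun R n => (LocAn.colimEquiv R.locAnalytic n).trans
    ((LocAn.locRep R.locAnalytic).equiv n), fun R S m n ξ z hz h => ?_⟩
  let M := LocAn.locHom R.locAnalytic S.locAnalytic m.contMDiff m.T m.map_smul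
  have hz' : R.lieD n (m.lieCochainMap n z) = 0 := by
    -- The map on Lie algebra cochains is by definition that of the morphism of germs `M`, so it
    -- commutes with the differentials.
    refine (M.mapL_ceDiff n z).symm.trans ?_
    refine (congrArg (M.mapL (n + 1)) hz).trans (map_zero _)
  refine ⟨hz', ?_⟩
  have h1 := congrArg ((LocAn.locRep R.locAnalytic).equiv n)
    (LocAn.colimEquiv_colimMap R.locAnalytic S.locAnalytic m.contMDiff m.T m.map_smul ξ)
  refine h1.trans ((M.equiv_natural _).trans ?_)
  exact congrArg (LocAn.Cohomology.map _ M.mapL_ceDiff n) h
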